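/- Let $(E,\mathcal E)$ be a measurable space, and let $\mathcal M_{\mathbb R}(E)$ be the set of finite signed measures on $E$ with the $\sigma$-field generated by $\mu\mapsto\mu(A)$, $A\in\mathcal E$. Let $x\mapsto\mathcal L(R_x)$ be a probability kernel from $E$ to $\mathcal M_{\mathbb R}(E)$ (the replacement kernel), where each random signed measure $R_x$ is a.s. positive on $E\setminus\{x\}$, i.e. a.s. $R_x(A)\ge 0$ for all $A\in\mathcal E$ with $x\notin A$. For a finite non-zero positive measure $\mathfrak m_0$ on $E$, the measure-valued Pólya process (MVPP) with initial composition $\mathfrak m_0$ and replacement kernel $R$ consists of random variables $Y_n\in E$ and $R^{(n)}_{Y_n}\in\mathcal M_{\mathbb R}(E)$, $n\ge1$, with $\mathfrak m_n=\mathfrak m_0+\sum_{i=1}^nR^{(i)}_{Y_i}$, such that, with $\mathcal F_n=\sigma(Y_i,R^{(i)}_{Y_i}:1\le i\le n)$ and $\tilde{\mathfrak m}_n=\mathfrak m_n/\mathfrak m_n(E)$: conditionally on $\mathcal F_n$, $Y_{n+1}$ has distribution $\tilde{\mathfrak m}_n$; and conditionally on $\mathcal F_n$ and $Y_{n+1}=y$,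 $R^{(n+1)}_{Y_{n+1}}$ has distribution $\mathcal L(R_y)$. The process is assumed tenable: a.s. $\mathfrak m_n$ is a non-zero positive measure for all $n\ge0$. Write $\mu f=\int f\,d\mu$, let $|\mu|$ be the total variation measure, and let $\mathbf R_x(A)=\mathbb E[R_x(A)]$. Let $W:E\to[1,\infty)$ be measurable, $q>2$, $V=W^q$. Assume: (B) for all $x\in E$, $R_x(E)=1$ a.s.; (H) (i) there are $\vartheta\in(0,1)$ and $C_1\ge0$ with $\mathbf R_xV\le\vartheta V(x)+C_1$ (in particular $\mathbf R_xV$ is finite) for all $x\in E$; (ii) there is $C_2>0$ with $\mathbb E[(|R_x|W)^q]\le C_2W(x)^q$ for all $x\in E$; (iii) $\mathfrak m_0V<\infty$; (N) $\nu$ is a probability measure on $E$ with $\nu\mathbf R=\nu$, i.e. $\int_E\mathbf R_x(A)\,d\nu(x)=\nu(A)$ for all $A\in\mathcal E$, and $\nu V<\infty$. For a function $w\geq 1$, let $B(w)$ be the complex Banach space of measurable $g:E\to\mathbb C$ with $\|g\|_{B(w)}=\sup_x|g(x)|/w(x)<\infty$. By (H)(ii), $\mathbf R f(x)=\mathbf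 R_xf$ defines a bounded operator $\mathbf R$ on $B(W)$. A bounded operator $T$ on a complex Banach space is called spectrally-large quasi-compact (slqc) if $1$ is an isolated point of its spectrum $\sigma(T)$ whose spectral projection has rank $1$, and $\mathrm{Re}\,\lambda<1$ for all $\lambda\in\sigma(T)\setminus\{1\}$. For a closed subspace $D\subseteq B(W)$ with $\mathbf R(D)\subseteq D$, let $\mathbf R_D$ be the restriction of $\mathbf R$ to $D$, let $\theta_D=\sup\mathrm{Re}(\sigma(\mathbf R_D)\setminus\{1\})\in[-\infty,\infty)$ (with $\sup\emptyset=-\infty$), and let $\theta=\theta_{B(W)}$. **Theorem.** Let $D$ be a closed subspace of $B(W)$ with $\mathbf R(D)\subseteq D$ and $1\in D$, such that $\mathbf R_D$ is slqc. (a) Then $\theta_D<1$, and for every real $\delta\in(0,1-\theta_D)$ there is a constant $C_\delta$, which does not depend on $\mathfrak m_0$, such that for all $f\in D$ and all $n\ge1$, $f$ is a.s. $\tilde{\mathfrak m}_n$-integrable, $\tilde{\mathfrak m}_nf\in L^2$ and $$\mathbb E|\tilde{\mathfrak m}_nf-\nu f|^2\le C_\delta\,\tilde{\mathfrak m}_0V\left(\frac{\mathfrak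 m_0(E)+1}{\mathfrak m_0(E)+n}\right)^{\min(2\delta,1)}\|f\|_{B(W)}^2 .$$ If moreover $\delta<1/2$, then for every $f\in D$, $n^\delta|\tilde{\mathfrak m}_nf-\nu f|\to0$ a.s. as $n\to\infty$. (b) If in addition $\mathbf R$ is slqc on $B(W)$, then $\theta<1$, and for every real $\delta\in(0,1-\theta)$ there is a constant $C_\delta$, which does not depend on $\mathfrak m_0$, such that for all $f\in B(W^2)$ and all $n\ge1$, $f$ is a.s. $\tilde{\mathfrak m}_n$-integrable, $\tilde{\mathfrak m}_nf\in L^1$ and $$\mathbb E|\tilde{\mathfrak m}_nf-\nu f|\le C_\delta\,\tilde{\mathfrak m}_0V\left(\frac{\mathfrak m_0(E)+1}{\mathfrak m_0(E)+n}\right)^{\min(2\delta,1)\frac{q/2-1}{q-1}}\|f\|_{B(W^2)} .$$ -/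

import Mathlib

open MeasureTheory ProbabilityTheory Filter Topology
open scoped ENNReal NNReal

universe u v

namespace MVPP

section Weighted

variable {E : Type u} [MeasurableSpace E]

/-- A weight function: a measurable function `W : E → [1, ∞)`. -/
structure Weight (E : Type u) [MeasurableSpace E] where
  toFun : E → ℝ
  measurable' : Measurable toFun
  one_le' : ∀ x, 1 ≤ toFun x

instance : CoeFun (Weight E) (fun _ => E → ℝ) := ⟨Weight.toFun⟩

theorem Weight.pos (W : Weight E) (x : E) : 0 < W x := lt_of_lt_of_le one_pos (W.one_le' x)

/-- The weight `W ^ k`. -/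
def Weight.pow (W : Weight E) (k : ℕ) : Weight E where
  toFun x := W x ^ k
  measurable' := W.measurable'.pow_const k
  one_le' x := one_le_pow₀ (W.one_le' x)

/-- Measurable `g : E → ℂ` with `|g| ≤ C W` for some `C`. -/
def boundedSubmodule (W : Weight E) : Submodule ℂ (E → ℂ) where
  carrier := {g | Measurable g ∧ ∃ C : ℝ, ∀ x, ‖g x‖ ≤ C * W x}
  add_mem' := by
    rintro f g ⟨hf, C, hC⟩ ⟨hg, C', hC'⟩
    refine ⟨hf.add hg, C + C', fun x => ?_⟩
    rw [add_mul]
    exact (norm_add_le _ _).trans (add_le_add (hC x) (hC' x))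
  zero_mem' := ⟨measurable_const, 0, fun x => by simp⟩
  smul_mem' := by
    rintro c f ⟨hf, C, hC⟩
    refine ⟨hf.const_smul c, ‖c‖ * C, fun x => ?_⟩
    rw [Pi.smul_apply, norm_smul, mul_assoc]
    exact mul_le_mul_of_nonneg_left (hC x) (norm_nonneg _)

/-- The complex Banach space `B(W)` of measurable `g : E → ℂ` with
`‖g‖ = sup_x |g x| / W x < ∞`. -/
def BW (W : Weight E) : Type u := ↥(boundedSubmodule W)

variable {W : Weight E}

noncomputable instance : AddCommGroup (BW W) :=
  inferInstanceAs (AddCommGroup ↥(boundedSubmodule W))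

noncomputable instance : Module ℂ (BW W) :=
  inferInstanceAs (Module ℂ ↥(boundedSubmodule W))

namespace BW

/-- The underlying function. -/
def toFun (f : BW W) : E → ℂ := Subtype.val (p := fun g => g ∈ boundedSubmodule W) f

instance : CoeFun (BW W) (fun _ => E → ℂ) := ⟨toFun⟩

/-- Construct an element of `B(W)`. -/
def mk (g : E → ℂ) (hg : Measurable g) (C : ℝ) (hC : ∀ x, ‖g x‖ ≤ C * W x) : BW W :=
  Subtype.mk (p := fun g => g ∈ boundedSubmodule W) g ⟨hg, C, hC⟩

@[simp] theorem mk_apply (g : E → ℂ) (hg : Measurable g) (C : ℝ) (hC : ∀ x, ‖g x‖ ≤ C * W x)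
    (x : E) : (mk g hg C hC : BW W) x = g x := rfl

@[ext] theorem ext {f g : BW W} (h : ∀ x, f x = g x) : f = g := Subtype.ext (funext h)

@[simp] theorem add_apply (f g : BW W) (x : E) : (f + g) x = f x + g x := rfl

@[simp] theorem neg_apply (f : BW W) (x : E) : (-f) x = -f x := rfl

@[simp] theorem sub_apply (f g : BW W) (x : E) : (f - g) x = f x - g x := rfl

@[simp] theorem smul_apply (c : ℂ) (f : BW W) (x : E) : (c • f) x = c * f x := rfl

@[simp] theorem zero_apply (x : E) : (0 : BW W) x = 0 := rfl

theorem measurable (f : BW W) : Measurable (f : E → ℂ) := f.2.1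

noncomputable instance : Norm (BW W) := ⟨fun f => ⨆ x, ‖f x‖ / W x⟩

theorem norm_def (f : BW W) : ‖f‖ = ⨆ x, ‖f x‖ / W x := rfl

theorem bddAbove (f : BW W) : BddAbove (Set.range fun x => ‖f x‖ / W x) := by
  obtain ⟨C, hC⟩ := f.2.2
  refine ⟨C, ?_⟩
  rintro _ ⟨x, rfl⟩
  exact (div_le_iff₀ (W.pos x)).2 (hC x)

theorem le_norm (f : BW W) (x : E) : ‖f x‖ ≤ ‖f‖ * W x :=
  (div_le_iff₀ (W.pos x)).1 (le_ciSup (bddAbove f) x)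

theorem norm_nonneg' (f : BW W) : 0 ≤ ‖f‖ :=
  Real.iSup_nonneg fun x => div_nonneg (norm_nonneg _) (W.pos x).le

theorem norm_le_of (f : BW W) {C : ℝ} (hC : 0 ≤ C) (h : ∀ x, ‖f x‖ ≤ C * W x) : ‖f‖ ≤ C :=
  Real.iSup_le (fun x => (div_le_iff₀ (W.pos x)).2 (h x)) hC

theorem normCore : NormedSpace.Core ℂ (BW W) where
  norm_nonneg := norm_nonneg'
  norm_smul c f := by
    rw [norm_def, norm_def, Real.mul_iSup_of_nonneg (norm_nonneg c)]
    congr 1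
    funext x
    rw [smul_apply, norm_mul, mul_div_assoc]
  norm_triangle f g := by
    refine norm_le_of _ (add_nonneg (norm_nonneg' f) (norm_nonneg' g)) fun x => ?_
    rw [add_apply, add_mul]
    exact (norm_add_le _ _).trans (add_le_add (le_norm f x) (le_norm g x))
  norm_eq_zero_iff f := by
    constructor
    · intro h
      ext x
      have := le_norm f x
      rw [h, zero_mul] at this
      simpa using this
    · rintro rfl
      simp [norm_def]

noncomputable instance : NormedAddCommGroup (BW W) := NormedAddCommGroup.ofCore normCore

noncomputable instance : NormedSpace ℂ (BW W) := NormedSpace.ofCore normCore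

/-- The constant function `1`. -/
noncomputable instance : One (BW W) :=
  ⟨mk (fun _ => 1) measurable_const 1 fun x => by simpa using W.one_le' x⟩

@[simp] theorem one_apply (x : E) : (1 : BW W) x = 1 := rfl

instance : CompleteSpace (BW W) := by
  refine Metric.complete_of_cauchySeq_tendsto fun u hu => ?_
  have hpt : ∀ x, CauchySeq fun n => u n x := by
    intro x
    refine Metric.cauchySeq_iff.2 fun ε hε => ?_
    obtain ⟨N, hN⟩ := Metric.cauchySeq_iff.1 hu (ε / W x) (div_pos hε (W.pos x))
    refine ⟨N, fun m hm n hn => ?_⟩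
    rw [dist_eq_norm]
    have h1 := le_norm (u m - u n) x
    have h2 := hN m hm n hn
    rw [dist_eq_norm, lt_div_iff₀ (W.pos x)] at h2
    exact lt_of_le_of_lt h1 h2
  choose g hg using fun x => cauchySeq_tendsto_of_complete (hpt x)
  have hunif : ∀ ε > 0, ∃ N, ∀ n ≥ N, ∀ x, ‖u n x - g x‖ ≤ ε * W x := by
    intro ε hε
    obtain ⟨N, hN⟩ := Metric.cauchySeq_iff.1 hu ε hε
    refine ⟨N, fun n hn x => ?_⟩
    refine le_of_tendsto ((tendsto_const_nhds.sub (hg x)).norm) ?_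
    filter_upwards [eventually_ge_atTop N] with m hm
    have h2 := hN n hn m hm
    rw [dist_eq_norm] at h2
    exact (le_norm (u n - u m) x).trans (mul_le_mul_of_nonneg_right h2.le (W.pos x).le)
  have hgm : Measurable g :=
    measurable_of_tendsto_metrizable (fun n => (u n).measurable) (tendsto_pi_nhds.2 hg)
  obtain ⟨N, hN⟩ := hunif 1 one_pos
  refine ⟨mk g hgm (‖u N‖ + 1) fun x => ?_, ?_⟩
  · have h1 := hN N le_rfl x
    have h2 := le_norm (u N) x
    have h3 : ‖g x‖ ≤ ‖u N x‖ + ‖u N x - g x‖ := by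
      have := norm_sub_le (u N x) (u N x - g x)
      simpa using this
    rw [add_mul]
    linarith
  · refine Metric.tendsto_atTop.2 fun ε hε => ?_
    obtain ⟨N, hN⟩ := hunif (ε / 2) (half_pos hε)
    refine ⟨N, fun n hn => ?_⟩
    rw [dist_eq_norm]
    refine lt_of_le_of_lt (norm_le_of _ (half_pos hε).le fun x => ?_) (half_lt_self hε)
    exact hN n hn x

end BW

end Weighted

section Spectral

variable {X : Type*} [NormedAddCommGroup X] [NormedSpace ℂ X]

/-- The Riesz integral `(2πi)⁻¹ ∮ (z - T)⁻¹ dz` over the circle of centre `c` and radius `r`. When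
`c` is the only point of the spectrum in the closed disc, this is the spectral projection of `T`
at `c`. -/
noncomputable def rieszIntegral (T : X →L[ℂ] X) (c : ℂ) (r : ℝ) : X →L[ℂ] X :=
  (2 * (Real.pi : ℂ) * Complex.I)⁻¹ • ∮ z in C(c, r), resolvent T z

/-- Spectrally-large quasi-compact operators: `1` is an isolated point of the spectrum, its spectral
projection has rank one, and the rest of the spectrum lies in `Re z < 1`. -/
structure IsSLQC (T : X →L[ℂ] X) : Prop where
  isolated_rank_one : ∃ r : ℝ, 0 < r ∧ spectrum ℂ T ∩ Metric.closedBall 1 r = {1} ∧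
    Module.finrank ℂ (rieszIntegral T 1 r).range = 1
  re_lt_one : ∀ z ∈ spectrum ℂ T, z ≠ 1 → z.re < 1

/-- `sup Re (σ(T) \ {1})`, with `sup ∅ = -∞`. -/
noncomputable def specBound (T : X →L[ℂ] X) : EReal :=
  sSup ((fun z : ℂ => (z.re : EReal)) '' (spectrum ℂ T \ {1}))

end Spectral

section Urn

variable {E : Type u} [MeasurableSpace E]

/-- The σ-field on finite signed measures generated by the evaluations `μ ↦ μ A`, `A` measurable. -/
instance instMeasurableSpaceSignedMeasure : MeasurableSpace (SignedMeasure E) :=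
  ⨆ (A : Set E) (_ : MeasurableSet A),
    MeasurableSpace.comap (fun μ : SignedMeasure E => μ A) inferInstance

theorem measurable_eval {A : Set E} (hA : MeasurableSet A) :
    Measurable (fun μ : SignedMeasure E => μ A) :=
  Measurable.of_comap_le (le_iSup₂_of_le A hA le_rfl)

/-- A replacement kernel `x ↦ 𝓛(R_x)` is a probability kernel from `E` to finite signed measures.
`R_x` is a.s. positive off `x`. -/
def PositiveOffDiagonal (R : Kernel E (SignedMeasure E)) : Prop :=
  ∀ x, ∀ᵐ μ ∂(R x), ∀ A, MeasurableSet A → x ∉ A → 0 ≤ μ A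

/-- `R_x(E) = 1` a.s. -/
def IsBalanced (R : Kernel E (SignedMeasure E)) : Prop :=
  ∀ x, ∀ᵐ μ ∂(R x), μ Set.univ = 1

open Classical in
/-- The mean measure of a random signed measure with law `ρ`: the signed measure
`A ↦ E[R(A)]` (the value `0` is used when this is not a signed measure). -/
noncomputable def expectedMeasure (ρ : Measure (SignedMeasure E)) : SignedMeasure E :=
  if h : ∃ m : SignedMeasure E, ∀ A, MeasurableSet A → m A = ∫ μ, μ A ∂ρ then h.choose else 0

/-- The mean replacement `A ↦ E[R_x(A)]`. -/
noncomputable def meanKernel (R : Kernel E (SignedMeasure E)) (x : E) : SignedMeasure E :=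
  expectedMeasure (R x)

open Classical in
/-- The bounded operator `f ↦ (x ↦ ∫ f d(E R_x))` on `B(W)`; that it is
well defined under the moment bound below is `meanOperator_apply`. -/
noncomputable def meanOperator (R : Kernel E (SignedMeasure E)) (W : Weight E) : BW W →L[ℂ] BW W :=
  if h : ∃ T : BW W →L[ℂ] BW W, ∀ f x, T f x = ∫ᵛ y, f y ∂<•(meanKernel R x) then h.choose else 0

/-- Drift condition `∫ V d(E R_x) ≤ ϑ V(x) + C` for `V = W ^ q`. -/
def LyapunovDrift (R : Kernel E (SignedMeasure E)) (W : Weight E) (q : ℝ) : Prop :=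
  ∃ ϑ C : ℝ, 0 < ϑ ∧ ϑ < 1 ∧ 0 ≤ C ∧ ∀ x,
    (meanKernel R x).Integrable (fun y => W y ^ q) ∧
    ∫ᵛ y, W y ^ q ∂<•(meanKernel R x) ≤ ϑ * W x ^ q + C

/-- Moment bound `E[(|R_x| W) ^ q] ≤ C W(x) ^ q`. -/
def MomentBound (R : Kernel E (SignedMeasure E)) (W : Weight E) (q : ℝ) : Prop :=
  ∃ C : ℝ, 0 < C ∧ ∀ x,
    ∫⁻ μ, (∫⁻ y, ENNReal.ofReal (W y) ∂μ.variation) ^ q ∂(R x) ≤ ENNReal.ofReal (C * W x ^ q)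

theorem lintegral_variation_expectedMeasure_le {ρ : Measure (SignedMeasure E)}
    {m : SignedMeasure E} (hm : ∀ A, MeasurableSet A → m A = ∫ μ, μ A ∂ρ) (φ : E → ℝ≥0∞) :
    ∫⁻ y, φ y ∂m.variation ≤ ∫⁻ μ, ∫⁻ y, φ y ∂(μ.variation) ∂ρ := by
  have key : ∀ A, MeasurableSet A → m.variation A ≤ ∫⁻ μ, μ.variation A ∂ρ := by
    intro A hA
    refine le_of_forall_lt fun a ha => ?_
    obtain ⟨Q, hQ1, hQ2, hQ3, hQ4⟩ := m.exists_lt_sum_of_lt_variation hA ha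
    refine hQ4.trans_le ?_
    calc ∑ p ∈ Q, ‖m p‖ₑ ≤ ∑ p ∈ Q, ∫⁻ μ, ‖μ p‖ₑ ∂ρ := by
          refine Finset.sum_le_sum fun p hp => ?_
          rw [hm p (hQ3 p hp)]
          exact enorm_integral_le_lintegral_enorm _
      _ = ∫⁻ μ, ∑ p ∈ Q, ‖μ p‖ₑ ∂ρ :=
          (lintegral_finsetSum _ fun p hp => (measurable_eval (hQ3 p hp)).enorm).symm
      _ ≤ ∫⁻ μ, μ.variation A ∂ρ := lintegral_mono fun μ => μ.le_variation hA hQ1 hQ2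
  rw [lintegral]
  refine iSup₂_le fun g hg => ?_
  have hsum : ∀ s : Finset ℝ≥0∞, ∑ c ∈ s, c * m.variation (g ⁻¹' {c})
      ≤ ∫⁻ μ, ∑ c ∈ s, c * μ.variation (g ⁻¹' {c}) ∂ρ := by
    classical
    intro s
    induction s using Finset.induction_on with
    | empty => simp
    | insert c s hc ih =>
      simp only [Finset.sum_insert hc]
      refine le_trans (add_le_add ?_ ih) (le_lintegral_add _ _)
      refine le_trans ?_ (lintegral_const_mul_le _ _)
      gcongr
      exact key _ (g.measurableSet_fiber c)
  refine (hsum g.range).trans (lintegral_mono fun μ => ?_)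
  have h1 : ∫⁻ y, g y ∂μ.variation ≤ ∫⁻ y, φ y ∂μ.variation := lintegral_mono hg
  exact (SimpleFunc.lintegral_eq_lintegral g μ.variation).symm.le.trans h1

theorem expectedMeasure_apply {ρ : Measure (SignedMeasure E)}
    (h : ∫⁻ μ, μ.variation Set.univ ∂ρ ≠ ∞) {A : Set E} (hA : MeasurableSet A) :
    expectedMeasure ρ A = ∫ μ, μ A ∂ρ := by
  classical
  suffices hex : ∃ m : SignedMeasure E, ∀ A, MeasurableSet A → m A = ∫ μ, μ A ∂ρ by
    rw [expectedMeasure, dif_pos hex]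
    exact hex.choose_spec A hA
  refine ⟨⟨fun A => if MeasurableSet A then ∫ μ, μ A ∂ρ else 0, by simp,
    fun A hA => if_neg hA, fun f hf hd => ?_⟩, fun A hA => if_pos hA⟩
  simp only [hf, MeasurableSet.iUnion hf, if_true]
  have hle : ∑' i, ∫⁻ μ : SignedMeasure E, ‖μ (f i)‖ₑ ∂ρ ≠ ∞ := by
    refine ne_top_of_le_ne_top h ?_
    rw [← lintegral_tsum fun i => (measurable_eval (hf i)).enorm.aemeasurable]
    refine lintegral_mono fun μ => ?_
    calc ∑' i, ‖μ (f i)‖ₑ ≤ ∑' i, μ.variation (f i) :=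
          ENNReal.tsum_le_tsum fun i => μ.enorm_measure_le_variation _
      _ = μ.variation (⋃ i, f i) := (measure_iUnion hd hf).symm
      _ ≤ μ.variation Set.univ := measure_mono (Set.subset_univ _)
  have hint : ∀ i, Integrable (fun μ : SignedMeasure E => μ (f i)) ρ := fun i =>
    ⟨(measurable_eval (hf i)).aestronglyMeasurable,
      lt_top_iff_ne_top.2 (ENNReal.ne_top_of_tsum_ne_top hle i)⟩
  have hsm : Summable fun i => ∫ μ : SignedMeasure E, ‖μ (f i)‖ ∂ρ := by
    have := ENNReal.summable_toReal hle
    refine this.congr fun i => ?_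
    exact (integral_norm_eq_lintegral_enorm (hint i).1).symm
  have := hasSum_integral_of_summable_integral_norm hint hsm
  have heq : ∫ μ : SignedMeasure E, μ (⋃ i, f i) ∂ρ
      = ∫ μ : SignedMeasure E, ∑' i, μ (f i) ∂ρ :=
    integral_congr_ae (Eventually.of_forall fun μ =>
      ((VectorMeasure.m_iUnion' μ hf hd).tsum_eq).symm)
  rw [heq]
  exact this

theorem lintegral_lintegral_variation_le {R : Kernel E (SignedMeasure E)} [IsMarkovKernel R]
    {W : Weight E} {q : ℝ} (hq : 1 ≤ q) (h : MomentBound R W q) :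
    ∃ K : ℝ, 0 ≤ K ∧ ∀ x,
      ∫⁻ μ, ∫⁻ y, ENNReal.ofReal (W y) ∂(μ.variation) ∂(R x) ≤ ENNReal.ofReal (K * W x) := by
  obtain ⟨C, hC, hb⟩ := h
  refine ⟨C + 1, by positivity, fun x => ?_⟩
  have hq0 : 0 < q := by linarith
  have hW := W.pos x
  -- rescale so that the elementary bound `t ≤ 1 + t ^ q` gives the factor `W x`
  have hel : ∀ t : ℝ≥0∞, t ≤ ENNReal.ofReal (W x) +
      t ^ q * ENNReal.ofReal (W x ^ (1 - q)) := by
    intro t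
    rcases eq_or_ne t ∞ with rfl | ht
    · rw [ENNReal.top_rpow_of_pos hq0, ENNReal.top_mul]
      · simp
      · simpa using Real.rpow_pos_of_pos hW _
    · lift t to ℝ≥0 using ht
      rcases le_total (t : ℝ) (W x) with hle | hle
      · refine le_add_right ?_
        rw [← ENNReal.ofReal_coe_nnreal]
        exact ENNReal.ofReal_le_ofReal hle
      · refine le_add_left ?_
        rw [← ENNReal.ofReal_coe_nnreal (p := t), ENNReal.ofReal_rpow_of_nonneg t.coe_nonneg hq0.le,
          ← ENNReal.ofReal_mul (Real.rpow_nonneg t.coe_nonneg _)]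
        refine ENNReal.ofReal_le_ofReal ?_
        have ht0 : (0 : ℝ) < t := hW.trans_le hle
        have h1 : (t : ℝ) ^ (1 - q) ≤ W x ^ (1 - q) :=
          Real.rpow_le_rpow_of_nonpos hW hle (by linarith)
        calc (t : ℝ) = (t : ℝ) ^ q * (t : ℝ) ^ (1 - q) := by
              rw [← Real.rpow_add ht0]; simp
          _ ≤ _ := mul_le_mul_of_nonneg_left h1 (Real.rpow_nonneg t.coe_nonneg _)
  calc ∫⁻ μ, ∫⁻ y, ENNReal.ofReal (W y) ∂(μ.variation) ∂(R x)
      ≤ ∫⁻ μ, (ENNReal.ofReal (W x) + (∫⁻ y, ENNReal.ofReal (W y) ∂(μ.variation)) ^ q *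
          ENNReal.ofReal (W x ^ (1 - q))) ∂(R x) := lintegral_mono fun μ => hel _
    _ = ENNReal.ofReal (W x) + (∫⁻ μ, (∫⁻ y, ENNReal.ofReal (W y) ∂(μ.variation)) ^ q ∂(R x)) *
          ENNReal.ofReal (W x ^ (1 - q)) := by
        rw [lintegral_add_left measurable_const, lintegral_mul_const' _ _ ENNReal.ofReal_ne_top]
        simp
    _ ≤ ENNReal.ofReal (W x) + ENNReal.ofReal (C * W x ^ q) * ENNReal.ofReal (W x ^ (1 - q)) := by
        gcongr
        exact hb x
    _ = ENNReal.ofReal ((C + 1) * W x) := by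
        have hp : W x ^ q * W x ^ (1 - q) = W x := by
          rw [← Real.rpow_add hW]; simp
        rw [← ENNReal.ofReal_mul (by positivity), ← ENNReal.ofReal_add hW.le (by positivity)]
        congr 1
        rw [mul_assoc, hp]; ring

/-- The mean measure is the entrywise mean, under the moment bound. -/
theorem meanKernel_apply {R : Kernel E (SignedMeasure E)} [IsMarkovKernel R]
    {W : Weight E} {q : ℝ} (hq : 1 ≤ q) (h : MomentBound R W q) (x : E) {A : Set E}
    (hA : MeasurableSet A) : meanKernel R x A = ∫ μ, μ A ∂(R x) := by
  obtain ⟨K, -, hK⟩ := lintegral_lintegral_variation_le hq h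
  refine expectedMeasure_apply (ne_top_of_le_ne_top ENNReal.ofReal_ne_top (le_trans ?_ (hK x))) hA
  refine lintegral_mono fun μ => ?_
  calc μ.variation Set.univ = ∫⁻ _, 1 ∂μ.variation := by simp
    _ ≤ _ := lintegral_mono fun y => by simpa using W.one_le' y

theorem lintegral_meanKernel_le {R : Kernel E (SignedMeasure E)} [IsMarkovKernel R]
    {W : Weight E} {q : ℝ} (hq : 1 ≤ q) (h : MomentBound R W q) :
    ∃ K : ℝ, 0 ≤ K ∧ ∀ x,
      ∫⁻ y, ENNReal.ofReal (W y) ∂(meanKernel R x).variation ≤ ENNReal.ofReal (K * W x) := by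
  obtain ⟨K, hK0, hK⟩ := lintegral_lintegral_variation_le hq h
  exact ⟨K, hK0, fun x => (lintegral_variation_expectedMeasure_le
    (fun A hA => meanKernel_apply hq h x hA) _).trans (hK x)⟩

theorem BW.integrable {W : Weight E} {m : SignedMeasure E}
    (hm : ∫⁻ y, ENNReal.ofReal (W y) ∂m.variation ≠ ∞) (f : BW W) : m.Integrable f := by
  have hWi : Integrable (fun y => W y) m.variation := by
    refine ⟨W.measurable'.aestronglyMeasurable, lt_top_iff_ne_top.2 ?_⟩
    simpa [Real.enorm_eq_ofReal (W.pos _).le] using hm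
  exact (hWi.const_mul ‖f‖).mono' f.measurable.aestronglyMeasurable
    (Eventually.of_forall fun y => f.le_norm y)

theorem norm_integral_le_of_lintegral {W : Weight E} {m : SignedMeasure E} {K : ℝ} (hK : 0 ≤ K)
    (hm : ∫⁻ y, ENNReal.ofReal (W y) ∂m.variation ≤ ENNReal.ofReal K) (f : BW W) :
    ‖∫ᵛ y, f y ∂<•m‖ ≤ ‖f‖ * K := by
  have h1 : ‖∫ᵛ y, f y ∂<•m‖ₑ ≤ ENNReal.ofReal (‖f‖ * K) := by
    calc ‖∫ᵛ y, f y ∂<•m‖ₑ ≤ ∫⁻ y, ‖f y‖ₑ ∂m.variation := by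
          have := VectorMeasure.enorm_integral_le_lintegral_enorm_transpose
            (μ := m) (f := (f : E → ℂ)) (B := (ContinuousLinearMap.lsmul ℝ ℝ).flip)
          rwa [VectorMeasure.variation_transpose_lsmul_flip] at this
      _ ≤ ∫⁻ y, ENNReal.ofReal ‖f‖ * ENNReal.ofReal (W y) ∂m.variation := by
          refine lintegral_mono fun y => ?_
          rw [← ENNReal.ofReal_mul (norm_nonneg f), ← ofReal_norm]
          exact ENNReal.ofReal_le_ofReal (f.le_norm y)
      _ = ENNReal.ofReal ‖f‖ * ∫⁻ y, ENNReal.ofReal (W y) ∂m.variation :=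
          lintegral_const_mul' _ _ ENNReal.ofReal_ne_top
      _ ≤ ENNReal.ofReal ‖f‖ * ENNReal.ofReal K := by gcongr
      _ = _ := (ENNReal.ofReal_mul (norm_nonneg f)).symm
  rw [← ofReal_norm] at h1
  exact (ENNReal.ofReal_le_ofReal_iff (mul_nonneg (norm_nonneg f) hK)).1 h1

theorem integral_const_mul_signed (m : SignedMeasure E) (c : ℂ) (f : E → ℂ) :
    ∫ᵛ y, c * f y ∂<•m = c * ∫ᵛ y, f y ∂<•m := by
  refine setToFun_smul (𝕜 := ℂ) _ (fun c s x => ?_) c f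
  simp [VectorMeasure.transpose]
  ring

theorem measurable_integral_signed {m : E → SignedMeasure E}
    (hm : ∀ A, MeasurableSet A → Measurable fun x => m x A) {W : Weight E}
    (hW : ∀ x, ∫⁻ y, ENNReal.ofReal (W y) ∂(m x).variation ≠ ∞) (f : BW W) :
    Measurable fun x => ∫ᵛ y, f y ∂<•(m x) := by
  have hfin : ∀ x, IsFiniteMeasure (m x).variation := fun x => by
    rw [← SignedMeasure.totalVariation_eq_variation]
    unfold SignedMeasure.totalVariation
    infer_instance
  have hsimple : ∀ g : SimpleFunc E ℂ, Measurable fun x => ∫ᵛ y, g y ∂<•(m x) := by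
    intro g
    induction g using SimpleFunc.induction with
    | const c hs =>
      rename_i s
      have : ∀ x, ∫ᵛ y, (SimpleFunc.piecewise s hs (SimpleFunc.const E c)
          (SimpleFunc.const E 0)) y ∂<•(m x) = m x s • c := by
        intro x
        have h1 : ((SimpleFunc.piecewise s hs (SimpleFunc.const E c)
          (SimpleFunc.const E 0) : SimpleFunc E ℂ) : E → ℂ) = s.indicator fun _ => c := by
          ext y; simp [Set.indicator, Set.piecewise]
        rw [h1, VectorMeasure.integral_indicator hs, VectorMeasure.setIntegral_const]
        simp
      simp only [this]
      exact (hm s hs).smul_const c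
    | add hdisj hf hg =>
      rename_i f g
      have : ∀ x, ∫ᵛ y, (f + g) y ∂<•(m x)
          = ∫ᵛ y, f y ∂<•(m x) + ∫ᵛ y, g y ∂<•(m x) := fun x =>
        VectorMeasure.integral_fun_add (μ := m x) (f := fun y => f y) (g := fun y => g y)
          (f.integrable_of_isFiniteMeasure (μ := (m x).variation))
          (g.integrable_of_isFiniteMeasure (μ := (m x).variation))
      simp only [this]
      exact hf.add hg
  refine measurable_of_tendsto_metrizable (fun n => hsimple
    (SimpleFunc.approxOn f f.measurable Set.univ 0 (Set.mem_univ _) n)) ?_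
  refine tendsto_pi_nhds.2 fun x => ?_
  have hWi : Integrable (fun y => W y) (m x).variation := by
    refine ⟨W.measurable'.aestronglyMeasurable, lt_top_iff_ne_top.2 ?_⟩
    simpa [Real.enorm_eq_ofReal (W.pos _).le] using hW x
  refine VectorMeasure.tendsto_integral_of_dominated_convergence
    (fun y => 2 * ‖f‖ * W y) (fun n => (SimpleFunc.aestronglyMeasurable _))
    (hWi.const_mul _) (fun n => Eventually.of_forall fun y => ?_)
    (Eventually.of_forall fun y => ?_)
  · have h1 := SimpleFunc.norm_approxOn_zero_le f.measurable (Set.mem_univ 0) y n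
    have h2 := f.le_norm y
    refine h1.trans ?_
    nlinarith
  · exact SimpleFunc.tendsto_approxOn _ _ (by simp)

/-- Under the moment bound the mean operator is `f ↦ (x ↦ ∫ f d(E R_x))`. -/
theorem meanOperator_apply {R : Kernel E (SignedMeasure E)} [IsMarkovKernel R]
    {W : Weight E} {q : ℝ} (hq : 1 ≤ q) (h : MomentBound R W q) (f : BW W) (x : E) :
    meanOperator R W f x = ∫ᵛ y, f y ∂<•(meanKernel R x) := by
  suffices hex : ∃ T : BW W →L[ℂ] BW W, ∀ f x, T f x = ∫ᵛ y, f y ∂<•(meanKernel R x) by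
    rw [meanOperator, dif_pos hex]
    exact hex.choose_spec f x
  obtain ⟨K, hK0, hK⟩ := lintegral_meanKernel_le hq h
  have hne : ∀ x, ∫⁻ y, ENNReal.ofReal (W y) ∂(meanKernel R x).variation ≠ ∞ :=
    fun x => ne_top_of_le_ne_top ENNReal.ofReal_ne_top (hK x)
  have hmeas : ∀ A, MeasurableSet A → Measurable fun x => meanKernel R x A := by
    intro A hA
    simp only [meanKernel_apply hq h _ hA]
    exact (measurable_eval hA).stronglyMeasurable.integral_kernel.measurable
  have hbd : ∀ (f : BW W) x, ‖∫ᵛ y, f y ∂<•(meanKernel R x)‖ ≤ (K * ‖f‖) * W x := by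
    intro f x
    refine (norm_integral_le_of_lintegral (mul_nonneg hK0 (W.pos x).le) (hK x) f).trans (le_of_eq ?_)
    ring
  let L : BW W →ₗ[ℂ] BW W :=
    { toFun := fun f => BW.mk (fun x => ∫ᵛ y, f y ∂<•(meanKernel R x))
        (measurable_integral_signed hmeas hne f) (K * ‖f‖) (hbd f)
      map_add' := fun f g => BW.ext fun x => by
        simp only [BW.mk_apply, BW.add_apply]
        exact VectorMeasure.integral_fun_add (f.integrable (hne x)) (g.integrable (hne x))
      map_smul' := fun c f => BW.ext fun x => by
        simp only [BW.mk_apply, BW.smul_apply, RingHom.id_apply]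
        exact integral_const_mul_signed _ c f }
  exact ⟨L.mkContinuous K fun f => BW.norm_le_of _ (mul_nonneg hK0 (norm_nonneg f)) (hbd f),
    fun f x => rfl⟩

/-- `ν R = ν` and `ν V < ∞`, for the mean replacement and `V = W ^ q`. -/
structure IsInvariantLaw (R : Kernel E (SignedMeasure E)) (W : Weight E) (q : ℝ)
    (ν : Measure E) : Prop where
  invariant : ∀ A, MeasurableSet A → ∫ x, meanKernel R x A ∂ν = ν.real A
  integrable : Integrable (fun x => W x ^ q) ν

variable {Ω : Type v}

/-- The composition `m_n = m_0 + ∑_{i=1}^n R^{(i)}_{Y_i}`; here `ρ i` is the `(i+1)`-st replacement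
`R^{(i+1)}_{Y_{i+1}}`. -/
noncomputable def composition (m₀ : Measure E) [IsFiniteMeasure m₀] (ρ : ℕ → Ω → SignedMeasure E)
    (n : ℕ) (ω : Ω) : SignedMeasure E :=
  m₀.toSignedMeasure + ∑ i ∈ Finset.range n, ρ i ω

/-- The normalised composition `m_n / m_n(E)`. -/
noncomputable def normalized (m₀ : Measure E) [IsFiniteMeasure m₀] (ρ : ℕ → Ω → SignedMeasure E)
    (n : ℕ) (ω : Ω) : SignedMeasure E :=
  (composition m₀ ρ n ω Set.univ)⁻¹ • composition m₀ ρ n ω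

/-- The σ-field generated by the first `n` draws and replacements. -/
abbrev history (Y : ℕ → Ω → E) (ρ : ℕ → Ω → SignedMeasure E) (n : ℕ) : MeasurableSpace Ω :=
  ⨆ (i : ℕ) (_ : i < n),
    MeasurableSpace.comap (Y i) inferInstance ⊔ MeasurableSpace.comap (ρ i) inferInstance

/-- `(Y, ρ)` is (a realisation of) the measure-valued Pólya process with initial composition `m₀`
and replacement kernel `R`, which is tenable. `Y n` is the `(n+1)`-st draw and `ρ n` the `(n+1)`-st
replacement: given the first `n` steps, `Y n` has law `m_n / m_n(E)`; given the first `n`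
steps and `Y n = y`, `ρ n` has law `R y`. -/
structure IsMVPP [MeasurableSpace Ω] (R : Kernel E (SignedMeasure E)) (m₀ : Measure E)
    [IsFiniteMeasure m₀] (P : Measure Ω) (Y : ℕ → Ω → E) (ρ : ℕ → Ω → SignedMeasure E) :
    Prop where
  measurable_draw : ∀ n, Measurable (Y n)
  measurable_replacement : ∀ n, Measurable (ρ n)
  tenable : ∀ᵐ ω ∂P, ∀ n, composition m₀ ρ n ω ≠ 0 ∧
    ∀ A, MeasurableSet A → 0 ≤ composition m₀ ρ n ω A
  law_draw : ∀ n A, MeasurableSet A →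
    P[(Y n ⁻¹' A).indicator (fun _ => (1 : ℝ)) | history Y ρ n] =ᵐ[P]
      fun ω => normalized m₀ ρ n ω A
  law_replacement : ∀ n B, MeasurableSet B →
    P[(ρ n ⁻¹' B).indicator (fun _ => (1 : ℝ)) |
        history Y ρ n ⊔ MeasurableSpace.comap (Y n) inferInstance] =ᵐ[P]
      fun ω => (R (Y n ω)).real B

end Urn

end MVPP

open MVPP

/-!
# Convergence of balanced measure-valued Pólya processes

Write `s_n = m₀(E) + n`, `V = W ^ q`, `T` for the mean replacement operator and `X_n f` for the
integral of `f` against the normalised composition. Balance gives `m_n(E) = s_n`, and conditioning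
on the history gives, with `s = s_{n+1}`,
`X_{n+1} f = X_n (f + s⁻¹ (T f - f)) + s⁻¹ (martingale increment)`.
This is a linear stochastic approximation scheme for the generator `T - 1` (`IsLinearScheme`,
`HasReplacementBounds.isLinearScheme`), and three ingredients give the rates.

* *Spectral gap.* As `ν` is a left and `1` a right eigenvector of `T`, the rank one spectral
  projection at `1` is `f ↦ (∫ f dν) 1` (`rieszIntegral_eq`). On functions with `∫ f dν = 0` the
  operator `U = 1 - h (1 - T)`, for `h` small, has spectral radius at most `1 - h δ₁`, for any `δ₁`
  smaller than the spectral gap. In the equivalent norm `sup_k ‖U ^ k f‖ / (1 - h δ₁) ^ k` all steps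
  `1 + s⁻¹ (T - 1)` with `s ≥ 1 / h` contract by the factor `1 - δ₁ / s`
  (`exists_contracting_norm`). Neither an operator semigroup nor a product formula is needed.

* *Moments.* The drift condition keeps `E X_n V` below a multiple of its initial value
  (`HasReplacementBounds.integral_weight_le`), and the moment condition bounds the conditional
  second moments of the increments by `V`. Hence
  `φ_{n+1} ≤ (1 - δ₁ / s) ^ 2 φ_n + K / s ^ 2` for the mean squares `φ_n`, and therefore
  `φ_n = O(s_n ^ (-κ))` for `κ ≤ 1`, `κ < 2 δ₁` (`exists_second_moment_le`, `exists_sq_rate`). For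
  `δ < 1 / 2` the differences of `n ^ δ X_n f` are an absolutely summable drift plus an `L²` bounded
  martingale, which gives the almost sure rate (`IsLinearScheme.ae_tendsto_rpow_mul`). For `f` of
  order `W ^ 2`, truncation at a level of `W` that depends on `n` interpolates between the mean
  square rate on `B(W)` and the bound on `E X_n V`
  (`HasReplacementBounds.integral_norm_le_of_sq_rate`).

* *Measurability.* As the σ-field of `E` need not be countably generated, neither the total
  variation of a signed measure nor the set of signed measures integrating `V` need be measurable
  in the signed measure. Integrals against a random signed measure are therefore replaced by the
  limits of the integrals of cut-offs (`limIntegral`), and means and integrals are exchanged by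
  uniform approximation for bounded functions (`integral_integral_signed_of_bounded`). For functions
  of order `V` the positivity of `R_x` off `x` enters: the tail `V 1_{W > W x}` vanishes at `x`, so
  that its integral against `|R_x|` is a.s. a monotone limit of measurable functions
  (`exists_tail_variation`, `integral_limIntegral_eq`).
-/

namespace MVPP

/-! ### Reduced resolvents and contracting norms -/

section SpectralGap

variable {X : Type*} [NormedAddCommGroup X] [NormedSpace ℂ X]

theorem map_circleIntegral {A Y : Type*} [NormedAddCommGroup A] [NormedSpace ℂ A] [CompleteSpace A]
    [NormedAddCommGroup Y] [NormedSpace ℂ Y] [CompleteSpace Y] (L : A →L[ℂ] Y) {f : ℂ → A} {c : ℂ}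
    {r : ℝ} (hf : CircleIntegrable f c r) :
    L (∮ z in C(c, r), f z) = ∮ z in C(c, r), L (f z) := by
  rw [circleIntegral, circleIntegral, ← ContinuousLinearMap.intervalIntegral_comp_comm]
  · simp
  · exact hf.out

theorem resolvent_mul_self {T : X →L[ℂ] X} {z : ℂ} (hz : z ∉ spectrum ℂ T) :
    resolvent T z * (algebraMap ℂ (X →L[ℂ] X) z - T) = 1 := by
  rw [resolvent]
  exact Ring.inverse_mul_cancel _ (spectrum.notMem_iff.1 hz)

theorem self_mul_resolvent {T : X →L[ℂ] X} {z : ℂ} (hz : z ∉ spectrum ℂ T) :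
    (algebraMap ℂ (X →L[ℂ] X) z - T) * resolvent T z = 1 := by
  rw [resolvent]
  exact Ring.mul_inverse_cancel _ (spectrum.notMem_iff.1 hz)

theorem resolvent_apply_eigenvector {T : X →L[ℂ] X} {e : X} (he : T e = e) {z : ℂ}
    (hz : z ∉ spectrum ℂ T) (hz1 : z ≠ 1) : resolvent T z e = (z - 1)⁻¹ • e := by
  have h := congrArg (fun B : X →L[ℂ] X => B e) (resolvent_mul_self hz)
  have h2 : (algebraMap ℂ (X →L[ℂ] X) z - T) e = (z - 1) • e := by
    simp [Algebra.algebraMap_eq_smul_one, he, sub_smul]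
  simp only [mul_apply_eq_comp, h2, map_smul, one_apply_eq_self] at h
  rw [← h, smul_smul, inv_mul_cancel₀ (sub_ne_zero.2 hz1), one_smul, h]

theorem comp_resolvent_of_invariant {T : X →L[ℂ] X} {ℓ : X →L[ℂ] ℂ} (hl : ∀ x, ℓ (T x) = ℓ x)
    {z : ℂ} (hz : z ∉ spectrum ℂ T) (hz1 : z ≠ 1) (x : X) :
    ℓ (resolvent T z x) = (z - 1)⁻¹ * ℓ x := by
  have h := congrArg (fun B : X →L[ℂ] X => ℓ (B x)) (self_mul_resolvent hz)
  simp only [mul_apply_eq_comp, one_apply_eq_self,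
    sub_apply, map_sub, hl, Algebra.algebraMap_eq_smul_one,
    smul_apply, map_smul, smul_eq_mul] at h
  rw [← h]
  field_simp [sub_ne_zero.2 hz1]

/-- A gap `δ < 1 - sup Re (σ(T) \ {1})` can be enlarged. -/
theorem exists_gap_of_lt_specBound {T : X →L[ℂ] X} {δ : ℝ}
    (h : (δ : EReal) < 1 - specBound T) :
    ∃ δ' : ℝ, δ < δ' ∧ ∀ z ∈ spectrum ℂ T, z ≠ 1 → z.re ≤ 1 - δ' := by
  obtain ⟨δ', h1, h2⟩ := EReal.lt_iff_exists_real_btwn.1 h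
  refine ⟨δ', EReal.coe_lt_coe_iff.1 h1, fun z hz hz1 => ?_⟩
  have h3 : ((z.re : ℝ) : EReal) ≤ specBound T := le_sSup ⟨z, ⟨hz, hz1⟩, rfl⟩
  have h4 : (δ' : EReal) < 1 - (z.re : ℝ) := h2.trans_le (EReal.sub_le_sub le_rfl h3)
  have h5 : δ' < 1 - z.re := by exact_mod_cast h4
  linarith

variable [CompleteSpace X]

theorem continuousOn_resolvent {T : X →L[ℂ] X} {s : Set ℂ} (hs : ∀ z ∈ s, z ∉ spectrum ℂ T) :
    ContinuousOn (resolvent T) s := fun z hz =>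
  (spectrum.hasDerivAt_resolvent_const_left (spectrum.notMem_iff.1 (hs z hz))).continuousAt.continuousWithinAt

theorem circleIntegral_inv_smul {Y : Type*} [NormedAddCommGroup Y] [NormedSpace ℂ Y]
    [CompleteSpace Y] {r : ℝ} (hr : 0 < r) (y : Y) :
    (2 * (Real.pi : ℂ) * Complex.I)⁻¹ • ∮ z in C(1, r), (z - 1)⁻¹ • y = y := by
  rw [circleIntegral.integral_smul_const,
    circleIntegral.integral_sub_inv_of_mem_ball (Metric.mem_ball_self hr), smul_smul,
    inv_mul_cancel₀ Complex.two_pi_I_ne_zero, one_smul]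

/-- If `e` and `ℓ` are right and left eigenvectors of `T` at `1`, normalised by `ℓ e = 1`, and the
spectral projection at `1` has rank one, then that projection is `x ↦ ℓ x • e`. -/
theorem rieszIntegral_eq {T : X →L[ℂ] X} {e : X} {ℓ : X →L[ℂ] ℂ} (he : T e = e)
    (hl : ∀ x, ℓ (T x) = ℓ x) (hle : ℓ e = 1) {r : ℝ} (hr : 0 < r)
    (hs : ∀ z ∈ Metric.sphere (1 : ℂ) r, z ∉ spectrum ℂ T)
    (hrank : Module.finrank ℂ (rieszIntegral T 1 r).range = 1) :
    rieszIntegral T 1 r = ℓ.smulRight e := by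
  have hne : ∀ z ∈ Metric.sphere (1 : ℂ) r, z ≠ 1 := by
    rintro z hz rfl
    simp at hz
    exact hr.ne hz
  have hint : CircleIntegrable (resolvent T) 1 r :=
    (continuousOn_resolvent hs).circleIntegrable hr.le
  have hPe : rieszIntegral T 1 r e = e := by
    rw [rieszIntegral, smul_apply]
    have := map_circleIntegral (ContinuousLinearMap.apply ℂ X e) hint
    simp only [ContinuousLinearMap.apply_apply] at this
    rw [this, circleIntegral.integral_congr hr.le
      (fun z hz => resolvent_apply_eigenvector he (hs z hz) (hne z hz)), circleIntegral_inv_smul hr]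
  have hPl : ∀ x, ℓ (rieszIntegral T 1 r x) = ℓ x := by
    intro x
    rw [rieszIntegral, smul_apply, map_smul]
    have := map_circleIntegral (ℓ.comp (ContinuousLinearMap.apply ℂ X x)) hint
    simp only [ContinuousLinearMap.comp_apply, ContinuousLinearMap.apply_apply] at this
    rw [this, circleIntegral.integral_congr hr.le
      (fun z hz => comp_resolvent_of_invariant hl (hs z hz) (hne z hz) x)]
    exact circleIntegral_inv_smul hr (ℓ x)
  have he0 : e ≠ 0 := by
    rintro rfl
    simp at hle
  ext x
  obtain ⟨c, hc⟩ := (finrank_eq_one_iff_of_nonzero'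
    (⟨e, ⟨e, hPe⟩⟩ : (rieszIntegral T 1 r).range) (fun h => he0 (congrArg Subtype.val h))).1 hrank
      ⟨rieszIntegral T 1 r x, ⟨x, rfl⟩⟩
  have hc' : c • e = rieszIntegral T 1 r x := congrArg Subtype.val hc
  have h1 := hPl x
  rw [← hc', map_smul, hle, smul_eq_mul, mul_one] at h1
  simp [← hc', h1]

/-- The reduced resolvent at `1`: it inverts `1 - T` modulo the spectral projection. -/
theorem exists_reduced_resolvent {T : X →L[ℂ] X} {r : ℝ} (hr : 0 < r)
    (hs : ∀ z ∈ Metric.sphere (1 : ℂ) r, z ∉ spectrum ℂ T) :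
    ∃ S : X →L[ℂ] X, (1 - T) * S = 1 - rieszIntegral T 1 r ∧
      S * (1 - T) = 1 - rieszIntegral T 1 r := by
  have hne : ∀ z ∈ Metric.sphere (1 : ℂ) r, z - 1 ≠ 0 := by
    rintro z hz h
    rw [sub_eq_zero] at h
    subst h
    simp at hz
    exact hr.ne hz
  have hcont := continuousOn_resolvent hs
  have hcinv : ContinuousOn (fun z : ℂ => (z - 1)⁻¹) (Metric.sphere (1 : ℂ) r) :=
    (continuousOn_id.sub continuousOn_const).inv₀ hne
  have hint : CircleIntegrable (fun z => (z - 1)⁻¹ • resolvent T z) 1 r :=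
    (hcinv.smul hcont).circleIntegrable hr.le
  have hint1 : CircleIntegrable (fun z : ℂ => (z - 1)⁻¹ • (1 : X →L[ℂ] X)) 1 r :=
    (hcinv.smul continuousOn_const).circleIntegrable hr.le
  have key : ∀ L : (X →L[ℂ] X) →L[ℂ] (X →L[ℂ] X),
      (∀ z ∈ Metric.sphere (1 : ℂ) r, L (resolvent T z) = 1 - (z - 1) • resolvent T z) →
      L ((2 * (Real.pi : ℂ) * Complex.I)⁻¹ • ∮ z in C(1, r), (z - 1)⁻¹ • resolvent T z)
        = 1 - rieszIntegral T 1 r := by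
    intro L hL
    rw [map_smul, map_circleIntegral L hint, circleIntegral.integral_congr hr.le
      (g := fun z => (z - 1)⁻¹ • (1 : X →L[ℂ] X) - resolvent T z),
      circleIntegral.integral_sub hint1 (hcont.circleIntegrable hr.le), smul_sub,
      circleIntegral_inv_smul hr, rieszIntegral]
    intro z hz
    simp only [map_smul, hL z hz, smul_sub, smul_smul]
    rw [inv_mul_cancel₀ (hne z hz), one_smul]
  refine ⟨(2 * (Real.pi : ℂ) * Complex.I)⁻¹ • ∮ z in C(1, r), (z - 1)⁻¹ • resolvent T z,
    key (ContinuousLinearMap.mul ℂ (X →L[ℂ] X) (1 - T)) fun z hz => ?_,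
    key ((ContinuousLinearMap.mul ℂ (X →L[ℂ] X)).flip (1 - T)) fun z hz => ?_⟩
  · have := self_mul_resolvent (hs z hz)
    rw [ContinuousLinearMap.mul_apply', eq_sub_iff_add_eq]
    refine Eq.trans ?_ this
    rw [Algebra.algebraMap_eq_smul_one]
    simp only [sub_mul, smul_mul_assoc, one_mul, sub_smul, one_smul]
    abel
  · have := resolvent_mul_self (hs z hz)
    rw [ContinuousLinearMap.flip_apply, ContinuousLinearMap.mul_apply', eq_sub_iff_add_eq]
    refine Eq.trans ?_ this
    rw [Algebra.algebraMap_eq_smul_one]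
    simp only [mul_sub, mul_smul_comm, mul_one, sub_smul, one_smul]
    abel

/-- An element that is multiplication by `w - 1` on the range of an idempotent `p` and invertible on
the kernel of `p` becomes invertible when `p` is added, if `w ≠ 0`. -/
theorem isUnit_add_idempotent {A : Type*} [Ring A] [Algebra ℂ A] {a b p : A} {w : ℂ}
    (hp : p * p = p) (hap : a * p = (w - 1) • p) (hpa : p * a = (w - 1) • p) (hw : w ≠ 0)
    (hab : a * b * (1 - p) = 1 - p) (hba : (1 - p) * (b * a) = 1 - p) : IsUnit (a + p) := by
  have hcomm : a * (1 - p) = (1 - p) * a := by rw [mul_sub, sub_mul, hap, hpa, mul_one, one_mul]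
  have hq : (1 - p) * (1 - p) = 1 - p := by rw [mul_sub, sub_mul, sub_mul, hp]; simp
  have hpq : p * (1 - p) = 0 := by rw [mul_sub, hp]; simp
  have hqp : (1 - p) * p = 0 := by rw [sub_mul, hp]; simp
  have h1 : (a + p) * ((1 - p) * b * (1 - p) + w⁻¹ • p) = 1 := by
    have e1 : a * ((1 - p) * b * (1 - p)) = 1 - p := by
      calc a * ((1 - p) * b * (1 - p)) = a * (1 - p) * b * (1 - p) := by simp only [mul_assoc]
        _ = (1 - p) * (a * b * (1 - p)) := by rw [hcomm]; simp only [mul_assoc]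
        _ = 1 - p := by rw [hab, hq]
    have e2 : p * ((1 - p) * b * (1 - p)) = 0 := by
      rw [mul_assoc, ← mul_assoc, hpq, zero_mul]
    rw [add_mul, mul_add, mul_add, e1, e2, mul_smul_comm, mul_smul_comm, hap, hp, smul_smul,
      zero_add, add_assoc, ← add_smul]
    rw [show w⁻¹ * (w - 1) + w⁻¹ = 1 by field_simp; ring, one_smul, sub_add_cancel]
  have h2 : ((1 - p) * b * (1 - p) + w⁻¹ • p) * (a + p) = 1 := by
    have e1 : (1 - p) * b * (1 - p) * a = 1 - p := by
      calc (1 - p) * b * (1 - p) * a = (1 - p) * (b * ((1 - p) * a)) := by simp only [mul_assoc]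
        _ = (1 - p) * (b * a) * (1 - p) := by rw [← hcomm]; simp only [mul_assoc]
        _ = 1 - p := by rw [hba, hq]
    have e2 : (1 - p) * b * (1 - p) * p = 0 := by rw [mul_assoc, hqp, mul_zero]
    rw [add_mul, mul_add, mul_add, e1, e2, smul_mul_assoc, smul_mul_assoc, hpa, hp, smul_smul,
      add_zero, ← add_smul]
    rw [show w⁻¹ * (w - 1) + w⁻¹ = 1 by field_simp; ring, one_smul, sub_add_cancel]
  exact ⟨⟨_, _, h1, h2⟩, rfl⟩

theorem exists_norm_pow_le {A : Type*} [NormedRing A] [NormedAlgebra ℂ A] [CompleteSpace A] {a : A}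
    {r : ℝ≥0} (hr : 0 < r) (h : spectralRadius ℂ a < r) :
    ∃ C : ℝ, ∀ k : ℕ, ‖a ^ k‖ ≤ C * r ^ k := by
  have hev : ∀ᶠ n : ℕ in atTop, ‖a ^ n‖ ≤ (r : ℝ) ^ n := by
    have := (spectrum.pow_nnnorm_pow_one_div_tendsto_nhds_spectralRadius a).eventually_lt_const h
    filter_upwards [this, eventually_ge_atTop 1] with n hn hn1
    have h0 : (0 : ℝ) < n := by exact_mod_cast hn1
    have h2 := ENNReal.rpow_lt_rpow hn h0
    rw [← ENNReal.rpow_mul, one_div, inv_mul_cancel₀ h0.ne', ENNReal.rpow_one,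
      ENNReal.rpow_natCast] at h2
    exact_mod_cast h2.le
  obtain ⟨N, hN⟩ := eventually_atTop.1 hev
  refine ⟨1 + ∑ i ∈ Finset.range N, ‖a ^ i‖ / r ^ i, fun k => ?_⟩
  have hrk : (0 : ℝ) < (r : ℝ) ^ k := by positivity
  rw [← div_le_iff₀ hrk]
  have hnn : ∀ i ∈ Finset.range N, 0 ≤ ‖a ^ i‖ / (r : ℝ) ^ i := fun i _ => by positivity
  rcases lt_or_ge k N with hk | hk
  · have := Finset.single_le_sum hnn (Finset.mem_range.2 hk)
    linarith
  · have h1 : ‖a ^ k‖ / (r : ℝ) ^ k ≤ 1 := (div_le_one hrk).2 (hN k hk)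
    have := Finset.sum_nonneg hnn
    linarith

/-- Away from `1` the spectrum is compact, so that a bound `Re z < 1` on it is uniform. -/
theorem specBound_lt_one {T : X →L[ℂ] X} (hT : IsSLQC T) : specBound T < 1 := by
  obtain ⟨r, hr, hs, -⟩ := hT.isolated_rank_one
  have hset : spectrum ℂ T \ {1} = spectrum ℂ T \ Metric.ball 1 r := by
    ext z
    constructor
    · rintro ⟨hz, hz1⟩
      refine ⟨hz, fun hb => hz1 ?_⟩
      rw [← hs]
      exact ⟨hz, Metric.ball_subset_closedBall hb⟩
    · rintro ⟨hz, hz1⟩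
      refine ⟨hz, fun h => hz1 ?_⟩
      rw [Set.mem_singleton_iff.1 h]
      exact Metric.mem_ball_self hr
  have hcomp : IsCompact (spectrum ℂ T \ {1}) := by
    rw [hset]
    exact (spectrum.isCompact T).diff Metric.isOpen_ball
  rcases (spectrum ℂ T \ {1}).eq_empty_or_nonempty with h | h
  · rw [specBound, h, Set.image_empty, sSup_empty]
    exact EReal.bot_lt_coe 1
  · obtain ⟨z, hz, hmax⟩ := hcomp.exists_isMaxOn h Complex.continuous_re.continuousOn
    refine lt_of_le_of_lt (b := ((z.re : ℝ) : EReal)) (sSup_le ?_) ?_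
    · rintro _ ⟨w, hw, rfl⟩
      exact EReal.coe_le_coe_iff.2 (hmax hw)
    · exact_mod_cast hT.re_lt_one z hz.1 hz.2

/-- Off the eigenvector at `1`, small steps `x ↦ x + s⁻¹ (T x - x)` contract by `1 - δ / s` in an
equivalent norm, if the rest of the spectrum lies in `Re z ≤ 1 - δ'` with `δ < δ'`. The norm is
`sup_k ‖U ^ k x‖ / r ^ k`, where `U` is such a step of fixed size and `r` bounds its spectral
radius; smaller steps are convex combinations of the identity and `U`. -/
theorem exists_contracting_norm {T : X →L[ℂ] X} {e : X} {ℓ : X →L[ℂ] ℂ} (he : T e = e)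
    (hl : ∀ x, ℓ (T x) = ℓ x) (hle : ℓ e = 1) (hT : IsSLQC T) {δ δ' : ℝ} (hδ : 0 < δ)
    (hδδ' : δ < δ') (hspec : ∀ z ∈ spectrum ℂ T, z ≠ 1 → z.re ≤ 1 - δ') :
    ∃ (N : X → ℝ) (C s₀ : ℝ), (∀ x, ‖x‖ ≤ N x) ∧ (∀ x, N x ≤ C * ‖x‖) ∧
      ∀ s, s₀ ≤ s → ∀ x, ℓ x = 0 → N (x + ((s⁻¹ : ℝ) : ℂ) • (T x - x)) ≤ (1 - δ / s) * N x := by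
  obtain ⟨ρ, hρ, hs, hrank⟩ := hT.isolated_rank_one
  have hsph : ∀ z ∈ Metric.sphere (1 : ℂ) ρ, z ∉ spectrum ℂ T := by
    intro z hz hzs
    have h1 : z ∈ ({1} : Set ℂ) := hs ▸ ⟨hzs, Metric.sphere_subset_closedBall hz⟩
    rw [Set.mem_singleton_iff.1 h1] at hz
    simp at hz
    exact hρ.ne hz
  set p : X →L[ℂ] X := ℓ.smulRight e with hp
  have hP := rieszIntegral_eq he hl hle hρ hsph hrank
  obtain ⟨S, hS1, hS2⟩ := exists_reduced_resolvent hρ hsph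
  rw [hP, ← hp] at hS1 hS2
  have hpp : p * p = p := by ext x; simp [hp, hle]
  have hTp : T * p = p := by ext x; simp [hp, he]
  have hpT : p * T = p := by ext x; simp [hp, hl]
  set M : ℝ := 1 + ‖T‖ * ‖(1 : X →L[ℂ] X)‖ with hM
  have hM0 : 0 < M := by positivity
  have hMb : ∀ z ∈ spectrum ℂ T, ‖1 - z‖ ≤ M := fun z hz => by
    have := spectrum.norm_le_norm_mul_of_mem hz
    have h2 := norm_sub_le (1 : ℂ) z
    rw [norm_one] at h2
    linarith
  -- the step size `h` is so small that `|1 - h (1 - z)| < 1 - h δ` on the rest of the spectrum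
  obtain ⟨h, hh0, hh1, hh2⟩ : ∃ h : ℝ, 0 < h ∧ h * δ < 1 ∧ h * M ^ 2 < 2 * (δ' - δ) := by
    refine ⟨min (1 / (2 * δ)) ((δ' - δ) / M ^ 2), ?_, ?_, ?_⟩
    · have : 0 < δ' - δ := by linarith
      positivity
    · have := mul_le_mul_of_nonneg_right (min_le_left (1 / (2 * δ)) ((δ' - δ) / M ^ 2)) hδ.le
      refine this.trans_lt ?_
      rw [div_mul_eq_mul_div, one_mul, div_lt_one (by positivity)]
      linarith
    · have := mul_le_mul_of_nonneg_right (min_le_right (1 / (2 * δ)) ((δ' - δ) / M ^ 2))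
        (sq_nonneg M)
      refine this.trans_lt ?_
      rw [div_mul_cancel₀ _ (by positivity)]
      linarith
  set r : ℝ := 1 - h * δ with hr
  have hr0 : 0 < r := by rw [hr]; linarith
  set U : X →L[ℂ] X := 1 - (h : ℂ) • (1 - T) - p with hU
  have hhc : (h : ℂ) ≠ 0 := by exact_mod_cast hh0.ne'
  have hspecU : ∀ w ∈ spectrum ℂ U, ‖w‖₊ < (⟨r, hr0.le⟩ : ℝ≥0) := by
    intro w hw
    rcases eq_or_ne w 0 with rfl | hw0
    · rw [nnnorm_zero]
      exact hr0
    set z : ℂ := 1 - (1 - w) / h with hz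
    have hwz : w = 1 - h * (1 - z) := by rw [hz]; field_simp; ring
    have hform : algebraMap ℂ (X →L[ℂ] X) w - U
        = (h : ℂ) • (algebraMap ℂ (X →L[ℂ] X) z - T) + p := by
      rw [hU, hwz, Algebra.algebraMap_eq_smul_one, Algebra.algebraMap_eq_smul_one]
      module
    have hap : (h : ℂ) • (algebraMap ℂ (X →L[ℂ] X) z - T) * p = (w - 1) • p := by
      rw [hwz, Algebra.algebraMap_eq_smul_one, smul_mul_assoc, sub_mul, hTp, smul_mul_assoc,
        one_mul]
      module
    have hpa : p * ((h : ℂ) • (algebraMap ℂ (X →L[ℂ] X) z - T)) = (w - 1) • p := by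
      rw [hwz, Algebra.algebraMap_eq_smul_one, mul_smul_comm, mul_sub, hpT, mul_smul_comm, mul_one]
      module
    have hmem : z ∈ spectrum ℂ T ∧ z ≠ 1 := by
      by_contra hcon
      refine hw ?_
      rw [spectrum.mem_resolventSet_iff, hform]
      by_cases hz1 : z = 1
      · refine isUnit_add_idempotent (b := (h : ℂ)⁻¹ • S) hpp hap hpa hw0 ?_ ?_
        · rw [hz1, map_one, smul_mul_smul_comm, hS1, mul_inv_cancel₀ hhc, one_smul, mul_sub,
            sub_mul, sub_mul, hpp]
          simp
        · rw [hz1, map_one, smul_mul_smul_comm, hS2, inv_mul_cancel₀ hhc, one_smul, mul_sub,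
            sub_mul, sub_mul, hpp]
          simp
      · have hzT : z ∉ spectrum ℂ T := fun hzT => hcon ⟨hzT, hz1⟩
        refine isUnit_add_idempotent (b := (h : ℂ)⁻¹ • resolvent T z) hpp hap hpa hw0 ?_ ?_
        · rw [smul_mul_smul_comm, self_mul_resolvent hzT, mul_inv_cancel₀ hhc, one_smul, one_mul]
        · rw [smul_mul_smul_comm, resolvent_mul_self hzT, inv_mul_cancel₀ hhc, one_smul, mul_one]
    have h1 := hspec z hmem.1 hmem.2
    have h2 := hMb z hmem.1
    have h3 : ‖w‖ < r := by
      refine lt_of_pow_lt_pow_left₀ 2 hr0.le ?_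
      have h4 : ‖1 - z‖ ^ 2 ≤ M ^ 2 := pow_le_pow_left₀ (norm_nonneg _) h2 2
      have h5 : ‖1 - z‖ ^ 2 = (1 - z.re) ^ 2 + z.im ^ 2 := by
        rw [← Complex.normSq_eq_norm_sq, Complex.normSq_apply]; simp; ring
      have h6 : ‖w‖ ^ 2 = (1 - h * (1 - z.re)) ^ 2 + (h * z.im) ^ 2 := by
        rw [hwz, ← Complex.normSq_eq_norm_sq, Complex.normSq_apply]; simp; ring
      rw [h5] at h4
      rw [h6, hr]
      have h7 : h * (h * M ^ 2) < h * (2 * (δ' - δ)) := mul_lt_mul_of_pos_left hh2 hh0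
      have h8 : h ^ 2 * ((1 - z.re) ^ 2 + z.im ^ 2) ≤ h ^ 2 * M ^ 2 :=
        mul_le_mul_of_nonneg_left h4 (sq_nonneg h)
      have h9 : h * δ' ≤ h * (1 - z.re) := mul_le_mul_of_nonneg_left (by linarith) hh0.le
      nlinarith [sq_nonneg (h * δ)]
    exact h3
  have hnt : Nontrivial (X →L[ℂ] X) := by
    refine ⟨⟨p, 0, fun h0 => ?_⟩⟩
    have := congrArg (fun B : X →L[ℂ] X => ℓ (B e)) h0
    simp [hp, hle] at this
  obtain ⟨C, hC⟩ := exists_norm_pow_le (r := ⟨r, hr0.le⟩) hr0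
    (spectrum.spectralRadius_lt_of_forall_lt U hspecU)
  have hC' : ∀ x k, ‖(U ^ k) x‖ / r ^ k ≤ C * ‖x‖ := fun x k => by
    rw [div_le_iff₀ (by positivity)]
    calc ‖(U ^ k) x‖ ≤ ‖U ^ k‖ * ‖x‖ := (U ^ k).le_opNorm x
      _ ≤ (C * r ^ k) * ‖x‖ := mul_le_mul_of_nonneg_right (hC k) (norm_nonneg x)
      _ = C * ‖x‖ * r ^ k := by ring
  have hbdd : ∀ x, BddAbove (Set.range fun k => ‖(U ^ k) x‖ / r ^ k) := fun x =>
    ⟨C * ‖x‖, by rintro _ ⟨k, rfl⟩; exact hC' x k⟩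
  refine ⟨fun x => ⨆ k, ‖(U ^ k) x‖ / r ^ k, C, h⁻¹, fun x => ?_, fun x => ciSup_le (hC' x),
    fun s hs x hx => ?_⟩
  · simpa using le_ciSup (hbdd x) 0
  have hinv : 0 < h⁻¹ := inv_pos.2 hh0
  have hs0 : 0 < s := hinv.trans_le hs
  set t : ℝ := (s * h)⁻¹ with ht
  have ht0 : 0 ≤ t := by positivity
  have ht1 : t ≤ 1 := by
    refine inv_le_one_of_one_le₀ ?_
    rwa [inv_le_iff_one_le_mul₀ hh0] at hs
  have hF : x + ((s⁻¹ : ℝ) : ℂ) • (T x - x) = ((1 - t : ℝ) : ℂ) • x + (t : ℂ) • U x := by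
    have hUx : U x = x - (h : ℂ) • (x - T x) := by simp [hU, hp, hx]
    have hst : (t : ℂ) * h = ((s⁻¹ : ℝ) : ℂ) := by
      rw [← Complex.ofReal_mul, ht]; congr 1; field_simp
    rw [hUx, ← hst]
    push_cast
    module
  refine ciSup_le fun k => ?_
  have e1 : (U ^ k) (U x) = (U ^ (k + 1)) x := by rw [pow_succ]; rfl
  have e2 := le_ciSup (hbdd x) k
  have e3 := le_ciSup (hbdd x) (k + 1)
  set Nx : ℝ := ⨆ k, ‖(U ^ k) x‖ / r ^ k
  rw [div_le_iff₀ (by positivity)] at e2 e3 ⊢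
  rw [hF, map_add, map_smul, map_smul, e1]
  calc ‖((1 - t : ℝ) : ℂ) • (U ^ k) x + (t : ℂ) • (U ^ (k + 1)) x‖
      ≤ (1 - t) * ‖(U ^ k) x‖ + t * ‖(U ^ (k + 1)) x‖ := by
        refine (norm_add_le _ _).trans (le_of_eq ?_)
        rw [norm_smul, norm_smul, Complex.norm_real, Complex.norm_real, Real.norm_of_nonneg ht0,
          Real.norm_of_nonneg (by linarith)]
    _ ≤ (1 - t) * (Nx * r ^ k) + t * (Nx * r ^ (k + 1)) := by
        have : 0 ≤ 1 - t := by linarith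
        gcongr
    _ = (1 - δ / s) * Nx * r ^ k := by
        rw [pow_succ, hr, ht]
        field_simp
        ring

end SpectralGap

/-! ### Second moments of linear schemes -/

section StochasticApproximation

variable {Ω : Type*} {mΩ : MeasurableSpace Ω} {P : Measure Ω}

theorem integrable_inner_of_memLp {X D : Ω → ℂ} (hX : MemLp X 2 P) (hD : MemLp D 2 P) :
    Integrable (fun ω => inner ℝ (X ω) (D ω)) P := by
  have h := (hX.norm.integrable_mul (q := 2) hD.norm)
  refine h.mono' (hX.1.inner hD.1) (Eventually.of_forall fun ω => ?_)
  exact norm_inner_le_norm _ _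

/-- Pythagoras for a centred increment. -/
theorem integral_norm_sq_add_of_condExp_eq_zero [IsProbabilityMeasure P] {m : MeasurableSpace Ω}
    (hm : m ≤ mΩ) {X D : Ω → ℂ} (hXm : StronglyMeasurable[m] X) (hX : MemLp X 2 P)
    (hD : MemLp D 2 P) (h0 : P[D | m] =ᵐ[P] 0) :
    ∫ ω, ‖X ω + D ω‖ ^ 2 ∂P = ∫ ω, ‖X ω‖ ^ 2 ∂P + ∫ ω, ‖D ω‖ ^ 2 ∂P := by
  have hin := integrable_inner_of_memLp hX hD
  have hcross : ∫ ω, inner ℝ (X ω) (D ω) ∂P = 0 := by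
    have h1 := condExp_bilin_of_stronglyMeasurable_left (m := m) (μ := P) (innerSL ℝ) hXm
      (g := D) hin (hD.integrable (by norm_num))
    rw [← integral_condExp hm]
    refine integral_eq_zero_of_ae ?_
    filter_upwards [h1, h0] with ω h1 h2
    have h3 : (fun ω => (innerSL ℝ (X ω)) (D ω)) = fun ω => inner ℝ (X ω) (D ω) := rfl
    rw [h3] at h1
    rw [h1, h2]
    simp
  have hX2 := hX.integrable_norm_pow (p := 2) (by norm_num)
  have hD2 := hD.integrable_norm_pow (p := 2) (by norm_num)
  simp_rw [norm_add_sq_real]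
  have hXin : Integrable (fun ω => ‖X ω‖ ^ 2 + 2 * inner ℝ (X ω) (D ω)) P :=
    hX2.add (hin.const_mul 2)
  rw [integral_add hXin hD2, integral_add hX2 (hin.const_mul 2),
    integral_const_mul, hcross]
  simp

theorem sq_integral_norm_le [IsProbabilityMeasure P] {X : Ω → ℂ} (hX : MemLp X 2 P) :
    (∫ ω, ‖X ω‖ ∂P) ^ 2 ≤ ∫ ω, ‖X ω‖ ^ 2 ∂P := by
  have h1 := (hX.integrable (by norm_num)).norm
  have h2 := hX.integrable_norm_pow (p := 2) (by norm_num)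
  set c := ∫ ω, ‖X ω‖ ∂P with hc
  have h3 : 0 ≤ ∫ ω, (‖X ω‖ ^ 2 - 2 * c * ‖X ω‖ + c ^ 2) ∂P :=
    integral_nonneg fun ω => by
      have := sq_nonneg (‖X ω‖ - c)
      simp only [Pi.zero_apply]
      linarith
  have h4 : Integrable (fun ω => ‖X ω‖ ^ 2 - 2 * c * ‖X ω‖) P := h2.sub (h1.const_mul _)
  rw [integral_add h4 (integrable_const _), integral_sub h2 (h1.const_mul _), integral_const_mul,
    ← hc] at h3
  simp at h3
  linarith

/-- A random linear scheme driven by `T`: linear functionals `ξ n` of `x : X`, with values in `L²`,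
such that `ξ (n + 1)` is obtained from `ξ n` by a step `1 + (T - 1) / (s₀ + n + 1)` up to a
martingale increment of conditional variance `O((s₀ + n + 1)⁻²)`. -/
structure IsLinearScheme {X : Type*} [NormedAddCommGroup X] [NormedSpace ℂ X]
    (P : Measure Ω) (ℱ : Filtration ℕ mΩ) (T : X →L[ℂ] X) (s₀ K : ℝ) (ξ : ℕ → X → Ω → ℂ) :
    Prop where
  pos : 0 < s₀
  nonneg : 0 ≤ K
  adapted : ∀ n x, StronglyMeasurable[ℱ n] (ξ n x)
  memLp : ∀ n x, MemLp (ξ n x) 2 P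
  second_moment : ∀ n x, ∫ ω, ‖ξ n x ω‖ ^ 2 ∂P ≤ K * ‖x‖ ^ 2
  linear : ∀ n x y (c : ℂ), ξ n (x + c • y) =ᵐ[P] fun ω => ξ n x ω + c * ξ n y ω
  condExp_increment : ∀ n x,
    P[fun ω => ξ (n + 1) x ω - ξ n (x + (((s₀ + n + 1)⁻¹ : ℝ) : ℂ) • (T x - x)) ω | ℱ n] =ᵐ[P] 0
  increment : ∀ n x,
    ∫ ω, ‖ξ (n + 1) x ω - ξ n (x + (((s₀ + n + 1)⁻¹ : ℝ) : ℂ) • (T x - x)) ω‖ ^ 2 ∂P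
      ≤ K * ‖x‖ ^ 2 / (s₀ + n + 1) ^ 2

/-- The elementary inequality behind the rate `s ^ (-κ)` for a recursion with factors
`(1 - δ / s) ^ 2`. -/
theorem exists_sq_one_sub_div_le {δ κ : ℝ} (hδ : 0 < δ) (hκ : 0 ≤ κ) (hκ1 : κ ≤ 1)
    (hκδ : κ < 2 * δ) : ∃ ε S : ℝ, 0 < ε ∧ 2 ≤ S ∧ δ ≤ S ∧
      ∀ s, S ≤ s → (1 - δ / s) ^ 2 ≤ (1 - ε / s) * (1 - 1 / s) ^ κ := by
  set ε := (2 * δ - κ) / 2 with hε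
  have hε0 : 0 < ε := by rw [hε]; linarith
  refine ⟨ε, max 2 (max δ ((2 + 3 * δ ^ 2) / ε)), hε0, le_max_left _ _,
    (le_max_left _ _).trans (le_max_right _ _), fun s hs => ?_⟩
  have hs2 : 2 ≤ s := (le_max_left _ _).trans hs
  have hsδ : (2 + 3 * δ ^ 2) / ε ≤ s :=
    ((le_max_right _ _).trans (le_max_right _ _)).trans hs
  have hs0 : 0 < s := by linarith
  have hb : (1 - 1 / s) ^ κ * (1 + κ / (s - 1)) ≥ 1 := by
    have h1 : (1 + 1 / (s - 1)) ^ κ ≤ 1 + κ * (1 / (s - 1)) :=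
      rpow_one_add_le_one_add_mul_self
        (by have : 0 ≤ 1 / (s - 1) := div_nonneg zero_le_one (by linarith)
            linarith) hκ hκ1
    have h2 : (1 - 1 / s) ^ κ * (1 + 1 / (s - 1)) ^ κ = 1 := by
      have h4 : (1 - 1 / s) * (1 + 1 / (s - 1)) = 1 := by
        have : s - 1 ≠ 0 := by linarith
        field_simp
        ring
      rw [← Real.mul_rpow, h4, Real.one_rpow]
      · rw [sub_nonneg, div_le_one hs0]; linarith
      · have : 0 ≤ 1 / (s - 1) := div_nonneg zero_le_one (by linarith)
        linarith
    rw [ge_iff_le]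
    refine h2.symm.le.trans ?_
    refine mul_le_mul_of_nonneg_left (h1.trans (le_of_eq (by rw [mul_one_div]))) (Real.rpow_nonneg ?_ _)
    rw [sub_nonneg, div_le_one hs0]; linarith
  have hq0 : 0 < 1 + κ / (s - 1) := by
    have : 0 ≤ κ / (s - 1) := div_nonneg hκ (by linarith)
    linarith
  suffices h : (1 - δ / s) ^ 2 * (1 + κ / (s - 1)) ≤ 1 - ε / s by
    have h1 : 0 ≤ 1 - ε / s := le_trans (mul_nonneg (sq_nonneg _) hq0.le) h
    rw [← le_div_iff₀ hq0] at h
    refine h.trans ?_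
    rw [div_eq_mul_inv]
    refine mul_le_mul_of_nonneg_left ?_ h1
    rw [inv_le_iff_one_le_mul₀ hq0]
    exact hb
  have hκs : κ / (s - 1) ≤ κ / s + 2 / s ^ 2 := by
    rw [div_add_div _ _ hs0.ne' (by positivity), div_le_div_iff₀ (by linarith) (by positivity)]
    have h0 : 0 ≤ s * (2 * (s - 1) - κ * s) := mul_nonneg hs0.le (by nlinarith)
    nlinarith
  set w := 1 / s with hw
  have hw0 : 0 < w := by positivity
  have hw1 : w ≤ 1 / 2 := one_div_le_one_div_of_le (by norm_num) hs2
  have e1 : δ / s = δ * w := by rw [hw]; ring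
  have e2 : κ / s + 2 / s ^ 2 = κ * w + 2 * w ^ 2 := by rw [hw]; ring
  have e3 : ε / s = ε * w := by rw [hw]; ring
  have hwε : (2 + 3 * δ ^ 2) * w ≤ ε := by
    rw [div_le_iff₀ hε0] at hsδ
    rw [hw, mul_one_div, div_le_iff₀ hs0]
    linarith
  rw [e1, e3]
  rw [e2] at hκs
  calc (1 - δ * w) ^ 2 * (1 + κ / (s - 1)) ≤ (1 - δ * w) ^ 2 * (1 + (κ * w + 2 * w ^ 2)) := by
        gcongr
    _ = 1 + κ * w + 2 * w ^ 2 - 2 * δ * w + (δ ^ 2 * w ^ 2) * (1 + κ * w + 2 * w ^ 2)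
          - 2 * δ * w * (κ * w + 2 * w ^ 2) := by ring
    _ ≤ 1 + κ * w + 2 * w ^ 2 - 2 * δ * w + (δ ^ 2 * w ^ 2) * 3 - 0 := by
        have h1 : 1 + κ * w + 2 * w ^ 2 ≤ 3 := by nlinarith
        have h2 : 0 ≤ 2 * δ * w * (κ * w + 2 * w ^ 2) := by positivity
        gcongr
    _ = 1 + (κ - 2 * δ) * w + ((2 + 3 * δ ^ 2) * w) * w := by ring
    _ ≤ 1 + (κ - 2 * δ) * w + ε * w := by gcongr
    _ = 1 - ε * w := by rw [hε]; ring

variable {X : Type*} [NormedAddCommGroup X] [NormedSpace ℂ X] {ℱ : Filtration ℕ mΩ}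
  {T : X →L[ℂ] X} {s₀ K : ℝ} {ξ : ℕ → X → Ω → ℂ}

theorem IsLinearScheme.memLp_increment (h : IsLinearScheme P ℱ T s₀ K ξ) (n : ℕ) (x : X) :
    MemLp (fun ω => ξ (n + 1) x ω
      - ξ n (x + (((s₀ + n + 1)⁻¹ : ℝ) : ℂ) • (T x - x)) ω) 2 P :=
  (h.memLp _ _).sub (h.memLp _ _)

theorem IsLinearScheme.second_moment_succ_le [IsProbabilityMeasure P]
    (h : IsLinearScheme P ℱ T s₀ K ξ) (n : ℕ) (x : X) :
    ∫ ω, ‖ξ (n + 1) x ω‖ ^ 2 ∂P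
      ≤ ∫ ω, ‖ξ n (x + (((s₀ + n + 1)⁻¹ : ℝ) : ℂ) • (T x - x)) ω‖ ^ 2 ∂P
        + K * ‖x‖ ^ 2 / (s₀ + n + 1) ^ 2 := by
  have h1 := integral_norm_sq_add_of_condExp_eq_zero (ℱ.le n) (h.adapted n (x + (((s₀ + n + 1)⁻¹ : ℝ) : ℂ) • (T x - x))) (h.memLp n _)
    (h.memLp_increment n x) (h.condExp_increment n x)
  simp only [add_sub_cancel] at h1
  rw [h1]
  linarith [h.increment n x]

/-- Mean-square rate of a linear scheme. The steps contract by `1 - δ / s` in the norm `N`, so the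
second moments satisfy `φ (n + 1) ≤ (1 - δ / s) ^ 2 φ n + K / s ^ 2`, whose solutions decay like
`s ^ (-κ)` for `κ ≤ 1`, `κ < 2 δ`. -/
theorem exists_second_moment_le {T : X →L[ℂ] X} {ℓ : X →L[ℂ] ℂ} (hl : ∀ x, ℓ (T x) = ℓ x)
    {N : X → ℝ} {C S δ κ : ℝ} (hN : ∀ x, ‖x‖ ≤ N x) (hNC : ∀ x, N x ≤ C * ‖x‖)
    (hstep : ∀ s, S ≤ s → ∀ x, ℓ x = 0 →
      N (x + ((s⁻¹ : ℝ) : ℂ) • (T x - x)) ≤ (1 - δ / s) * N x)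
    (hδ : 0 < δ) (hκ : 0 ≤ κ) (hκ1 : κ ≤ 1) (hκδ : κ < 2 * δ) :
    ∃ A : ℝ, 0 ≤ A ∧ ∀ {Ω : Type v} {mΩ : MeasurableSpace Ω} {P : Measure Ω}
      [IsProbabilityMeasure P] {ℱ : Filtration ℕ mΩ} {s₀ K : ℝ} {ξ : ℕ → X → Ω → ℂ},
      IsLinearScheme P ℱ T s₀ K ξ → ∀ n : ℕ, 1 ≤ n → ∀ x, ℓ x = 0 →
        ∫ ω, ‖ξ n x ω‖ ^ 2 ∂P ≤ A * K * ((s₀ + 1) / (s₀ + n)) ^ κ * ‖x‖ ^ 2 := by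
  obtain ⟨ε, S', hε, hS2, hSδ, hε2⟩ := exists_sq_one_sub_div_le hδ hκ hκ1 hκδ
  obtain ⟨n₀, hn₀⟩ := exists_nat_ge (max S S')
  set A := max (n₀ : ℝ) (1 / ε) with hA
  have hA0 : 0 ≤ A := (Nat.cast_nonneg n₀).trans (le_max_left _ _)
  have hAε : 1 ≤ A * ε := by
    rw [← div_le_iff₀ hε]
    exact le_max_right _ _
  refine ⟨A * C ^ 2, by positivity, ?_⟩
  intro Ω mΩ P _ ℱ s₀ K ξ h
  have hs₀ := h.pos
  have hK := h.nonneg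
  have hN0 : ∀ x, 0 ≤ N x := fun x => (norm_nonneg x).trans (hN x)
  suffices hmain : ∀ n : ℕ, 1 ≤ n → ∀ x, ℓ x = 0 →
      ∫ ω, ‖ξ n x ω‖ ^ 2 ∂P ≤ A * K * ((s₀ + 1) / (s₀ + n)) ^ κ * N x ^ 2 by
    intro n hn x hx
    refine (hmain n hn x hx).trans ?_
    have h1 : N x ^ 2 ≤ (C * ‖x‖) ^ 2 := pow_le_pow_left₀ (hN0 x) (hNC x) 2
    calc A * K * ((s₀ + 1) / (s₀ + n)) ^ κ * N x ^ 2
        ≤ A * K * ((s₀ + 1) / (s₀ + n)) ^ κ * (C * ‖x‖) ^ 2 := by gcongr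
      _ = _ := by ring
  -- the claimed rate is at least `1 / t` for all `t` up to the current total mass
  have hrate : ∀ t : ℝ, 1 ≤ t → 1 / t ≤ (1 / t) ^ κ := fun t ht => by
    have h1 : 1 / t ≤ 1 := (div_le_one (by linarith)).2 ht
    calc 1 / t = (1 / t) ^ (1 : ℝ) := (Real.rpow_one _).symm
      _ ≤ (1 / t) ^ κ := Real.rpow_le_rpow_of_exponent_ge (by positivity) h1 hκ1
  intro n hn
  induction n, hn using Nat.le_induction with
  | base =>
    intro x hx
    refine (h.second_moment 1 x).trans ?_
    have h1 : ((s₀ + 1) / (s₀ + (1 : ℕ))) = 1 := by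
      rw [Nat.cast_one, div_self (by linarith)]
    rw [h1, Real.one_rpow, mul_one]
    have h2 : 1 ≤ A := by
      refine le_trans ?_ (le_max_left _ _)
      exact (by linarith : (1:ℝ) ≤ S').trans ((le_max_right _ _).trans hn₀)
    have h3 : ‖x‖ ^ 2 ≤ N x ^ 2 := pow_le_pow_left₀ (norm_nonneg x) (hN x) 2
    calc K * ‖x‖ ^ 2 ≤ K * N x ^ 2 := by gcongr
      _ = 1 * K * N x ^ 2 := by ring
      _ ≤ A * K * N x ^ 2 := by gcongr
  | succ n hn ih =>
    intro x hx
    have h3 : ‖x‖ ^ 2 ≤ N x ^ 2 := pow_le_pow_left₀ (norm_nonneg x) (hN x) 2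
    rcases le_or_gt (n + 1) n₀ with hnn | hnn
    · refine (h.second_moment (n + 1) x).trans ?_
      have hn1 : (1 : ℝ) ≤ ((n + 1 : ℕ) : ℝ) := by exact_mod_cast Nat.le_add_left 1 n
      have h4 : 1 / ((n + 1 : ℕ) : ℝ) ≤ ((s₀ + 1) / (s₀ + (n + 1 : ℕ))) ^ κ := by
        refine (hrate _ hn1).trans (Real.rpow_le_rpow (by positivity) ?_ hκ)
        rw [div_le_div_iff₀ (by linarith) (by linarith)]
        nlinarith
      have h5 : 1 ≤ A * ((s₀ + 1) / (s₀ + (n + 1 : ℕ))) ^ κ := by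
        calc (1 : ℝ) = ((n + 1 : ℕ) : ℝ) * (1 / ((n + 1 : ℕ) : ℝ)) := by field_simp
          _ ≤ A * ((s₀ + 1) / (s₀ + (n + 1 : ℕ))) ^ κ := by
              refine mul_le_mul ?_ h4 (by positivity) hA0
              exact le_trans (by exact_mod_cast hnn) (le_max_left _ _)
      calc K * ‖x‖ ^ 2 ≤ 1 * (K * N x ^ 2) := by rw [one_mul]; gcongr
        _ ≤ (A * ((s₀ + 1) / (s₀ + (n + 1 : ℕ))) ^ κ) * (K * N x ^ 2) := by gcongr
        _ = _ := by ring
    · set s : ℝ := s₀ + n + 1 with hs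
      have hsn : (n₀ : ℝ) ≤ n := by exact_mod_cast Nat.lt_succ_iff.1 hnn
      have hsS : max S S' ≤ s := hn₀.trans (by rw [hs]; linarith)
      have hsS1 : S ≤ s := (le_max_left _ _).trans hsS
      have hsS2 : S' ≤ s := (le_max_right _ _).trans hsS
      have hs2 : 2 ≤ s := hS2.trans hsS2
      have hs0 : 0 < s := by linarith
      have hcast : s₀ + ((n + 1 : ℕ) : ℝ) = s := by push_cast; ring
      have hcast' : s₀ + (n : ℝ) = s - 1 := by rw [hs]; ring
      have hx' : ℓ (x + ((s⁻¹ : ℝ) : ℂ) • (T x - x)) = 0 := by simp [hl, hx]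
      have h4 := h.second_moment_succ_le n x
      have h5 := ih _ hx'
      have h6 := hstep s hsS1 x hx
      have hδs : 0 ≤ 1 - δ / s := by
        rw [sub_nonneg, div_le_one hs0]
        exact hSδ.trans hsS2
      have h7 : N (x + ((s⁻¹ : ℝ) : ℂ) • (T x - x)) ^ 2 ≤ ((1 - δ / s) * N x) ^ 2 :=
        pow_le_pow_left₀ (hN0 _) h6 2
      rw [hcast'] at h5
      rw [hcast]
      have h8 : ((s₀ + 1) / (s - 1)) ^ κ * (1 - 1 / s) ^ κ = ((s₀ + 1) / s) ^ κ := by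
        rw [← Real.mul_rpow (div_nonneg (by linarith) (by linarith))
          (by rw [sub_nonneg, div_le_one hs0]; linarith)]
        congr 1
        have : s - 1 ≠ 0 := by linarith
        field_simp
      set a := ((s₀ + 1) / (s - 1)) ^ κ with ha
      have ha0 : 0 ≤ a := Real.rpow_nonneg (div_nonneg (by linarith) (by linarith)) _
      set b := ((s₀ + 1) / s) ^ κ with hb
      have h9 : 1 / s ≤ b := by
        refine (hrate s (by linarith)).trans (Real.rpow_le_rpow (by positivity) ?_ hκ)
        gcongr
        linarith
      have h10 : 0 ≤ N x ^ 2 := sq_nonneg _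
      calc ∫ ω, ‖ξ (n + 1) x ω‖ ^ 2 ∂P
          ≤ A * K * a * ((1 - δ / s) * N x) ^ 2 + K * N x ^ 2 / s ^ 2 := by
            refine h4.trans (add_le_add (h5.trans ?_) ?_)
            · gcongr
            · gcongr
        _ = A * K * a * N x ^ 2 * (1 - δ / s) ^ 2 + K * N x ^ 2 / s ^ 2 := by ring
        _ ≤ A * K * a * N x ^ 2 * ((1 - ε / s) * (1 - 1 / s) ^ κ) + K * N x ^ 2 / s ^ 2 := by
            gcongr
            exact hε2 s hsS2
        _ = A * K * N x ^ 2 * (1 - ε / s) * b + K * N x ^ 2 / s * (1 / s) := by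
            rw [← h8]; field_simp
        _ ≤ A * K * N x ^ 2 * (1 - ε / s) * b + (A * ε) * (K * N x ^ 2 / s) * b := by
            gcongr
            calc K * N x ^ 2 / s ≤ 1 * (K * N x ^ 2 / s) := by rw [one_mul]
              _ ≤ A * ε * (K * N x ^ 2 / s) := by gcongr
        _ = A * K * b * N x ^ 2 := by ring

end StochasticApproximation

/-! ### Almost sure convergence of linear schemes -/

section AlmostSureConvergence

variable {Ω : Type*} {mΩ : MeasurableSpace Ω} {P : Measure Ω}

theorem ae_summable_of_summable_integral_norm {A : ℕ → Ω → ℂ} (hA : ∀ n, Integrable (A n) P)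
    (hs : Summable fun n => ∫ ω, ‖A n ω‖ ∂P) : ∀ᵐ ω ∂P, Summable fun n => A n ω := by
  have h1 : ∑' n, ∫⁻ ω, ‖A n ω‖ₑ ∂P ≠ ∞ := by
    have h2 : ∀ n, ∫⁻ ω, ‖A n ω‖ₑ ∂P = ENNReal.ofReal (∫ ω, ‖A n ω‖ ∂P) := fun n =>
      (ofReal_integral_norm_eq_lintegral_enorm (hA n)).symm
    simp_rw [h2]
    rw [← ENNReal.ofReal_tsum_of_nonneg (fun n => integral_nonneg fun _ => norm_nonneg _) hs]
    exact ENNReal.ofReal_ne_top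
  rw [← lintegral_tsum fun n => (hA n).1.enorm] at h1
  filter_upwards [ae_lt_top' (AEMeasurable.tsum fun n => (hA n).1.enorm) h1] with ω hω
  have h3 := ENNReal.summable_toReal hω.ne
  refine Summable.of_norm (h3.congr fun n => ?_)
  simp

/-- Martingale convergence for complex sums of orthogonal increments. -/
theorem ae_exists_tendsto_sum_of_condExp_eq_zero [IsProbabilityMeasure P] {ℱ : Filtration ℕ mΩ}
    {D : ℕ → Ω → ℂ} (hadp : ∀ n, StronglyMeasurable[ℱ (n + 1)] (D n))
    (hL2 : ∀ n, MemLp (D n) 2 P) (h0 : ∀ n, P[D n | ℱ n] =ᵐ[P] 0)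
    (hs : Summable fun n => ∫ ω, ‖D n ω‖ ^ 2 ∂P) :
    ∀ᵐ ω ∂P, ∃ c : ℂ, Tendsto (fun n => ∑ i ∈ Finset.range n, D i ω) atTop (𝓝 c) := by
  set M : ℕ → Ω → ℂ := fun n ω => ∑ i ∈ Finset.range n, D i ω with hM
  have hMadp : ∀ n, StronglyMeasurable[ℱ n] (M n) := by
    intro n
    refine Finset.stronglyMeasurable_fun_sum _ fun i hi => ?_
    exact (hadp i).mono (ℱ.mono (Finset.mem_range.1 hi))
  have hM2 : ∀ n, MemLp (M n) 2 P := fun n => memLp_finsetSum _ fun i _ => hL2 i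
  have hMsq : ∀ n, ∫ ω, ‖M n ω‖ ^ 2 ∂P = ∑ i ∈ Finset.range n, ∫ ω, ‖D i ω‖ ^ 2 ∂P := by
    intro n
    induction n with
    | zero => simp [hM]
    | succ n ih =>
      rw [Finset.sum_range_succ, ← ih,
        ← integral_norm_sq_add_of_condExp_eq_zero (ℱ.le n) (hMadp n) (hM2 n) (hL2 n) (h0 n)]
      simp only [hM, Finset.sum_range_succ]
  set B := ∑' n, ∫ ω, ‖D n ω‖ ^ 2 ∂P with hB
  have hMB : ∀ n, ∫ ω, ‖M n ω‖ ∂P ≤ √B := fun n => by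
    refine Real.le_sqrt_of_sq_le ((sq_integral_norm_le (hM2 n)).trans ?_)
    rw [hMsq]
    exact hs.sum_le_tsum _ fun i _ => integral_nonneg fun _ => sq_nonneg _
  have key : ∀ L : ℂ →L[ℝ] ℝ, (∀ z, ‖L z‖ ≤ ‖z‖) →
      ∀ᵐ ω ∂P, ∃ c : ℝ, Tendsto (fun n => L (M n ω)) atTop (𝓝 c) := by
    intro L hL
    have hint : ∀ n, Integrable (M n) P := fun n => (hM2 n).integrable (by norm_num)
    have hmart : Martingale (fun n ω => L (M n ω)) ℱ P := by
      refine martingale_of_condExp_sub_eq_zero_nat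
        (fun n => L.continuous.comp_stronglyMeasurable (hMadp n))
        (fun n => L.integrable_comp (hint n)) fun n => ?_
      have h1 : (fun ω => L (M (n + 1) ω)) - (fun ω => L (M n ω)) = L ∘ D n := by
        ext ω
        simp [hM, Finset.sum_range_succ]
      rw [h1]
      have h2 := ContinuousLinearMap.comp_condExp_comm (m := ℱ n)
        ((hL2 n).integrable (by norm_num)) L
      filter_upwards [h2, h0 n] with ω h2 h3
      rw [← h2, Function.comp_apply, h3]
      simp
    refine hmart.submartingale.exists_ae_tendsto_of_bdd (R := ⟨√B, Real.sqrt_nonneg _⟩)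
      fun n => ?_
    rw [eLpNorm_one_eq_lintegral_enorm,
      ← ofReal_integral_norm_eq_lintegral_enorm (L.integrable_comp (hint n))]
    refine (ENNReal.ofReal_le_ofReal ((integral_mono (L.integrable_comp (hint n)).norm
      (hint n).norm fun ω => hL _).trans (hMB n))).trans (le_of_eq ?_)
    exact ENNReal.ofReal_eq_coe_nnreal (Real.sqrt_nonneg _)
  filter_upwards [key Complex.reCLM Complex.abs_re_le_norm,
    key Complex.imCLM Complex.abs_im_le_norm] with ω ⟨a, ha⟩ ⟨b, hb⟩
  refine ⟨a + b * Complex.I, ?_⟩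
  have h1 := ((Complex.continuous_ofReal.tendsto a).comp ha).add
    (((Complex.continuous_ofReal.tendsto b).comp hb).mul_const Complex.I)
  refine h1.congr fun n => ?_
  exact Complex.re_add_im (M n ω)

theorem ae_eq_zero_of_tendsto_of_integral_norm {Z : ℕ → Ω → ℂ}
    (hZ : ∀ n, Integrable (Z n) P) (h0 : Tendsto (fun n => ∫ ω, ‖Z n ω‖ ∂P) atTop (𝓝 0))
    (hc : ∀ᵐ ω ∂P, ∃ c : ℂ, Tendsto (fun n => Z n ω) atTop (𝓝 c)) :
    ∀ᵐ ω ∂P, Tendsto (fun n => Z n ω) atTop (𝓝 0) := by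
  have h1 : TendstoInMeasure P Z atTop (fun _ => (0 : ℂ)) := by
    refine tendstoInMeasure_of_tendsto_eLpNorm (p := 1) one_ne_zero (fun n => (hZ n).1)
      aestronglyMeasurable_const ?_
    have h2 : ∀ n, eLpNorm (Z n - fun _ => (0 : ℂ)) 1 P = ENNReal.ofReal (∫ ω, ‖Z n ω‖ ∂P) := by
      intro n
      rw [eLpNorm_one_eq_lintegral_enorm, ofReal_integral_norm_eq_lintegral_enorm (hZ n)]
      simp
    simp_rw [h2]
    simpa using ENNReal.tendsto_ofReal h0
  obtain ⟨ns, hns, hlim⟩ := h1.exists_seq_tendsto_ae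
  filter_upwards [hlim, hc] with ω h2 ⟨c, h3⟩
  rwa [tendsto_nhds_unique h2 (h3.comp hns.tendsto_atTop)]

variable {X : Type*} [NormedAddCommGroup X] [NormedSpace ℂ X] {ℱ : Filtration ℕ mΩ}
  {T : X →L[ℂ] X} {s₀ K : ℝ} {ξ : ℕ → X → Ω → ℂ}

/-- Almost sure rate of a linear scheme. The differences of `n ^ δ * ξ n x` are the sum of a drift
that is absolutely summable in mean and of martingale increments with summable variances, so the
sequence converges; the mean-square rate identifies the limit. -/
theorem IsLinearScheme.ae_tendsto_rpow_mul [IsProbabilityMeasure P]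
    (h : IsLinearScheme P ℱ T s₀ K ξ) {δ δ' A : ℝ} (hδ : 0 < δ) (hδ2 : δ < 1 / 2) (hδδ' : δ < δ')
    {x : X} (hx : ∀ n : ℕ, 1 ≤ n → ∫ ω, ‖ξ n x ω‖ ∂P ≤ A * (n : ℝ) ^ (-δ'))
    (hTx : ∀ n : ℕ, 1 ≤ n → ∫ ω, ‖ξ n (T x - x) ω‖ ∂P ≤ A * (n : ℝ) ^ (-δ')) :
    ∀ᵐ ω ∂P, Tendsto (fun n : ℕ => (n : ℝ) ^ δ * ‖ξ n x ω‖) atTop (𝓝 0) := by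
  have hs₀ := h.pos
  have hK := h.nonneg
  have hint : ∀ n y, Integrable (ξ n y) P := fun n y => (h.memLp n y).integrable (by norm_num)
  set F : ℕ → X := fun n => x + (((s₀ + n + 1)⁻¹ : ℝ) : ℂ) • (T x - x) with hF
  set Z : ℕ → Ω → ℂ := fun n ω => (((n : ℝ) ^ δ : ℝ) : ℂ) * ξ n x ω with hZ
  set A' : ℕ → Ω → ℂ := fun n ω => ((((n + 1 : ℕ) : ℝ) ^ δ : ℝ) : ℂ) * ξ n (F n) ω - Z n ω with hA'
  set D : ℕ → Ω → ℂ := fun n ω =>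
    ((((n + 1 : ℕ) : ℝ) ^ δ : ℝ) : ℂ) * (ξ (n + 1) x ω - ξ n (F n) ω) with hD
  have hZint : ∀ n, Integrable (Z n) P := fun n => (hint n x).const_mul _
  have hsucc : ∀ n ω, Z (n + 1) ω = Z n ω + (A' n ω + D n ω) := fun n ω => by
    simp only [hZ, hA', hD]; ring
  have hsum : ∀ n ω, Z n ω = Z 0 ω + (∑ i ∈ Finset.range n, A' i ω + ∑ i ∈ Finset.range n, D i ω) := by
    intro n ω
    induction n with
    | zero => simp
    | succ n ih => rw [hsucc, ih, Finset.sum_range_succ, Finset.sum_range_succ]; ring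
  -- the drift
  have hAint : ∀ n, Integrable (A' n) P := fun n => ((hint n _).const_mul _).sub (hZint n)
  have hAbound : ∀ n : ℕ, 1 ≤ n → ∫ ω, ‖A' n ω‖ ∂P ≤ 2 * A * (n : ℝ) ^ (δ - 1 - δ') := by
    intro n hn
    have hn0 : (0 : ℝ) < n := by exact_mod_cast hn
    set c₁ : ℝ := ((n + 1 : ℕ) : ℝ) ^ δ - (n : ℝ) ^ δ with hc₁
    set c₂ : ℝ := ((n + 1 : ℕ) : ℝ) ^ δ * (s₀ + n + 1)⁻¹ with hc₂
    have hc₁0 : 0 ≤ c₁ := by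
      rw [hc₁, sub_nonneg]
      refine Real.rpow_le_rpow hn0.le ?_ hδ.le
      push_cast; linarith
    have hc₂0 : 0 ≤ c₂ := by positivity
    have hc₁1 : c₁ ≤ (n : ℝ) ^ (δ - 1) := by
      have h1 : ((n + 1 : ℕ) : ℝ) ^ δ = (n : ℝ) ^ δ * (1 + 1 / n) ^ δ := by
        rw [← Real.mul_rpow hn0.le (by positivity)]
        congr 1
        push_cast
        field_simp
      have h2 : (1 + 1 / (n : ℝ)) ^ δ ≤ 1 + δ * (1 / n) :=
        rpow_one_add_le_one_add_mul_self
          (by have : 0 ≤ 1 / (n : ℝ) := by positivity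
              linarith) hδ.le (by linarith)
      have h3 : δ * (1 / (n : ℝ)) ≤ 1 / n := by
        have : 0 ≤ 1 / (n : ℝ) := by positivity
        nlinarith
      rw [hc₁, h1, Real.rpow_sub_one hn0.ne']
      have h4 : (n : ℝ) ^ δ * (1 + 1 / n) ^ δ ≤ (n : ℝ) ^ δ * (1 + 1 / n) := by
        refine mul_le_mul_of_nonneg_left ?_ (by positivity)
        linarith
      calc (n : ℝ) ^ δ * (1 + 1 / n) ^ δ - (n : ℝ) ^ δ
          ≤ (n : ℝ) ^ δ * (1 + 1 / n) - (n : ℝ) ^ δ := by linarith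
        _ = (n : ℝ) ^ δ / n := by ring
    have hc₂1 : c₂ ≤ (n : ℝ) ^ (δ - 1) := by
      have hn1 : (0 : ℝ) < ((n + 1 : ℕ) : ℝ) := by positivity
      calc c₂ ≤ ((n + 1 : ℕ) : ℝ) ^ δ * (((n + 1 : ℕ) : ℝ))⁻¹ := by
            rw [hc₂]
            gcongr
            push_cast
            linarith
        _ = ((n + 1 : ℕ) : ℝ) ^ (δ - 1) := by rw [Real.rpow_sub_one hn1.ne']; ring
        _ ≤ (n : ℝ) ^ (δ - 1) := by
            refine Real.rpow_le_rpow_of_nonpos hn0 ?_ (by linarith)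
            push_cast; linarith
    have hae : ∀ᵐ ω ∂P, ‖A' n ω‖ ≤ c₁ * ‖ξ n x ω‖ + c₂ * ‖ξ n (T x - x) ω‖ := by
      filter_upwards [h.linear n x (T x - x) (((s₀ + n + 1)⁻¹ : ℝ) : ℂ)] with ω hω
      have h1 : A' n ω = (c₁ : ℂ) * ξ n x ω + (c₂ : ℂ) * ξ n (T x - x) ω := by
        simp only [hA', hZ, hF, hω, hc₁, hc₂]
        push_cast
        ring
      rw [h1]
      refine (norm_add_le _ _).trans (le_of_eq ?_)
      rw [norm_mul, norm_mul, Complex.norm_real, Complex.norm_real, Real.norm_of_nonneg hc₁0,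
        Real.norm_of_nonneg hc₂0]
    have h1 := integral_mono_ae (hAint n).norm
      (((hint n x).norm.const_mul c₁).add ((hint n (T x - x)).norm.const_mul c₂)) hae
    refine h1.trans ?_
    simp only [Pi.add_apply]
    rw [integral_add ((hint n x).norm.const_mul c₁) ((hint n (T x - x)).norm.const_mul c₂),
      integral_const_mul, integral_const_mul]
    calc c₁ * ∫ ω, ‖ξ n x ω‖ ∂P + c₂ * ∫ ω, ‖ξ n (T x - x) ω‖ ∂P
        ≤ (n : ℝ) ^ (δ - 1) * (A * (n : ℝ) ^ (-δ')) + (n : ℝ) ^ (δ - 1) * (A * (n : ℝ) ^ (-δ')) := by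
          refine add_le_add (mul_le_mul hc₁1 (hx n hn) (integral_nonneg fun _ => norm_nonneg _)
            (by positivity)) (mul_le_mul hc₂1 (hTx n hn) (integral_nonneg fun _ => norm_nonneg _)
            (by positivity))
      _ = 2 * A * ((n : ℝ) ^ (δ - 1) * (n : ℝ) ^ (-δ')) := by ring
      _ = 2 * A * (n : ℝ) ^ (δ - 1 - δ') := by rw [← Real.rpow_add hn0]; ring_nf
  have hAsum : Summable fun n => ∫ ω, ‖A' n ω‖ ∂P := by
    have h1 : Summable fun n : ℕ => 2 * A * (n : ℝ) ^ (δ - 1 - δ') :=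
      (Real.summable_nat_rpow.2 (by linarith)).mul_left _
    rw [← summable_nat_add_iff 1] at h1 ⊢
    refine Summable.of_nonneg_of_le (fun n => integral_nonneg fun _ => norm_nonneg _)
      (fun n => ?_) h1
    exact hAbound (n + 1) (Nat.le_add_left 1 n)
  -- the martingale part
  have hDbound : ∀ n : ℕ, ∫ ω, ‖D n ω‖ ^ 2 ∂P ≤ K * ‖x‖ ^ 2 * ((n + 1 : ℕ) : ℝ) ^ (2 * δ - 2) := by
    intro n
    have hn1 : (0 : ℝ) < ((n + 1 : ℕ) : ℝ) := by positivity
    have h1 : ∀ ω, ‖D n ω‖ ^ 2 = ((n + 1 : ℕ) : ℝ) ^ (2 * δ) * ‖ξ (n + 1) x ω - ξ n (F n) ω‖ ^ 2 := by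
      intro ω
      simp only [hD, norm_mul, Complex.norm_real, mul_pow]
      rw [Real.norm_of_nonneg (by positivity), ← Real.rpow_natCast, ← Real.rpow_mul hn1.le]
      congr 2
      push_cast; ring
    simp_rw [h1]
    rw [integral_const_mul, Real.rpow_sub hn1]
    have h2 : K * ‖x‖ ^ 2 / (s₀ + n + 1) ^ 2 ≤ K * ‖x‖ ^ 2 / ((n + 1 : ℕ) : ℝ) ^ 2 := by
      gcongr
      push_cast; linarith
    calc ((n + 1 : ℕ) : ℝ) ^ (2 * δ) * ∫ ω, ‖ξ (n + 1) x ω - ξ n (F n) ω‖ ^ 2 ∂P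
        ≤ ((n + 1 : ℕ) : ℝ) ^ (2 * δ) * (K * ‖x‖ ^ 2 / ((n + 1 : ℕ) : ℝ) ^ 2) :=
          mul_le_mul_of_nonneg_left ((h.increment n x).trans h2) (by positivity)
      _ = K * ‖x‖ ^ 2 * (((n + 1 : ℕ) : ℝ) ^ (2 * δ) / ((n + 1 : ℕ) : ℝ) ^ (2 : ℝ)) := by
          rw [Real.rpow_two]; ring
  have hDsum : Summable fun n => ∫ ω, ‖D n ω‖ ^ 2 ∂P := by
    have h1 : Summable fun n : ℕ => K * ‖x‖ ^ 2 * (n : ℝ) ^ (2 * δ - 2) :=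
      (Real.summable_nat_rpow.2 (by linarith)).mul_left _
    rw [← summable_nat_add_iff 1] at h1
    exact Summable.of_nonneg_of_le (fun n => integral_nonneg fun _ => sq_nonneg _) hDbound h1
  have hDconv := ae_exists_tendsto_sum_of_condExp_eq_zero (P := P) (ℱ := ℱ) (D := D)
    (fun n => ((h.adapted (n + 1) x).sub ((h.adapted n (F n)).mono
      (ℱ.mono (Nat.le_succ n)))).const_mul _)
    (fun n => (h.memLp_increment n x).const_mul _)
    (fun n => by
      have h1 := condExp_smul (m := ℱ n) (μ := P) ((((n + 1 : ℕ) : ℝ) ^ δ : ℝ) : ℂ)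
        (fun ω => ξ (n + 1) x ω - ξ n (F n) ω)
      filter_upwards [h1, h.condExp_increment n x] with ω h1 h2
      have h3 : D n = ((((n + 1 : ℕ) : ℝ) ^ δ : ℝ) : ℂ) •
        (fun ω => ξ (n + 1) x ω - ξ n (F n) ω) := rfl
      rw [h3, h1, Pi.smul_apply, h2]
      simp) hDsum
  have hZconv : ∀ᵐ ω ∂P, ∃ c : ℂ, Tendsto (fun n => Z n ω) atTop (𝓝 c) := by
    filter_upwards [ae_summable_of_summable_integral_norm hAint hAsum, hDconv] with ω h1 ⟨d, h2⟩
    refine ⟨_, ((h1.hasSum.tendsto_sum_nat.add h2).const_add (Z 0 ω)).congr fun n => ?_⟩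
    rw [hsum n ω]
  have hZ0 : Tendsto (fun n => ∫ ω, ‖Z n ω‖ ∂P) atTop (𝓝 0) := by
    have h1 : Tendsto (fun n : ℕ => A * (n : ℝ) ^ (-(δ' - δ))) atTop (𝓝 0) := by
      simpa using ((tendsto_rpow_neg_atTop (by linarith : 0 < δ' - δ)).comp
        tendsto_natCast_atTop_atTop).const_mul A
    refine squeeze_zero' (Eventually.of_forall fun n => integral_nonneg fun _ => norm_nonneg _) ?_ h1
    filter_upwards [eventually_ge_atTop 1] with n hn
    have hn0 : (0 : ℝ) < n := by exact_mod_cast hn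
    have h2 : ∀ ω, ‖Z n ω‖ = (n : ℝ) ^ δ * ‖ξ n x ω‖ := fun ω => by
      simp only [hZ, norm_mul, Complex.norm_real]
      rw [Real.norm_of_nonneg (by positivity)]
    simp_rw [h2]
    rw [integral_const_mul]
    calc (n : ℝ) ^ δ * ∫ ω, ‖ξ n x ω‖ ∂P ≤ (n : ℝ) ^ δ * (A * (n : ℝ) ^ (-δ')) :=
          mul_le_mul_of_nonneg_left (hx n hn) (by positivity)
      _ = A * ((n : ℝ) ^ δ * (n : ℝ) ^ (-δ')) := by ring
      _ = A * (n : ℝ) ^ (-(δ' - δ)) := by rw [← Real.rpow_add hn0]; ring_nf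
  filter_upwards [ae_eq_zero_of_tendsto_of_integral_norm hZint hZ0 hZconv] with ω hω
  have := hω.norm
  rw [norm_zero] at this
  refine this.congr fun n => ?_
  simp only [hZ, norm_mul, Complex.norm_real]
  rw [Real.norm_of_nonneg (by positivity)]

end AlmostSureConvergence

/-! ### Integrals against signed measures -/

section SignedIntegral

variable {E : Type u} [MeasurableSpace E]

instance isFiniteMeasure_variation (m : SignedMeasure E) : IsFiniteMeasure m.variation := by
  rw [← SignedMeasure.totalVariation_eq_variation]
  unfold SignedMeasure.totalVariation
  infer_instance

theorem exists_measure_of_nonneg {m : SignedMeasure E} (hm : ∀ A, MeasurableSet A → 0 ≤ m A) :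
    ∃ (m' : Measure E) (_ : IsFiniteMeasure m'), m'.toSignedMeasure = m ∧ m.variation = m' := by
  have h0 : VectorMeasure.restrict 0 Set.univ ≤ m.restrict Set.univ := by
    rw [VectorMeasure.restrict_le_restrict_iff _ _ MeasurableSet.univ]
    intro A hA _
    exact hm A hA
  have h1 := SignedMeasure.toMeasureOfZeroLE_toSignedMeasure m h0
  refine ⟨m.toMeasureOfZeroLE Set.univ MeasurableSet.univ h0, inferInstance, h1, ?_⟩
  conv_lhs => rw [← h1]
  exact Measure.variation_toSignedMeasure

theorem variation_apply_of_nonneg {m : SignedMeasure E} (hm : ∀ A, MeasurableSet A → 0 ≤ m A)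
    {A : Set E} (hA : MeasurableSet A) : m.variation A = ENNReal.ofReal (m A) := by
  obtain ⟨m', _, rfl, h⟩ := exists_measure_of_nonneg hm
  rw [h, Measure.toSignedMeasure_apply_measurable hA, ofReal_measureReal]

variable {F : Type*} [NormedAddCommGroup F]

/-- Bounded measurable functions are uniform limits of simple functions. -/
theorem exists_simpleFunc_norm_sub_le [ProperSpace F] [MeasurableSpace F] [BorelSpace F]
    {f : E → F} (hf : Measurable f) {C : ℝ}
    (hC : ∀ y, ‖f y‖ ≤ C) {ε : ℝ} (hε : 0 < ε) : ∃ g : SimpleFunc E F, ∀ y, ‖f y - g y‖ ≤ ε := by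
  obtain ⟨t, ht⟩ := (isCompact_closedBall (0 : F) C).elim_finite_subcover
    (fun k => Metric.ball (TopologicalSpace.denseSeq F k) ε) (fun k => Metric.isOpen_ball)
    fun z _ => by
      obtain ⟨k, hk⟩ := (TopologicalSpace.denseRange_denseSeq F).exists_dist_lt z hε
      exact Set.mem_iUnion.2 ⟨k, hk⟩
  refine ⟨(SimpleFunc.nearestPt (TopologicalSpace.denseSeq F) (t.sup id)).comp f hf, fun y => ?_⟩
  obtain ⟨k, hk, hky⟩ := Set.mem_iUnion₂.1 (ht (mem_closedBall_zero_iff.2 (hC y)))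
  have h1 := SimpleFunc.edist_nearestPt_le (TopologicalSpace.denseSeq F) (f y)
    (Finset.le_sup (f := id) hk)
  rw [edist_dist, edist_dist, ENNReal.ofReal_le_ofReal_iff dist_nonneg, dist_comm,
    dist_comm _ (f y), dist_eq_norm] at h1
  exact h1.trans (le_of_lt hky)

/-- The cut-off of `f` to `{W ≤ c}`. -/
noncomputable def truncation (W : Weight E) (c : ℝ) (f : E → F) : E → F := {y | W y ≤ c}.indicator f

theorem measurableSet_weight_le (W : Weight E) (c : ℝ) : MeasurableSet {y | W y ≤ c} :=
  measurableSet_le W.measurable' measurable_const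

theorem norm_truncation_le (W : Weight E) (c : ℝ) (f : E → F) (y : E) :
    ‖truncation W c f y‖ ≤ ‖f y‖ := norm_indicator_le_norm_self _ _

theorem norm_truncation_le_const {W : Weight E} {q : ℝ} (hq : 0 ≤ q) (c : ℝ) {f : E → F} {C : ℝ}
    (hC : 0 ≤ C) (hf : ∀ y, ‖f y‖ ≤ C * W y ^ q) (y : E) :
    ‖truncation W c f y‖ ≤ C * |c| ^ q := by
  by_cases h : W y ≤ c
  · rw [truncation, Set.indicator_of_mem (by exact h)]
    refine (hf y).trans (mul_le_mul_of_nonneg_left ?_ hC)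
    exact Real.rpow_le_rpow (W.pos y).le (h.trans (le_abs_self c)) hq
  · rw [truncation, Set.indicator_of_notMem (by exact h), norm_zero]
    positivity

theorem tendsto_truncation (W : Weight E) (f : E → F) (y : E) :
    Tendsto (fun k : ℕ => truncation W k f y) atTop (𝓝 (f y)) := by
  refine tendsto_const_nhds.congr' ?_
  filter_upwards [eventually_ge_atTop (Nat.ceil (W y))] with k hk
  have h : y ∈ {y | W y ≤ k} := (Nat.le_ceil (W y)).trans (Nat.cast_le.2 hk)
  rw [truncation, Set.indicator_of_mem h]

theorem measurable_truncation [MeasurableSpace F] (W : Weight E) (c : ℝ) {f : E → F} (hf : Measurable f) :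
    Measurable (truncation W c f) := hf.indicator (measurableSet_weight_le W c)

theorem integrable_signed_of_bounded [ProperSpace F] [MeasurableSpace F] [BorelSpace F]
    (m : SignedMeasure E) {f : E → F} (hf : Measurable f) {C : ℝ}
    (hC : ∀ y, ‖f y‖ ≤ C) : m.Integrable f :=
  Integrable.of_bound hf.aestronglyMeasurable C (Eventually.of_forall hC)

theorem integrable_signed_of_le {W : Weight E} {q : ℝ} {m : SignedMeasure E}
    (hm : m.Integrable fun y => W y ^ q) {f : E → F} (hf : AEStronglyMeasurable f m.variation)
    {C : ℝ} (hfC : ∀ y, ‖f y‖ ≤ C * W y ^ q) : m.Integrable f :=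
  (hm.const_mul C).mono' hf (Eventually.of_forall hfC)

variable [NormedSpace ℝ F]

theorem integral_signed_of_nonneg {m : SignedMeasure E} (hm : ∀ A, MeasurableSet A → 0 ≤ m A)
    (f : E → F) : ∫ᵛ y, f y ∂<•m = ∫ y, f y ∂m.variation := by
  obtain ⟨m', _, rfl, h⟩ := exists_measure_of_nonneg hm
  rw [h, VectorMeasure.integral_toSignedMeasure]

theorem enorm_integral_signed_le (m : SignedMeasure E) (f : E → F) :
    ‖∫ᵛ y, f y ∂<•m‖ₑ ≤ ∫⁻ y, ‖f y‖ₑ ∂m.variation := by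
  rcases subsingleton_or_nontrivial F with hF | hF
  · simp [Subsingleton.elim (∫ᵛ y, f y ∂<•m) 0]
  · have := VectorMeasure.enorm_integral_le_lintegral_enorm_transpose
      (μ := m) (f := f) (B := (ContinuousLinearMap.lsmul ℝ ℝ).flip)
    rwa [VectorMeasure.variation_transpose_lsmul_flip] at this

/-- A signed measure that is positive off `x` integrates functions vanishing at `x` as its total
variation does. -/
theorem integral_signed_of_positive_off {m : SignedMeasure E} {x : E}
    (hm : ∀ A, MeasurableSet A → x ∉ A → 0 ≤ m A) {f : E → F} {A : Set E} (hA : MeasurableSet A)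
    (hx : x ∉ A) (hf : ∀ y, y ∉ A → f y = 0) : ∫ᵛ y, f y ∂<•m = ∫ y, f y ∂m.variation := by
  rw [← VectorMeasure.setIntegral_eq_integral_of_forall_compl_eq_zero hA hf,
    integral_signed_of_nonneg, VectorMeasure.variation_restrict hA,
    setIntegral_eq_integral_of_forall_compl_eq_zero hf]
  intro B hB
  rw [VectorMeasure.restrict_apply _ hA hB]
  exact hm _ (hB.inter hA) fun h => hx h.2

variable [ProperSpace F] [MeasurableSpace F] [BorelSpace F]

theorem measurable_integral_simpleFunc (g : SimpleFunc E F) :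
    Measurable fun m : SignedMeasure E => ∫ᵛ y, g y ∂<•m := by
  induction g using SimpleFunc.induction with
  | const c hs =>
    rename_i s
    have : ∀ m : SignedMeasure E, ∫ᵛ y, (SimpleFunc.piecewise s hs (SimpleFunc.const E c)
        (SimpleFunc.const E 0)) y ∂<•m = m s • c := by
      intro m
      have h1 : ((SimpleFunc.piecewise s hs (SimpleFunc.const E c)
        (SimpleFunc.const E 0) : SimpleFunc E F) : E → F) = s.indicator fun _ => c := by
        ext y; simp [Set.indicator, Set.piecewise]
      rw [h1, VectorMeasure.integral_indicator_const _ hs]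
      simp
    simp only [this]
    exact (measurable_eval hs).smul_const c
  | add hdisj hf hg =>
    rename_i f g
    have : ∀ m : SignedMeasure E, ∫ᵛ y, (f + g) y ∂<•m
        = ∫ᵛ y, f y ∂<•m + ∫ᵛ y, g y ∂<•m := fun m =>
      VectorMeasure.integral_fun_add (μ := m) (f := fun y => f y) (g := fun y => g y)
        (f.integrable_of_isFiniteMeasure (μ := m.variation))
        (g.integrable_of_isFiniteMeasure (μ := m.variation))
    simp only [this]
    exact hf.add hg

theorem measurable_integral_of_bounded {f : E → F} (hf : Measurable f) {C : ℝ}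
    (hC : ∀ y, ‖f y‖ ≤ C) : Measurable fun m : SignedMeasure E => ∫ᵛ y, f y ∂<•m := by
  refine measurable_of_tendsto_metrizable (fun n => measurable_integral_simpleFunc
    (SimpleFunc.approxOn f hf Set.univ 0 (Set.mem_univ _) n)) ?_
  refine tendsto_pi_nhds.2 fun m => ?_
  refine VectorMeasure.tendsto_integral_of_dominated_convergence
    (fun y => C + C) (fun n => (SimpleFunc.aestronglyMeasurable _))
    (integrable_const _) (fun n => Eventually.of_forall fun y => ?_)
    (Eventually.of_forall fun y => ?_)
  · exact (SimpleFunc.norm_approxOn_zero_le hf (Set.mem_univ 0) y n).trans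
      (add_le_add (hC y) (hC y))
  · exact SimpleFunc.tendsto_approxOn _ _ (by simp)

/-- The integral of `f` against a signed measure as the limit of the integrals of its cut-offs.
Contrary to `∫ᵛ`, whose junk value depends on the (possibly non-measurable) set of signed measures
for which `f` is integrable, it is measurable in the signed measure. -/
noncomputable def limIntegral (W : Weight E) (f : E → F) (m : SignedMeasure E) : F :=
  limUnder atTop fun k : ℕ => ∫ᵛ y, truncation W k f y ∂<•m

theorem tendsto_integral_truncation (W : Weight E) {f : E → F} (hf : Measurable f)
    {m : SignedMeasure E} (hm : m.Integrable f) :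
    Tendsto (fun k : ℕ => ∫ᵛ y, truncation W k f y ∂<•m) atTop (𝓝 (∫ᵛ y, f y ∂<•m)) :=
  VectorMeasure.tendsto_integral_of_dominated_convergence (fun y => ‖f y‖)
    (fun k => (measurable_truncation W k hf).aestronglyMeasurable) hm.norm
    (fun k => Eventually.of_forall fun y => norm_truncation_le W k f y)
    (Eventually.of_forall fun y => tendsto_truncation W f y)

theorem limIntegral_eq (W : Weight E) {f : E → F} (hf : Measurable f) {m : SignedMeasure E}
    (hm : m.Integrable f) : limIntegral W f m = ∫ᵛ y, f y ∂<•m :=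
  (tendsto_integral_truncation W hf hm).limUnder_eq

theorem stronglyMeasurable_limIntegral {W : Weight E} {q : ℝ} (hq : 0 ≤ q) {f : E → F}
    (hf : Measurable f) {C : ℝ} (hC : 0 ≤ C) (hfC : ∀ y, ‖f y‖ ≤ C * W y ^ q) :
    StronglyMeasurable (limIntegral W f : SignedMeasure E → F) :=
  StronglyMeasurable.limUnder fun k : ℕ => (measurable_integral_of_bounded
    (measurable_truncation W k hf) (norm_truncation_le_const hq k hC hfC)).stronglyMeasurable

end SignedIntegral

/-! ### Random signed measures: bounded integrands -/

section ReplacementMoments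

variable {E : Type u} [MeasurableSpace E] {F : Type*} [NormedAddCommGroup F] [NormedSpace ℝ F]
  {R : Kernel E (SignedMeasure E)} {W : Weight E} {q K : ℝ} {x : E}

theorem enorm_integral_signed_le_of_le_weight (m : SignedMeasure E) {f : E → F} {c : ℝ}
    (hc : 0 ≤ c) (hf : ∀ y, ‖f y‖ ≤ c * W y) :
    ‖∫ᵛ y, f y ∂<•m‖ₑ ≤ ENNReal.ofReal c * ∫⁻ y, ENNReal.ofReal (W y) ∂m.variation := by
  refine (enorm_integral_signed_le m f).trans ?_
  rw [← lintegral_const_mul' _ _ ENNReal.ofReal_ne_top]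
  refine lintegral_mono fun y => ?_
  rw [← ENNReal.ofReal_mul hc, ← ofReal_norm]
  exact ENNReal.ofReal_le_ofReal (hf y)

theorem lintegral_enorm_integral_signed_le
    (hK : ∫⁻ m, ∫⁻ y, ENNReal.ofReal (W y) ∂(m.variation) ∂(R x) ≤ ENNReal.ofReal (K * W x))
    {f : E → F} {c : ℝ} (hc : 0 ≤ c) (hf : ∀ y, ‖f y‖ ≤ c * W y) :
    ∫⁻ m, ‖∫ᵛ y, f y ∂<•m‖ₑ ∂(R x) ≤ ENNReal.ofReal (c * (K * W x)) := by
  calc ∫⁻ m, ‖∫ᵛ y, f y ∂<•m‖ₑ ∂(R x)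
      ≤ ∫⁻ m, ENNReal.ofReal c * ∫⁻ y, ENNReal.ofReal (W y) ∂(m.variation) ∂(R x) :=
        lintegral_mono fun m => enorm_integral_signed_le_of_le_weight m hc hf
    _ = ENNReal.ofReal c * ∫⁻ m, ∫⁻ y, ENNReal.ofReal (W y) ∂(m.variation) ∂(R x) :=
        lintegral_const_mul' _ _ ENNReal.ofReal_ne_top
    _ ≤ ENNReal.ofReal c * ENNReal.ofReal (K * W x) := by gcongr
    _ = _ := (ENNReal.ofReal_mul hc).symm

theorem lintegral_sq_le_of_momentBound [IsMarkovKernel R] (hq : 2 ≤ q) {C : ℝ} (hC : 0 < C)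
    (h : ∫⁻ m, (∫⁻ y, ENNReal.ofReal (W y) ∂m.variation) ^ q ∂(R x)
      ≤ ENNReal.ofReal (C * W x ^ q)) :
    ∫⁻ m, (∫⁻ y, ENNReal.ofReal (W y) ∂m.variation) ^ (2 : ℝ) ∂(R x)
      ≤ ENNReal.ofReal ((1 + C) * W x ^ q) := by
  have hel : ∀ t : ℝ≥0∞, t ^ (2 : ℝ) ≤ 1 + t ^ q := fun t => by
    rcases le_total t 1 with ht | ht
    · exact (ENNReal.rpow_le_one ht (by norm_num)).trans le_self_add
    · exact (ENNReal.rpow_le_rpow_of_exponent_le ht hq).trans le_add_self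
  calc ∫⁻ m, (∫⁻ y, ENNReal.ofReal (W y) ∂m.variation) ^ (2 : ℝ) ∂(R x)
      ≤ ∫⁻ m, (1 + (∫⁻ y, ENNReal.ofReal (W y) ∂m.variation) ^ q) ∂(R x) :=
        lintegral_mono fun m => hel _
    _ = 1 + ∫⁻ m, (∫⁻ y, ENNReal.ofReal (W y) ∂m.variation) ^ q ∂(R x) := by
        rw [lintegral_add_left measurable_const]; simp
    _ ≤ ENNReal.ofReal (W x ^ q) + ENNReal.ofReal (C * W x ^ q) := by
        gcongr
        rw [ENNReal.one_le_ofReal]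
        exact Real.one_le_rpow (W.one_le' x) (by linarith)
    _ = ENNReal.ofReal ((1 + C) * W x ^ q) := by
        have := Real.rpow_nonneg (W.pos x).le q
        rw [← ENNReal.ofReal_add this (by positivity)]
        ring_nf

theorem le_mul_weight_of_bounded {G : Type*} [NormedAddCommGroup G] {f : E → G} {c : ℝ} (hc : 0 ≤ c)
    (hf : ∀ y, ‖f y‖ ≤ c) (y : E) :
    ‖f y‖ ≤ c * W y :=
  (hf y).trans (le_mul_of_one_le_right hc (W.one_le' y))

theorem norm_integral_integral_signed_le
    (hK : ∫⁻ m, ∫⁻ y, ENNReal.ofReal (W y) ∂(m.variation) ∂(R x) ≤ ENNReal.ofReal (K * W x))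
    (hK0 : 0 ≤ K) {f : E → F} {c : ℝ} (hc : 0 ≤ c) (hf : ∀ y, ‖f y‖ ≤ c * W y) :
    ‖∫ m, ∫ᵛ y, f y ∂<•m ∂(R x)‖ ≤ c * (K * W x) := by
  have h1 := (enorm_integral_le_lintegral_enorm
    (fun m : SignedMeasure E => ∫ᵛ y, f y ∂<•m) (μ := R x)).trans
    (lintegral_enorm_integral_signed_le hK hc hf)
  rw [← ofReal_norm] at h1
  have := (W.pos x).le
  exact (ENNReal.ofReal_le_ofReal_iff (by positivity)).1 h1

variable [ProperSpace F] [MeasurableSpace F] [BorelSpace F]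

theorem integrable_integral_signed_of_bounded
    (hK : ∫⁻ m, ∫⁻ y, ENNReal.ofReal (W y) ∂(m.variation) ∂(R x) ≤ ENNReal.ofReal (K * W x))
    {f : E → F} (hfm : Measurable f) {c : ℝ} (hc : 0 ≤ c) (hf : ∀ y, ‖f y‖ ≤ c) :
    Integrable (fun m : SignedMeasure E => ∫ᵛ y, f y ∂<•m) (R x) := by
  refine ⟨(measurable_integral_of_bounded hfm hf).aestronglyMeasurable, ?_⟩
  exact (lintegral_enorm_integral_signed_le hK hc (le_mul_weight_of_bounded hc hf)).trans_lt
    ENNReal.ofReal_lt_top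

theorem integral_integral_simpleFunc
    (hK : ∫⁻ m, ∫⁻ y, ENNReal.ofReal (W y) ∂(m.variation) ∂(R x) ≤ ENNReal.ofReal (K * W x))
    {M : SignedMeasure E} (hM : ∀ A, MeasurableSet A → M A = ∫ m, m A ∂(R x))
    (g : SimpleFunc E F) :
    ∫ m, ∫ᵛ y, g y ∂<•m ∂(R x) = ∫ᵛ y, g y ∂<•M := by
  induction g using SimpleFunc.induction with
  | const c hs =>
    rename_i s
    have : ∀ m : SignedMeasure E, ∫ᵛ y, (SimpleFunc.piecewise s hs (SimpleFunc.const E c)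
        (SimpleFunc.const E 0)) y ∂<•m = m s • c := by
      intro m
      have h1 : ((SimpleFunc.piecewise s hs (SimpleFunc.const E c)
        (SimpleFunc.const E 0) : SimpleFunc E F) : E → F) = s.indicator fun _ => c := by
        ext y; simp [Set.indicator, Set.piecewise]
      rw [h1, VectorMeasure.integral_indicator_const _ hs]
      simp
    simp only [this]
    rw [integral_smul_const, hM s hs]
  | add hdisj hf hg =>
    rename_i f g
    have hadd : ∀ m : SignedMeasure E, ∫ᵛ y, (f + g) y ∂<•m
        = ∫ᵛ y, f y ∂<•m + ∫ᵛ y, g y ∂<•m := fun m =>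
      VectorMeasure.integral_fun_add (μ := m) (f := fun y => f y) (g := fun y => g y)
        (f.integrable_of_isFiniteMeasure (μ := m.variation))
        (g.integrable_of_isFiniteMeasure (μ := m.variation))
    have hint : ∀ f : SimpleFunc E F,
        Integrable (fun m : SignedMeasure E => ∫ᵛ y, f y ∂<•m) (R x) := fun f => by
      obtain ⟨c, hc⟩ := f.exists_forall_norm_le
      refine integrable_integral_signed_of_bounded hK f.measurable (c := |c|) (abs_nonneg c)
        fun y => (hc y).trans (le_abs_self c)
    simp only [hadd]
    rw [integral_add (hint f) (hint g), hf, hg]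

/-- Integrals of bounded functions against the mean measure are means of integrals. Since total
variations need not be measurable, dominated convergence is not available here and uniform
approximation by simple functions is used. -/
theorem integral_integral_signed_of_bounded
    (hK : ∫⁻ m, ∫⁻ y, ENNReal.ofReal (W y) ∂(m.variation) ∂(R x) ≤ ENNReal.ofReal (K * W x))
    (hK0 : 0 ≤ K) {M : SignedMeasure E} (hM : ∀ A, MeasurableSet A → M A = ∫ m, m A ∂(R x))
    {f : E → F} (hfm : Measurable f) {c : ℝ} (hc : 0 ≤ c) (hf : ∀ y, ‖f y‖ ≤ c) :
    ∫ m, ∫ᵛ y, f y ∂<•m ∂(R x) = ∫ᵛ y, f y ∂<•M := by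
  set L := M.variation.real Set.univ with hL
  have hWx := (W.pos x).le
  have hL0 : 0 ≤ L := measureReal_nonneg
  have hle : ∀ ε : ℝ, 0 < ε →
      ‖∫ m, ∫ᵛ y, f y ∂<•m ∂(R x) - ∫ᵛ y, f y ∂<•M‖ ≤ ε * (K * W x + L) := by
    intro ε hε
    obtain ⟨g, hg⟩ := exists_simpleFunc_norm_sub_le hfm hf hε
    have hfi : ∀ m : SignedMeasure E, m.Integrable f := fun m => integrable_signed_of_bounded m hfm hf
    have hgi : ∀ m : SignedMeasure E, m.Integrable g := fun m => g.integrable_of_isFiniteMeasure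
    have hsub : ∀ m : SignedMeasure E, ∫ᵛ y, (f y - g y) ∂<•m
        = ∫ᵛ y, f y ∂<•m - ∫ᵛ y, g y ∂<•m := fun m =>
      VectorMeasure.integral_fun_sub (hfi m) (hgi m)
    obtain ⟨c', hc'⟩ := g.exists_forall_norm_le
    have h1 : ‖∫ m, ∫ᵛ y, (f y - g y) ∂<•m ∂(R x)‖ ≤ ε * (K * W x) :=
      norm_integral_integral_signed_le hK hK0 hε.le (le_mul_weight_of_bounded hε.le hg)
    have h2 : ‖∫ᵛ y, (f y - g y) ∂<•M‖ ≤ ε * L := by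
      have h3 := enorm_integral_signed_le M (fun y => f y - g y)
      have h4 : ∫⁻ y, ‖f y - g y‖ₑ ∂M.variation ≤ ENNReal.ofReal (ε * L) := by
        calc ∫⁻ y, ‖f y - g y‖ₑ ∂M.variation ≤ ∫⁻ y, ENNReal.ofReal ε ∂M.variation :=
              lintegral_mono fun y => by
                rw [← ofReal_norm]; exact ENNReal.ofReal_le_ofReal (hg y)
          _ = ENNReal.ofReal (ε * L) := by
              rw [lintegral_const, ENNReal.ofReal_mul hε.le, hL, ofReal_measureReal]
      have h5 := h3.trans h4
      rw [← ofReal_norm] at h5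
      exact (ENNReal.ofReal_le_ofReal_iff (by positivity)).1 h5
    simp_rw [hsub] at h1
    rw [hsub] at h2
    rw [integral_sub (integrable_integral_signed_of_bounded hK hfm hc hf)
      (integrable_integral_signed_of_bounded hK g.measurable (abs_nonneg c')
        fun y => (hc' y).trans (le_abs_self c')), integral_integral_simpleFunc hK hM] at h1
    calc ‖∫ m, ∫ᵛ y, f y ∂<•m ∂(R x) - ∫ᵛ y, f y ∂<•M‖
        = ‖(∫ m, ∫ᵛ y, f y ∂<•m ∂(R x) - ∫ᵛ y, g y ∂<•M)
            - (∫ᵛ y, f y ∂<•M - ∫ᵛ y, g y ∂<•M)‖ := by congr 1; abel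
      _ ≤ ε * (K * W x) + ε * L := (norm_sub_le _ _).trans (add_le_add h1 h2)
      _ = ε * (K * W x + L) := by ring
  have h0 : ‖∫ m, ∫ᵛ y, f y ∂<•m ∂(R x) - ∫ᵛ y, f y ∂<•M‖ ≤ 0 := by
    have ht : Tendsto (fun ε : ℝ => ε * (K * W x + L)) (𝓝[>] 0) (𝓝 0) := by
      have : Tendsto (fun ε : ℝ => ε * (K * W x + L)) (𝓝 0) (𝓝 (0 * (K * W x + L))) :=
        (continuous_id.mul continuous_const).tendsto 0
      rw [zero_mul] at this
      exact this.mono_left nhdsWithin_le_nhds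
    refine ge_of_tendsto ht ?_
    filter_upwards [self_mem_nhdsWithin] with ε hε using hle ε hε
  exact sub_eq_zero.1 (norm_le_zero_iff.1 h0)

end ReplacementMoments

/-! ### Random signed measures: integrands of order `V` -/

section ReplacementTail

variable {E : Type u} [MeasurableSpace E] {F : Type*} [NormedAddCommGroup F] [NormedSpace ℝ F]
  {R : Kernel E (SignedMeasure E)} {W : Weight E} {q K : ℝ} {x : E}

/-- The part of `V = W ^ q` on `{W > W x}`. It vanishes at `x`, so that it only sees the positive
part of a signed measure that is positive off `x`. -/
noncomputable def weightTail (W : Weight E) (q : ℝ) (x : E) : E → ℝ :=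
  {y | W x < W y}.indicator fun y => W y ^ q

theorem measurable_rpow_weight (W : Weight E) (q : ℝ) : Measurable fun y => W y ^ q :=
  W.measurable'.pow_const q

theorem measurableSet_lt_weight (W : Weight E) (x : E) : MeasurableSet {y | W x < W y} :=
  measurableSet_lt measurable_const W.measurable'

theorem measurable_weightTail (W : Weight E) (q : ℝ) (x : E) : Measurable (weightTail W q x) :=
  (measurable_rpow_weight W q).indicator (measurableSet_lt_weight W x)

theorem rpow_weight_nonneg (W : Weight E) (q : ℝ) (y : E) : 0 ≤ W y ^ q :=
  Real.rpow_nonneg (W.pos y).le q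

theorem one_le_rpow_weight (W : Weight E) {q : ℝ} (hq : 0 ≤ q) (y : E) : 1 ≤ W y ^ q :=
  Real.one_le_rpow (W.one_le' y) hq

theorem weightTail_nonneg (W : Weight E) (q : ℝ) (x y : E) : 0 ≤ weightTail W q x y :=
  Set.indicator_nonneg (fun y _ => rpow_weight_nonneg W q y) y

theorem weightTail_le (W : Weight E) (q : ℝ) (x y : E) : weightTail W q x y ≤ W y ^ q :=
  Set.indicator_le_self' (fun y _ => rpow_weight_nonneg W q y) y

theorem truncation_add_weightTail (W : Weight E) (q : ℝ) (x y : E) :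
    truncation W (W x) (fun y => W y ^ q) y + weightTail W q x y = W y ^ q := by
  by_cases h : W y ≤ W x
  · simp [truncation, weightTail, h]
  · simp [truncation, weightTail, h, not_le.1 h]

theorem norm_rpow_weight_le (W : Weight E) (q : ℝ) (y : E) : ‖W y ^ q‖ ≤ 1 * W y ^ q := by
  rw [Real.norm_of_nonneg (rpow_weight_nonneg W q y), one_mul]

theorem norm_weightTail_le (W : Weight E) (q : ℝ) (x y : E) :
    ‖weightTail W q x y‖ ≤ 1 * W y ^ q := by
  rw [Real.norm_of_nonneg (weightTail_nonneg W q x y), one_mul]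
  exact weightTail_le W q x y

theorem truncation_weightTail_mono (W : Weight E) (q : ℝ) (x y : E) :
    Monotone fun k : ℕ => truncation W k (weightTail W q x) y := by
  intro k l hkl
  refine Set.indicator_le_indicator_of_subset (fun z (hz : W z ≤ k) => ?_)
    (weightTail_nonneg W q x) y
  exact hz.trans (by exact_mod_cast hkl)

theorem truncation_weightTail_nonneg (W : Weight E) (q c : ℝ) (x y : E) :
    0 ≤ truncation W c (weightTail W q x) y :=
  Set.indicator_nonneg (fun y _ => weightTail_nonneg W q x y) y

theorem truncation_weightTail_eq_zero (W : Weight E) (q c : ℝ) (x : E) {y : E}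
    (hy : y ∉ {y | W x < W y}) : truncation W c (weightTail W q x) y = 0 := by
  have : weightTail W q x y = 0 := Set.indicator_of_notMem hy _
  rw [truncation, Set.indicator_apply, this, ite_self]

theorem notMem_lt_weight (W : Weight E) (x : E) : x ∉ {y | W x < W y} := fun h : W x < W x => lt_irrefl _ h

theorem truncation_le_mul_weight {G : Type*} [NormedAddCommGroup G] (W : Weight E) {q : ℝ}
    (hq : 1 ≤ q) {c C : ℝ} (hC : 0 ≤ C) {f : E → G} (hf : ∀ y, ‖f y‖ ≤ C * W y ^ q) (y : E) :
    ‖truncation W c f y‖ ≤ C * |c| ^ (q - 1) * W y := by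
  have hWy := W.pos y
  by_cases h : W y ≤ c
  · rw [truncation, Set.indicator_of_mem (by exact h)]
    refine (hf y).trans ?_
    have h1 : W y ^ q = W y ^ (q - 1) * W y := by
      rw [Real.rpow_sub_one hWy.ne', div_mul_cancel₀ _ hWy.ne']
    have h2 : W y ^ (q - 1) ≤ |c| ^ (q - 1) :=
      Real.rpow_le_rpow hWy.le (h.trans (le_abs_self c)) (by linarith)
    rw [h1, mul_assoc]
    gcongr
  · rw [truncation, Set.indicator_of_notMem (by exact h), norm_zero]
    positivity

/-- The total variations of the tail of `V` under `R_x` coincide a.s. with a measurable function,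
whose mean is controlled by the mean measure. -/
theorem exists_tail_variation (hq : 1 ≤ q) (hpos : PositiveOffDiagonal R)
    (hK : ∫⁻ m, ∫⁻ y, ENNReal.ofReal (W y) ∂(m.variation) ∂(R x) ≤ ENNReal.ofReal (K * W x))
    (hK0 : 0 ≤ K) {M : SignedMeasure E} (hM : ∀ A, MeasurableSet A → M A = ∫ m, m A ∂(R x))
    (hMV : M.Integrable fun y => W y ^ q) :
    ∃ G : SignedMeasure E → ℝ≥0∞, Measurable G ∧
      ∫⁻ m, G m ∂(R x) ≤ ENNReal.ofReal (∫ᵛ y, weightTail W q x y ∂<•M) ∧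
      ∀ᵐ m ∂(R x), ∫⁻ y, ENNReal.ofReal (weightTail W q x y) ∂m.variation = G m := by
  have hq0 : 0 ≤ q := by linarith
  set h := weightTail W q x with hh
  have hhm : ∀ k : ℕ, Measurable (truncation W k h) := fun k =>
    measurable_truncation W k (measurable_weightTail W q x)
  have hhb : ∀ (k : ℕ) y, ‖truncation W k h y‖ ≤ 1 * |(k : ℝ)| ^ q := fun k =>
    norm_truncation_le_const hq0 k zero_le_one (norm_weightTail_le W q x)
  have hMpos : ∀ A, MeasurableSet A → x ∉ A → 0 ≤ M A := by
    intro A hA hx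
    rw [hM A hA]
    refine integral_nonneg_of_ae ?_
    filter_upwards [hpos x] with m hm using hm A hA hx
  have hA := measurableSet_lt_weight W x
  have hvar : ∀ m : SignedMeasure E, (∀ A, MeasurableSet A → x ∉ A → 0 ≤ m A) → ∀ k : ℕ,
      ENNReal.ofReal (∫ᵛ y, truncation W k h y ∂<•m)
        = ∫⁻ y, ENNReal.ofReal (truncation W k h y) ∂m.variation := by
    intro m hm k
    rw [integral_signed_of_positive_off hm hA (notMem_lt_weight W x)
      fun y hy => truncation_weightTail_eq_zero W q k x hy,
      ofReal_integral_eq_lintegral_ofReal (integrable_signed_of_bounded m (hhm k) (hhb k))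
        (Eventually.of_forall fun y => truncation_weightTail_nonneg W q k x y)]
  have hmeasb : ∀ k : ℕ, Measurable fun m : SignedMeasure E =>
      ENNReal.ofReal (∫ᵛ y, truncation W k h y ∂<•m) := fun k =>
    (measurable_integral_of_bounded (hhm k) (hhb k)).ennreal_ofReal
  refine ⟨fun m => ⨆ k : ℕ, ENNReal.ofReal (∫ᵛ y, truncation W k h y ∂<•m),
    Measurable.iSup hmeasb, ?_, ?_⟩
  · rw [lintegral_iSup' (fun k => (hmeasb k).aemeasurable)]
    · refine iSup_le fun k => ?_
      rw [← ofReal_integral_eq_lintegral_ofReal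
        (integrable_integral_signed_of_bounded hK (hhm k) (by positivity) (hhb k)),
        integral_integral_signed_of_bounded hK hK0 hM (hhm k) (by positivity) (hhb k)]
      · refine ENNReal.ofReal_le_ofReal ?_
        rw [integral_signed_of_positive_off hMpos hA (notMem_lt_weight W x)
          fun y hy => truncation_weightTail_eq_zero W q k x hy,
          integral_signed_of_positive_off (f := h) hMpos hA (notMem_lt_weight W x)
          fun y hy => Set.indicator_of_notMem hy _]
        refine integral_mono (integrable_signed_of_bounded M (hhm k) (hhb k))
          (integrable_signed_of_le hMV (measurable_weightTail W q x).aestronglyMeasurable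
            (norm_weightTail_le W q x)) fun y => ?_
        exact Set.indicator_le_self' (fun y _ => weightTail_nonneg W q x y) y
      · filter_upwards [hpos x] with m hm
        rw [Pi.zero_apply, integral_signed_of_positive_off hm hA (notMem_lt_weight W x)
          fun y hy => truncation_weightTail_eq_zero W q k x hy]
        exact integral_nonneg fun y => truncation_weightTail_nonneg W q k x y
    · filter_upwards [hpos x] with m hm k l hkl
      simp only [hvar m hm]
      exact lintegral_mono fun y => ENNReal.ofReal_le_ofReal (truncation_weightTail_mono W q x y hkl)
  · filter_upwards [hpos x] with m hm
    simp only [hvar m hm]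
    rw [← lintegral_iSup (fun k => (hhm k).ennreal_ofReal)
      fun k l hkl y => ENNReal.ofReal_le_ofReal (truncation_weightTail_mono W q x y hkl)]
    refine lintegral_congr fun y => ?_
    refine le_antisymm ?_ (iSup_le fun k => ENNReal.ofReal_le_ofReal
      (Set.indicator_le_self' (fun y _ => weightTail_nonneg W q x y) y))
    refine le_of_tendsto' (ENNReal.tendsto_ofReal (tendsto_truncation W h y)) fun k => ?_
    exact le_iSup (fun k : ℕ => ENNReal.ofReal (truncation W k h y)) k

theorem integrable_rpow_weight_of_tail (hq : 0 ≤ q) {m : SignedMeasure E}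
    (h : ∫⁻ y, ENNReal.ofReal (weightTail W q x y) ∂m.variation ≠ ∞) :
    m.Integrable fun y => W y ^ q := by
  have h1 : Integrable (weightTail W q x) m.variation := by
    refine ⟨(measurable_weightTail W q x).aestronglyMeasurable, lt_top_iff_ne_top.2 ?_⟩
    simpa [Real.enorm_eq_ofReal (weightTail_nonneg W q x _)] using h
  have h2 : Integrable (truncation W (W x) fun y => W y ^ q) m.variation :=
    integrable_signed_of_bounded m (measurable_truncation W _ (measurable_rpow_weight W q))
      (norm_truncation_le_const hq _ zero_le_one (norm_rpow_weight_le W q))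
  refine (h2.add h1).congr (Eventually.of_forall fun y => ?_)
  exact truncation_add_weightTail W q x y

theorem norm_integral_truncation_le {m : SignedMeasure E}
    (hm : ∀ A, MeasurableSet A → x ∉ A → 0 ≤ m A) (hq : 0 ≤ q)
    (hV : m.Integrable fun y => W y ^ q) [ProperSpace F] [MeasurableSpace F] [BorelSpace F]
    {f : E → F} (hfm : Measurable f) {c : ℝ} (hc : 0 ≤ c) (hf : ∀ y, ‖f y‖ ≤ c * W y ^ q)
    {k : ℝ} (hk : W x ≤ k) :
    ‖∫ᵛ y, truncation W k f y ∂<•m‖ ≤ ‖∫ᵛ y, truncation W (W x) f y ∂<•m‖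
      + c * (∫⁻ y, ENNReal.ofReal (weightTail W q x y) ∂m.variation).toReal := by
  have hi : ∀ k : ℝ, m.Integrable (truncation W k f) := fun k =>
    integrable_signed_of_bounded m (measurable_truncation W k hfm)
      (norm_truncation_le_const hq k hc hf)
  have htail : m.Integrable (weightTail W q x) :=
    integrable_signed_of_le hV (measurable_weightTail W q x).aestronglyMeasurable
      (norm_weightTail_le W q x)
  have hb : ∀ y, ‖truncation W k f y - truncation W (W x) f y‖ ≤ c * weightTail W q x y := by
    intro y
    by_cases h1 : W y ≤ W x
    · have h2 : W y ≤ k := h1.trans hk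
      have h3 : weightTail W q x y = 0 := Set.indicator_of_notMem (by simpa using h1) _
      simp [truncation, h1, h2, h3]
    · have h3 : weightTail W q x y = W y ^ q := Set.indicator_of_mem (by simpa using h1) _
      have h4 : truncation W (W x) f y = 0 := Set.indicator_of_notMem (by exact h1) _
      rw [h3, h4, sub_zero]
      exact (norm_truncation_le W k f y).trans (hf y)
  have h0 : ∀ y, y ∉ {y | W x < W y} → truncation W k f y - truncation W (W x) f y = 0 := by
    intro y hy
    have h3 : weightTail W q x y = 0 := Set.indicator_of_notMem hy _
    have := hb y
    rw [h3, mul_zero] at this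
    exact norm_le_zero_iff.1 this
  have h1 : ∫ᵛ y, truncation W k f y ∂<•m = ∫ᵛ y, truncation W (W x) f y ∂<•m
      + ∫ y, (truncation W k f y - truncation W (W x) f y) ∂m.variation := by
    rw [← integral_signed_of_positive_off hm (measurableSet_lt_weight W x) (notMem_lt_weight W x) h0,
      VectorMeasure.integral_fun_sub (hi k) (hi (W x))]
    abel
  rw [h1]
  refine (norm_add_le _ _).trans (add_le_add le_rfl ?_)
  refine (norm_integral_le_of_norm_le (htail.const_mul c) (Eventually.of_forall hb)).trans
    (le_of_eq ?_)
  rw [integral_const_mul, integral_eq_lintegral_of_nonneg_ae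
    (Eventually.of_forall (weightTail_nonneg W q x))
    (measurable_weightTail W q x).aestronglyMeasurable]

theorem ae_integrable_rpow_weight (hq : 1 ≤ q) (hpos : PositiveOffDiagonal R)
    (hK : ∫⁻ m, ∫⁻ y, ENNReal.ofReal (W y) ∂(m.variation) ∂(R x) ≤ ENNReal.ofReal (K * W x))
    (hK0 : 0 ≤ K) {M : SignedMeasure E} (hM : ∀ A, MeasurableSet A → M A = ∫ m, m A ∂(R x))
    (hMV : M.Integrable fun y => W y ^ q) :
    ∀ᵐ m ∂(R x), m.Integrable fun y => W y ^ q := by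
  obtain ⟨G, hGm, hG, hGv⟩ := exists_tail_variation hq hpos hK hK0 hM hMV
  filter_upwards [hGv, ae_lt_top hGm (hG.trans_lt ENNReal.ofReal_lt_top).ne] with m h1 h2
  exact integrable_rpow_weight_of_tail (by linarith) (h1 ▸ h2.ne)

/-- Integrals against the mean measure are means of integrals, for functions dominated by `V`. -/
theorem integral_limIntegral_eq [ProperSpace F] [MeasurableSpace F] [BorelSpace F]
    (hq : 1 ≤ q) (hpos : PositiveOffDiagonal R)
    (hK : ∫⁻ m, ∫⁻ y, ENNReal.ofReal (W y) ∂(m.variation) ∂(R x) ≤ ENNReal.ofReal (K * W x))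
    (hK0 : 0 ≤ K) {M : SignedMeasure E} (hM : ∀ A, MeasurableSet A → M A = ∫ m, m A ∂(R x))
    (hMV : M.Integrable fun y => W y ^ q) {f : E → F} (hfm : Measurable f) {c : ℝ} (hc : 0 ≤ c)
    (hf : ∀ y, ‖f y‖ ≤ c * W y ^ q) :
    Integrable (limIntegral W f) (R x) ∧ ∫ m, limIntegral W f m ∂(R x) = ∫ᵛ y, f y ∂<•M := by
  have hq0 : 0 ≤ q := by linarith
  obtain ⟨G, hGm, hG, hGv⟩ := exists_tail_variation hq hpos hK hK0 hM hMV
  have hGi : Integrable (fun m => (G m).toReal) (R x) :=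
    integrable_toReal_of_lintegral_ne_top hGm.aemeasurable (hG.trans_lt ENNReal.ofReal_lt_top).ne
  have hm : ∀ k : ℝ, Measurable (truncation W k f) := fun k => measurable_truncation W k hfm
  have hb : ∀ k : ℝ, ∀ y, ‖truncation W k f y‖ ≤ c * |k| ^ q := fun k =>
    norm_truncation_le_const hq0 k hc hf
  have hi : ∀ k : ℝ, Integrable (fun m : SignedMeasure E => ∫ᵛ y, truncation W k f y ∂<•m) (R x) :=
    fun k => integrable_integral_signed_of_bounded hK (hm k) (by positivity) (hb k)
  set bound : SignedMeasure E → ℝ := fun m =>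
    ‖∫ᵛ y, truncation W (W x) f y ∂<•m‖ + c * (G m).toReal with hbound
  have hboundi : Integrable bound (R x) := (hi (W x)).norm.add (hGi.const_mul c)
  have hV := ae_integrable_rpow_weight hq hpos hK hK0 hM hMV
  have hle : ∀ k : ℕ, W x ≤ k →
      ∀ᵐ m ∂(R x), ‖∫ᵛ y, truncation W k f y ∂<•m‖ ≤ bound m := by
    intro k hk
    filter_upwards [hpos x, hGv, hV] with m h1 h2 h3
    have := norm_integral_truncation_le h1 hq0 h3 hfm hc hf hk
    rwa [h2] at this
  have hlim : ∀ᵐ m ∂(R x), Tendsto (fun k : ℕ => ∫ᵛ y, truncation W k f y ∂<•m) atTop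
      (𝓝 (limIntegral W f m)) := by
    filter_upwards [hV] with m h1
    have h2 := integrable_signed_of_le h1 hfm.aestronglyMeasurable hf
    rw [limIntegral_eq W hfm h2]
    exact tendsto_integral_truncation W hfm h2
  have hev : ∀ᶠ k : ℕ in atTop, W x ≤ k := by
    filter_upwards [eventually_ge_atTop (Nat.ceil (W x))] with k hk
    exact (Nat.le_ceil (W x)).trans (Nat.cast_le.2 hk)
  have hsm := stronglyMeasurable_limIntegral hq0 hfm hc hf
  refine ⟨hboundi.mono' hsm.aestronglyMeasurable ?_, ?_⟩
  · obtain ⟨k₀, hk₀⟩ := eventually_atTop.1 hev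
    have hall : ∀ᵐ m ∂(R x), ∀ k : ℕ, k₀ ≤ k → ‖∫ᵛ y, truncation W k f y ∂<•m‖ ≤ bound m :=
      ae_all_iff.2 fun k => by
        by_cases hk : k₀ ≤ k
        · filter_upwards [hle k (hk₀ k hk)] with m h _ using h
        · exact Eventually.of_forall fun m h => absurd h hk
    filter_upwards [hall, hlim] with m h1 h2
    refine le_of_tendsto h2.norm ?_
    filter_upwards [eventually_ge_atTop k₀] with k hk using h1 k hk
  · have h1 := tendsto_integral_filter_of_dominated_convergence (μ := R x) (l := atTop)
      (F := fun (k : ℕ) (m : SignedMeasure E) => ∫ᵛ y, truncation W k f y ∂<•m) bound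
      (Eventually.of_forall fun k => (hi k).1) (hev.mono fun k hk => hle k hk) hboundi hlim
    have h2 : ∀ k : ℕ, ∫ m, ∫ᵛ y, truncation W k f y ∂<•m ∂(R x) = ∫ᵛ y, truncation W k f y ∂<•M :=
      fun k => integral_integral_signed_of_bounded hK hK0 hM (hm k) (by positivity) (hb k)
    simp_rw [h2] at h1
    exact tendsto_nhds_unique h1 (tendsto_integral_truncation W hfm
      (integrable_signed_of_le hMV hfm.aestronglyMeasurable hf))

/-- First absolute moment of the `V`-mass of the replacements. -/
theorem lintegral_enorm_limIntegral_weight_le (hq : 1 ≤ q) (hpos : PositiveOffDiagonal R)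
    (hK : ∫⁻ m, ∫⁻ y, ENNReal.ofReal (W y) ∂(m.variation) ∂(R x) ≤ ENNReal.ofReal (K * W x))
    (hK0 : 0 ≤ K) {M : SignedMeasure E} (hM : ∀ A, MeasurableSet A → M A = ∫ m, m A ∂(R x))
    (hMV : M.Integrable fun y => W y ^ q) {L : ℝ} (hL0 : 0 ≤ L)
    (hL : ∫ᵛ y, W y ^ q ∂<•M ≤ L * W x ^ q) :
    ∫⁻ m, ‖limIntegral W (fun y => W y ^ q) m‖ₑ ∂(R x)
      ≤ ENNReal.ofReal ((L + 2 * K) * W x ^ q) := by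
  have hq0 : 0 ≤ q := by linarith
  have hWx := W.pos x
  obtain ⟨G, hGm, hG, hGv⟩ := exists_tail_variation hq hpos hK hK0 hM hMV
  have hVm := measurable_rpow_weight W q
  set t := truncation W (W x) (fun y => W y ^ q) with ht
  have htm : Measurable t := measurable_truncation W _ hVm
  have htb : ∀ y, ‖t y‖ ≤ 1 * |W x| ^ q :=
    norm_truncation_le_const hq0 _ zero_le_one (norm_rpow_weight_le W q)
  have htb' : ∀ y, ‖t y‖ ≤ W x ^ (q - 1) * W y := fun y => by
    have := truncation_le_mul_weight W hq (c := W x) zero_le_one (norm_rpow_weight_le W q) y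
    rwa [one_mul, abs_of_pos hWx] at this
  have hprod : W x ^ (q - 1) * (K * W x) = K * W x ^ q := by
    rw [Real.rpow_sub_one hWx.ne']
    field_simp
  have hsplit : ∀ m : SignedMeasure E, m.Integrable (fun y => W y ^ q) →
      ∫ᵛ y, W y ^ q ∂<•m = ∫ᵛ y, t y ∂<•m + ∫ᵛ y, weightTail W q x y ∂<•m := by
    intro m hm
    rw [← VectorMeasure.integral_fun_add (integrable_signed_of_bounded m htm htb)
      (integrable_signed_of_le hm (measurable_weightTail W q x).aestronglyMeasurable
        (norm_weightTail_le W q x))]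
    refine congrArg (fun g : E → ℝ => ∫ᵛ y, g y ∂<•m) (funext fun y => ?_)
    exact (truncation_add_weightTail W q x y).symm
  have hMt : -(K * W x ^ q) ≤ ∫ᵛ y, t y ∂<•M := by
    have h1 := norm_integral_integral_signed_le hK hK0 (by positivity) htb'
    rw [integral_integral_signed_of_bounded hK hK0 hM htm (by positivity) htb, hprod] at h1
    exact (abs_le.1 h1).1
  have hMtail : ∫ᵛ y, weightTail W q x y ∂<•M ≤ (L + K) * W x ^ q := by
    have := hsplit M hMV
    linarith
  have hV := ae_integrable_rpow_weight hq hpos hK hK0 hM hMV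
  calc ∫⁻ m, ‖limIntegral W (fun y => W y ^ q) m‖ₑ ∂(R x)
      ≤ ∫⁻ m, (‖∫ᵛ y, t y ∂<•m‖ₑ + G m) ∂(R x) := by
        refine lintegral_mono_ae ?_
        filter_upwards [hpos x, hGv, hV] with m h1 h2 h3
        rw [limIntegral_eq W hVm h3, hsplit m h3, ← h2]
        refine (enorm_add_le _ _).trans (add_le_add le_rfl ?_)
        refine (enorm_integral_signed_le m _).trans (le_of_eq (lintegral_congr fun y => ?_))
        exact Real.enorm_eq_ofReal (weightTail_nonneg W q x y)
    _ = ∫⁻ m, ‖∫ᵛ y, t y ∂<•m‖ₑ ∂(R x) + ∫⁻ m, G m ∂(R x) :=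
        lintegral_add_right _ hGm
    _ ≤ ENNReal.ofReal (K * W x ^ q) + ENNReal.ofReal ((L + K) * W x ^ q) := by
        refine add_le_add ?_ (hG.trans (ENNReal.ofReal_le_ofReal hMtail))
        rw [← hprod]
        exact lintegral_enorm_integral_signed_le hK (by positivity) htb'
    _ = ENNReal.ofReal ((L + 2 * K) * W x ^ q) := by
        have := rpow_weight_nonneg W q x
        rw [← ENNReal.ofReal_add (by positivity) (by positivity)]
        congr 1
        ring

/-- Second moments of the replacements, for functions in `B(W)`. -/
theorem lintegral_enorm_limIntegral_sq_le [ProperSpace F] [MeasurableSpace F] [BorelSpace F]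
    (hq : 1 ≤ q) (hV : ∀ᵐ m ∂(R x), m.Integrable fun y => W y ^ q) {C : ℝ}
    (h : ∫⁻ m, (∫⁻ y, ENNReal.ofReal (W y) ∂m.variation) ^ (2 : ℝ) ∂(R x)
      ≤ ENNReal.ofReal (C * W x ^ q))
    {f : E → F} (hfm : Measurable f) {c : ℝ} (hc : 0 ≤ c) (hf : ∀ y, ‖f y‖ ≤ c * W y) :
    ∫⁻ m, ‖limIntegral W f m‖ₑ ^ (2 : ℝ) ∂(R x) ≤ ENNReal.ofReal (c ^ 2 * (C * W x ^ q)) := by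
  have hf' : ∀ y, ‖f y‖ ≤ c * W y ^ q := fun y => (hf y).trans (by
    gcongr
    exact Real.self_le_rpow_of_one_le (W.one_le' y) hq)
  calc ∫⁻ m, ‖limIntegral W f m‖ₑ ^ (2 : ℝ) ∂(R x)
      ≤ ∫⁻ m, ENNReal.ofReal (c ^ 2) *
          (∫⁻ y, ENNReal.ofReal (W y) ∂m.variation) ^ (2 : ℝ) ∂(R x) := by
        refine lintegral_mono_ae ?_
        filter_upwards [hV] with m hm
        rw [limIntegral_eq W hfm (integrable_signed_of_le hm hfm.aestronglyMeasurable hf'),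
          ENNReal.ofReal_pow hc, ← ENNReal.rpow_natCast, Nat.cast_ofNat,
          ← ENNReal.mul_rpow_of_nonneg _ _ (by norm_num)]
        exact ENNReal.rpow_le_rpow (enorm_integral_signed_le_of_le_weight m hc hf) (by norm_num)
    _ = ENNReal.ofReal (c ^ 2) *
          ∫⁻ m, (∫⁻ y, ENNReal.ofReal (W y) ∂m.variation) ^ (2 : ℝ) ∂(R x) :=
        lintegral_const_mul' _ _ ENNReal.ofReal_ne_top
    _ ≤ ENNReal.ofReal (c ^ 2) * ENNReal.ofReal (C * W x ^ q) := by gcongr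
    _ = _ := (ENNReal.ofReal_mul (sq_nonneg c)).symm

end ReplacementTail

/-! ### Consequences of the hypotheses on the replacements, and conditional laws -/

section ReplacementBounds

variable {E : Type u} [MeasurableSpace E]

/-- The consequences of the hypotheses on the replacement kernel that enter the analysis of the
process, in terms of measurable functionals of the replacements. With `V = W ^ q`: `ϑ` and `C₁` are
the drift constants, `C₂` bounds the second moments of `R_x f` for `f` in `B(W)`, and `L` the mean of
`|R_x V|`. -/
structure HasReplacementBounds (R : Kernel E (SignedMeasure E)) (W : Weight E)
    (q ϑ C₁ C₂ L : ℝ) : Prop where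
  two_le : 2 ≤ q
  theta_pos : 0 < ϑ
  theta_lt_one : ϑ < 1
  nonneg_second : 0 ≤ C₂
  nonneg_first : 0 ≤ L
  balanced : IsBalanced R
  ae_integrable : ∀ x, ∀ᵐ m ∂(R x), m.Integrable fun y => W y ^ q
  first_moment : ∀ x, ∫⁻ m, ‖limIntegral W (fun y => W y ^ q) m‖ₑ ∂(R x)
    ≤ ENNReal.ofReal (L * W x ^ q)
  drift : ∀ x, ∫ m, limIntegral W (fun y => W y ^ q) m ∂(R x) ≤ ϑ * W x ^ q + C₁
  second_moment : ∀ x (f : BW W), ∫⁻ m, ‖limIntegral W f m‖ₑ ^ (2 : ℝ) ∂(R x)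
    ≤ ENNReal.ofReal (‖f‖ ^ 2 * (C₂ * W x ^ q))
  mean : ∀ x (f : BW W), ∫ m, limIntegral W f m ∂(R x) = meanOperator R W f x

theorem BW.norm_apply_le_rpow {W : Weight E} {q : ℝ} (hq : 1 ≤ q) (f : BW W) (y : E) :
    ‖f y‖ ≤ ‖f‖ * W y ^ q :=
  (f.le_norm y).trans (mul_le_mul_of_nonneg_left
    (Real.self_le_rpow_of_one_le (W.one_le' y) hq) (norm_nonneg f))

theorem exists_hasReplacementBounds {R : Kernel E (SignedMeasure E)} [IsMarkovKernel R]
    {W : Weight E} {q : ℝ} (hq : 2 < q) (hpos : PositiveOffDiagonal R) (hB : IsBalanced R)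
    (hHi : LyapunovDrift R W q) (hHii : MomentBound R W q) :
    ∃ ϑ C₁ C₂ L : ℝ, HasReplacementBounds R W q ϑ C₁ C₂ L := by
  have hq1 : 1 ≤ q := by linarith
  obtain ⟨ϑ, C₁, hϑ0, hϑ1, hC₁, hdrift⟩ := hHi
  obtain ⟨K, hK0, hK⟩ := lintegral_lintegral_variation_le hq1 hHii
  obtain ⟨C, hC, hCb⟩ := id hHii
  have hM : ∀ x A, MeasurableSet A → meanKernel R x A = ∫ m, m A ∂(R x) := fun x A hA =>
    meanKernel_apply hq1 hHii x hA
  have hV : ∀ x, ∀ᵐ m ∂(R x), m.Integrable fun y => W y ^ q := fun x =>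
    ae_integrable_rpow_weight hq1 hpos (hK x) hK0 (hM x) (hdrift x).1
  refine ⟨ϑ, C₁, 1 + C, (ϑ + C₁) + 2 * K, hq.le, hϑ0, hϑ1, by linarith, by positivity, hB, hV,
    fun x => ?_, fun x => ?_, fun x f => ?_, fun x f => ?_⟩
  · refine lintegral_enorm_limIntegral_weight_le hq1 hpos (hK x) hK0 (hM x) (hdrift x).1
      (by positivity) ((hdrift x).2.trans ?_)
    have := one_le_rpow_weight W (by linarith : (0 : ℝ) ≤ q) x
    nlinarith
  · rw [(integral_limIntegral_eq hq1 hpos (hK x) hK0 (hM x) (hdrift x).1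
      (measurable_rpow_weight W q) zero_le_one (norm_rpow_weight_le W q)).2]
    exact (hdrift x).2
  · exact lintegral_enorm_limIntegral_sq_le hq1 (hV x)
      (lintegral_sq_le_of_momentBound hq.le hC (hCb x)) f.measurable (norm_nonneg f) f.le_norm
  · rw [(integral_limIntegral_eq hq1 hpos (hK x) hK0 (hM x) (hdrift x).1
      f.measurable (norm_nonneg f) (f.norm_apply_le_rpow hq1)).2, meanOperator_apply hq1 hHii]

end ReplacementBounds

section ConditionalLaw

/-- A regular version `κ` of the conditional law of `Z` given `m` disintegrates the law of `Z` on
every event of `m`. The kernel need only be measurable for the ambient `σ`-field. -/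
theorem map_restrict_eq_bind_of_condExp {Ω S : Type*} [MeasurableSpace S]
    {m mΩ : MeasurableSpace Ω} {P : Measure Ω} [IsProbabilityMeasure P]
    (hm : m ≤ mΩ) {Z : Ω → S} (hZ : Measurable Z) {κ : Kernel Ω S} [IsFiniteKernel κ]
    (hκ : ∀ B, MeasurableSet B →
      P[(Z ⁻¹' B).indicator (fun _ => (1 : ℝ)) | m] =ᵐ[P] fun ω => (κ ω).real B)
    {H : Set Ω} (hH : MeasurableSet[m] H) : (P.restrict H).map Z = (P.restrict H).bind κ := by
  ext B hB
  have hind : Integrable ((Z ⁻¹' B).indicator (fun _ => (1 : ℝ))) P :=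
    (integrable_const 1).indicator (hZ hB)
  have h1 := setIntegral_condExp hm hind hH
  rw [setIntegral_congr_ae (g := fun ω => (κ ω).real B) (hm H hH)
    ((hκ B hB).mono fun ω h _ => h)] at h1
  have hκB : Measurable fun ω => (κ ω) B := κ.measurable_coe hB
  have h2 : ∫ ω in H, (Z ⁻¹' B).indicator (fun _ => (1 : ℝ)) ω ∂P = (P.restrict H).real (Z ⁻¹' B) :=
    integral_indicator_one (hZ hB)
  rw [h2] at h1
  rw [Measure.map_apply hZ hB, Measure.bind_apply hB κ.aemeasurable,
    ← ofReal_measureReal (μ := P.restrict H) (s := Z ⁻¹' B), ← h1,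
    ofReal_integral_eq_lintegral_ofReal]
  · exact lintegral_congr fun ω => ofReal_measureReal
  · refine Integrable.mono' (integrable_const (κ.bound).toReal)
      hκB.ennreal_toReal.aestronglyMeasurable (Eventually.of_forall fun ω => ?_)
    rw [Real.norm_of_nonneg measureReal_nonneg]
    exact ENNReal.toReal_mono (Kernel.bound_ne_top κ) (Kernel.measure_le_bound κ ω B)
  · exact Eventually.of_forall fun ω => measureReal_nonneg

variable {Ω : Type*} {mΩ : MeasurableSpace Ω} {S : Type*} [MeasurableSpace S]

theorem lintegral_comp_of_map_eq_bind {μ : Measure Ω} {Z : Ω → S} (hZ : Measurable Z)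
    {κ : Kernel Ω S} (h : μ.map Z = μ.bind κ) {ψ : S → ℝ≥0∞} (hψ : Measurable ψ) :
    ∫⁻ ω, ψ (Z ω) ∂μ = ∫⁻ ω, ∫⁻ z, ψ z ∂(κ ω) ∂μ := by
  rw [← lintegral_map hψ hZ, h, Measure.lintegral_bind κ.aemeasurable hψ.aemeasurable]

theorem integrable_comp_of_map_eq_bind {F : Type*} [NormedAddCommGroup F] {μ : Measure Ω} {Z : Ω → S} (hZ : Measurable Z)
    {κ : Kernel Ω S} (h : μ.map Z = μ.bind κ) {ψ : S → F} (hψ : StronglyMeasurable ψ)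
    (hfin : ∫⁻ ω, ∫⁻ z, ‖ψ z‖ₑ ∂(κ ω) ∂μ < ∞) : Integrable (fun ω => ψ (Z ω)) μ := by
  refine ⟨(hψ.comp_measurable hZ).aestronglyMeasurable, ?_⟩
  rw [HasFiniteIntegral, lintegral_comp_of_map_eq_bind hZ h hψ.enorm]
  exact hfin

variable {F : Type*} [NormedAddCommGroup F] [NormedSpace ℝ F]

theorem integral_comp_of_map_eq_bind {μ : Measure Ω} {Z : Ω → S} (hZ : Measurable Z)
    {κ : Kernel Ω S} (h : μ.map Z = μ.bind κ) {ψ : S → F} (hψ : StronglyMeasurable ψ)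
    (hfin : ∫⁻ ω, ∫⁻ z, ‖ψ z‖ₑ ∂(κ ω) ∂μ < ∞) :
    ∫ ω, ψ (Z ω) ∂μ = ∫ ω, ∫ z, ψ z ∂(κ ω) ∂μ := by
  have h1 : Integrable ψ (μ.bind κ) := by
    rw [← h, integrable_map_measure hψ.aestronglyMeasurable hZ.aemeasurable]
    exact integrable_comp_of_map_eq_bind hZ h hψ hfin
  rw [← integral_map hZ.aemeasurable hψ.aestronglyMeasurable, h]
  rw [Measure.comp_eq_comp_const_apply] at h1 ⊢
  rw [Kernel.integral_comp h1]
  simp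

end ConditionalLaw

/-! ### The compositions and the filtration -/

section Compositions

variable {E : Type u} [MeasurableSpace E]

theorem measurable_signed_of_eval {Ω : Type*} {m : MeasurableSpace Ω} {Z : Ω → SignedMeasure E}
    (h : ∀ A, MeasurableSet A → Measurable fun ω => Z ω A) : Measurable Z := by
  rw [measurable_iff_comap_le]
  simp only [instMeasurableSpaceSignedMeasure, MeasurableSpace.comap_iSup, iSup_le_iff,
    MeasurableSpace.comap_comp]
  exact fun A hA => (h A hA).comap_le

/-- Signed measures whose integrals of the truncations of `W ^ q` are bounded above. Unlike the
integrability of `W ^ q`, this is a measurable condition. -/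
def boundedTruncations (W : Weight E) (q : ℝ) : Set (SignedMeasure E) :=
  {m | ⨆ k : ℕ, ENNReal.ofReal (∫ᵛ y, truncation W k (fun y => W y ^ q) y ∂<•m) < ∞}

theorem norm_truncation_weight_le {W : Weight E} {q : ℝ} (hq : 0 ≤ q) (k : ℕ) (y : E) :
    ‖truncation W k (fun y => W y ^ q) y‖ ≤ 1 * |(k : ℝ)| ^ q :=
  norm_truncation_le_const hq k zero_le_one (norm_rpow_weight_le W q) y

theorem measurableSet_boundedTruncations {W : Weight E} {q : ℝ} (hq : 0 ≤ q) :
    MeasurableSet (boundedTruncations W q) :=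
  measurableSet_lt (Measurable.iSup fun k => ENNReal.measurable_ofReal.comp
    (measurable_integral_of_bounded (measurable_truncation W k (measurable_rpow_weight W q))
      (norm_truncation_weight_le hq k))) measurable_const

theorem mem_boundedTruncations {W : Weight E} {q : ℝ} {m : SignedMeasure E}
    (hm : m.Integrable fun y => W y ^ q) : m ∈ boundedTruncations W q := by
  refine lt_of_le_of_lt (iSup_le fun k => ?_) hm.2
  refine (Real.ofReal_le_enorm _).trans ((enorm_integral_signed_le m _).trans ?_)
  exact lintegral_mono fun y => enorm_le_iff_norm_le.2 (norm_truncation_le W k _ y)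

/-- For the positive signed measure `m + m'`, a bound on the integrals of the truncations of `W ^ q`
amounts to integrability, by Fatou's lemma. -/
theorem integrable_add_of_boundedTruncations {W : Weight E} {q : ℝ} (hq : 0 ≤ q)
    {m m' : SignedMeasure E} (hm : m.Integrable fun y => W y ^ q)
    (hm' : m' ∈ boundedTruncations W q) (hpos : ∀ A, MeasurableSet A → 0 ≤ (m + m') A) :
    (m + m').Integrable fun y => W y ^ q := by
  have hmeas := fun k : ℕ => measurable_truncation W k (measurable_rpow_weight W q)
  refine ⟨(measurable_rpow_weight W q).aestronglyMeasurable, ?_⟩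
  have h1 : ∀ y, liminf (fun k : ℕ => ‖truncation W k (fun y => W y ^ q) y‖ₑ) atTop
      = ‖W y ^ q‖ₑ := fun y => (tendsto_truncation W _ y).enorm.liminf_eq
  have h2 := lintegral_liminf_le (μ := (m + m').variation) (u := atTop)
    (fun k => (hmeas k).enorm)
  simp only [h1] at h2
  refine lt_of_le_of_lt h2 ?_
  have hb : ∀ k : ℕ, ∫⁻ y, ‖truncation W k (fun y => W y ^ q) y‖ₑ ∂(m + m').variation ≤
      (∫⁻ y, ‖W y ^ q‖ₑ ∂m.variation) +
        ⨆ k : ℕ, ENNReal.ofReal (∫ᵛ y, truncation W k (fun y => W y ^ q) y ∂<•m') := by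
    intro k
    have hnn : ∀ y, 0 ≤ truncation W k (fun y => W y ^ q) y := fun y =>
      Set.indicator_nonneg (fun y _ => rpow_weight_nonneg W q y) y
    have hint := fun m : SignedMeasure E => integrable_signed_of_bounded m (hmeas k)
      (norm_truncation_weight_le hq k)
    have h3 := integral_signed_of_nonneg hpos (truncation W k fun y => W y ^ q)
    have h4 : ∫⁻ y, ‖truncation W k (fun y => W y ^ q) y‖ₑ ∂(m + m').variation =
        ENNReal.ofReal (∫ y, truncation W k (fun y => W y ^ q) y ∂(m + m').variation) := by
      rw [ofReal_integral_eq_lintegral_ofReal (hint _) (Eventually.of_forall hnn)]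
      exact lintegral_congr fun y => Real.enorm_eq_ofReal (hnn y)
    rw [h4, ← h3, VectorMeasure.integral_add_vectorMeasure (hint m) (hint m')]
    refine ENNReal.ofReal_add_le.trans (add_le_add ?_ (le_iSup (fun k : ℕ => ENNReal.ofReal
      (∫ᵛ y, truncation W k (fun y => W y ^ q) y ∂<•m')) k))
    refine (Real.ofReal_le_enorm _).trans ((enorm_integral_signed_le m _).trans ?_)
    exact lintegral_mono fun y => enorm_le_iff_norm_le.2 (norm_truncation_le W k _ y)
  exact lt_of_le_of_lt ((liminf_le_liminf (Eventually.of_forall hb)).trans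
    (liminf_const _).le) (ENNReal.add_lt_top.2 ⟨hm.2, hm'⟩)

variable {Ω : Type v}

theorem composition_succ (m₀ : Measure E) [IsFiniteMeasure m₀] (ρ : ℕ → Ω → SignedMeasure E)
    (n : ℕ) (ω : Ω) : composition m₀ ρ (n + 1) ω = composition m₀ ρ n ω + ρ n ω := by
  simp [composition, Finset.sum_range_succ, add_assoc]

theorem measurable_replacement_history (Y : ℕ → Ω → E) (ρ : ℕ → Ω → SignedMeasure E) {i n : ℕ}
    (hi : i < n) : Measurable[history Y ρ n] (ρ i) :=
  Measurable.of_comap_le (le_sup_right.trans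
    (le_iSup₂ (f := fun i (_ : i < n) => MeasurableSpace.comap (Y i) inferInstance ⊔
      MeasurableSpace.comap (ρ i) inferInstance) i hi))

theorem measurable_composition_history (m₀ : Measure E) [IsFiniteMeasure m₀] (Y : ℕ → Ω → E)
    (ρ : ℕ → Ω → SignedMeasure E) (n : ℕ) : Measurable[history Y ρ n] (composition m₀ ρ n) := by
  refine measurable_signed_of_eval fun A hA => ?_
  have h1 : (fun ω => composition m₀ ρ n ω A) =
      fun ω => m₀.toSignedMeasure A + ∑ i ∈ Finset.range n, ρ i ω A := by
    funext ω
    rw [composition, add_apply]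
    congr 1
    exact map_sum ({ toFun := fun m => m A, map_zero' := rfl, map_add' := fun _ _ => rfl } :
      SignedMeasure E →+ ℝ) _ _
  rw [h1]
  refine measurable_const.add (Finset.measurable_sum _ fun i hi => ?_)
  exact (measurable_eval hA).comp (measurable_replacement_history Y ρ (Finset.mem_range.1 hi))

variable [mΩ : MeasurableSpace Ω] {R : Kernel E (SignedMeasure E)} {m₀ : Measure E}
  [IsFiniteMeasure m₀] {P : Measure Ω} {Y : ℕ → Ω → E} {ρ : ℕ → Ω → SignedMeasure E}

theorem IsMVPP.history_le (h : IsMVPP R m₀ P Y ρ) (n : ℕ) : history Y ρ n ≤ mΩ :=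
  iSup₂_le fun i _ => sup_le (h.measurable_draw i).comap_le (h.measurable_replacement i).comap_le

/-- The filtration generated by the draws and the replacements. -/
def IsMVPP.filtration (h : IsMVPP R m₀ P Y ρ) : Filtration ℕ mΩ where
  seq := history Y ρ
  mono' := fun _ _ hij => biSup_mono fun _ hk => hk.trans_le hij
  le' := h.history_le

variable [IsMarkovKernel R] [IsProbabilityMeasure P]

theorem IsMVPP.map_replacement (h : IsMVPP R m₀ P Y ρ) (n : ℕ) {H : Set Ω}
    (hH : MeasurableSet[history Y ρ n] H) :
    (P.restrict H).map (ρ n) = (P.restrict H).bind (R.comap (Y n) (h.measurable_draw n)) := by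
  refine map_restrict_eq_bind_of_condExp
    (sup_le (h.history_le n) (h.measurable_draw n).comap_le) (h.measurable_replacement n)
    (fun B hB => ?_) (le_sup_left (b := MeasurableSpace.comap (Y n) inferInstance) H hH)
  simpa using h.law_replacement n B hB

theorem IsMVPP.ae_replacement_mem (h : IsMVPP R m₀ P Y ρ) (n : ℕ) {B : Set (SignedMeasure E)}
    (hB : MeasurableSet B) (hR : ∀ x, ∀ᵐ m ∂(R x), m ∈ B) : ∀ᵐ ω ∂P, ρ n ω ∈ B := by
  have h1 := h.map_replacement n (H := Set.univ) MeasurableSet.univ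
  rw [Measure.restrict_univ] at h1
  have h2 : (P.map (ρ n)) Bᶜ = 0 := by
    rw [h1, Measure.bind_apply hB.compl (Kernel.aemeasurable _)]
    exact lintegral_eq_zero_of_ae_eq_zero (Eventually.of_forall fun ω => hR (Y n ω))
  rwa [Measure.map_apply (h.measurable_replacement n) hB.compl] at h2

end Compositions

/-! ### Regularity of trajectories -/

section Tame

variable {E : Type u} [MeasurableSpace E] {Ω : Type v}

/-- The regularity of a trajectory of the process that holds almost surely: the compositions are
positive with total mass `m₀(E) + n`, and all integrals of `W ^ q` converge. -/
structure IsTame (W : Weight E) (q : ℝ) (m₀ : Measure E) [IsFiniteMeasure m₀]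
    (ρ : ℕ → Ω → SignedMeasure E) (ω : Ω) : Prop where
  nonneg : ∀ n A, MeasurableSet A → 0 ≤ composition m₀ ρ n ω A
  univ : ∀ n, composition m₀ ρ n ω Set.univ = m₀.real Set.univ + n
  integrable : ∀ n, (composition m₀ ρ n ω).Integrable fun y => W y ^ q
  integrable_replacement : ∀ n, (ρ n ω).Integrable fun y => W y ^ q

variable {m₀ : Measure E} [IsFiniteMeasure m₀] {ρ : ℕ → Ω → SignedMeasure E} {W : Weight E} {q : ℝ}

theorem IsTame.integrable_normalized {F : Type*} [NormedAddCommGroup F] [ProperSpace F]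
    [MeasurableSpace F] [BorelSpace F] {ω : Ω} {f : E → F} {C : ℝ}
    (ht : IsTame W q m₀ ρ ω) (hf : Measurable f)
    (hfC : ∀ y, ‖f y‖ ≤ C * W y ^ q) (n : ℕ) : (normalized m₀ ρ n ω).Integrable f :=
  (integrable_signed_of_le (ht.integrable n) hf.aestronglyMeasurable hfC).smul_vectorMeasure _

variable {F : Type*} [NormedAddCommGroup F] [NormedSpace ℝ F]

/-- The integral of `f` against the normalised composition, as a functional of the process that is
measurable everywhere. -/
noncomputable def urnAverage (W : Weight E) (m₀ : Measure E) [IsFiniteMeasure m₀]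
    (ρ : ℕ → Ω → SignedMeasure E) (f : E → F) (n : ℕ) (ω : Ω) : F :=
  (m₀.real Set.univ + n)⁻¹ • limIntegral W f (composition m₀ ρ n ω)

theorem real_univ_pos (hm₀ : m₀ ≠ 0) : 0 < m₀.real Set.univ :=
  ENNReal.toReal_pos (Measure.measure_univ_ne_zero.2 hm₀) (measure_ne_top _ _)

theorem mass_pos (hm₀ : m₀ ≠ 0) (n : ℕ) : 0 < m₀.real Set.univ + n :=
  add_pos_of_pos_of_nonneg (real_univ_pos hm₀) n.cast_nonneg

namespace IsTame

variable [ProperSpace F] [MeasurableSpace F] [BorelSpace F]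
  {ω : Ω} {f : E → F} {C : ℝ}

theorem urnAverage_eq (ht : IsTame W q m₀ ρ ω) (hf : Measurable f)
    (hfC : ∀ y, ‖f y‖ ≤ C * W y ^ q) (n : ℕ) :
    urnAverage W m₀ ρ f n ω = ∫ᵛ y, f y ∂<•(normalized m₀ ρ n ω) := by
  rw [urnAverage, limIntegral_eq W hf
    (integrable_signed_of_le (ht.integrable n) hf.aestronglyMeasurable hfC), normalized,
    VectorMeasure.integral_smul_vectorMeasure, ht.univ n]

theorem urnAverage_succ (hm₀ : m₀ ≠ 0) (ht : IsTame W q m₀ ρ ω) (hf : Measurable f)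
    (hfC : ∀ y, ‖f y‖ ≤ C * W y ^ q) (n : ℕ) :
    (m₀.real Set.univ + n + 1) • urnAverage W m₀ ρ f (n + 1) ω =
      (m₀.real Set.univ + n) • urnAverage W m₀ ρ f n ω + limIntegral W f (ρ n ω) := by
  have hint := integrable_signed_of_le (ht.integrable n) hf.aestronglyMeasurable hfC
  have hint' := integrable_signed_of_le (ht.integrable_replacement n) hf.aestronglyMeasurable hfC
  have h1 := (mass_pos hm₀ n).ne'
  have h2 := (mass_pos hm₀ (n + 1)).ne'
  rw [urnAverage, urnAverage, smul_inv_smul₀ h1]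
  push_cast at h2 ⊢
  rw [add_assoc, smul_inv_smul₀ h2, composition_succ, limIntegral_eq W hf hint,
    limIntegral_eq W hf hint', limIntegral_eq W hf (hint.add_vectorMeasure hint'),
    VectorMeasure.integral_add_vectorMeasure hint hint']

end IsTame

theorem stronglyMeasurable_urnAverage {Y : ℕ → Ω → E} [ProperSpace F] [MeasurableSpace F] [BorelSpace F]
    (hq : 0 ≤ q) {f : E → F} (hf : Measurable f) {C : ℝ} (hC : 0 ≤ C)
    (hfC : ∀ y, ‖f y‖ ≤ C * W y ^ q) (n : ℕ) :
    StronglyMeasurable[history Y ρ n] (urnAverage W m₀ ρ f n) :=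
  (((stronglyMeasurable_limIntegral hq hf hC hfC).comp_measurable
    (measurable_composition_history m₀ Y ρ n)).const_smul _)

variable [mΩ : MeasurableSpace Ω] {R : Kernel E (SignedMeasure E)}
  {P : Measure Ω} {Y : ℕ → Ω → E}
  [IsMarkovKernel R] [IsProbabilityMeasure P] {ϑ C₁ C₂ L : ℝ}

/-- Tenability gives the positivity of the compositions; the integrability of `W ^ q` propagates from
one composition to the next because each replacement a.s. has bounded truncated integrals, which is a
measurable property and so is inherited from the replacement kernel. -/
theorem HasReplacementBounds.ae_isTame (hR : HasReplacementBounds R W q ϑ C₁ C₂ L)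
    (hV : Integrable (fun y => W y ^ q) m₀) (h : IsMVPP R m₀ P Y ρ) :
    ∀ᵐ ω ∂P, IsTame W q m₀ ρ ω := by
  have hq : 0 ≤ q := by linarith [hR.two_le]
  have h1 : ∀ᵐ ω ∂P, ∀ n, ρ n ω ∈ boundedTruncations W q := ae_all_iff.2 fun n =>
    h.ae_replacement_mem n (measurableSet_boundedTruncations hq)
      fun x => (hR.ae_integrable x).mono fun m hm => mem_boundedTruncations hm
  have h2 : ∀ᵐ ω ∂P, ∀ n, ρ n ω Set.univ = 1 := ae_all_iff.2 fun n =>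
    h.ae_replacement_mem n (B := {m | m Set.univ = 1})
      (measurable_eval MeasurableSet.univ (measurableSet_singleton 1)) hR.balanced
  filter_upwards [h.tenable, h1, h2] with ω h0 h1 h2
  have hint : ∀ n, (composition m₀ ρ n ω).Integrable fun y => W y ^ q := by
    intro n
    induction n with
    | zero =>
      have : composition m₀ ρ 0 ω = m₀.toSignedMeasure := by simp [composition]
      rw [this, VectorMeasure.Integrable, Measure.variation_toSignedMeasure]
      exact hV
    | succ n ih =>
      have h3 := (h0 (n + 1)).2
      rw [composition_succ] at h3 ⊢
      exact integrable_add_of_boundedTruncations hq ih (h1 n) h3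
  refine ⟨fun n => (h0 n).2, fun n => ?_, hint, fun n => ?_⟩
  · induction n with
    | zero => simp [composition, Measure.toSignedMeasure_apply_measurable MeasurableSet.univ]
    | succ n ih =>
      rw [composition_succ, add_apply, ih, h2 n]
      push_cast
      ring
  · have h3 := (hint (n + 1)).sub_vectorMeasure (hint n)
    rwa [composition_succ, add_sub_cancel_left] at h3

end Tame

/-! ### The law of the next draw and of the next replacement -/

section DrawKernel

variable {E : Type u} [MeasurableSpace E] {Ω : Type v} {m₀ : Measure E} [IsFiniteMeasure m₀]
  {ρ : ℕ → Ω → SignedMeasure E} {W : Weight E} {q : ℝ}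

/-- The measure `κ` on `E` is the normalised composition at time `n` of a tame trajectory. -/
structure IsDrawLaw (W : Weight E) (q : ℝ) (m₀ : Measure E) [IsFiniteMeasure m₀]
    (ρ : ℕ → Ω → SignedMeasure E) (n : ℕ) (ω : Ω) (κ : Measure E) : Prop where
  prob : IsProbabilityMeasure κ
  integrable : Integrable (fun y => W y ^ q) κ
  tame : IsTame W q m₀ ρ ω
  eq : κ = (ENNReal.ofReal (m₀.real Set.univ + n))⁻¹ • (composition m₀ ρ n ω).variation

theorem IsTame.isDrawLaw (hm₀ : m₀ ≠ 0) {ω : Ω} (ht : IsTame W q m₀ ρ ω) (n : ℕ) :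
    IsDrawLaw W q m₀ ρ n ω
      ((ENNReal.ofReal (m₀.real Set.univ + n))⁻¹ • (composition m₀ ρ n ω).variation) := by
  have hs : ENNReal.ofReal (m₀.real Set.univ + n) ≠ 0 := by simpa using mass_pos hm₀ n
  refine ⟨⟨?_⟩, (ht.integrable n).smul_measure (ENNReal.inv_ne_top.2 hs), ht, rfl⟩
  rw [Measure.smul_apply, variation_apply_of_nonneg (ht.nonneg n) MeasurableSet.univ, ht.univ n,
    smul_eq_mul, ENNReal.inv_mul_cancel hs ENNReal.ofReal_ne_top]

variable {F : Type*} [NormedAddCommGroup F] [NormedSpace ℝ F] [ProperSpace F] [MeasurableSpace F]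
  [BorelSpace F]

theorem IsDrawLaw.integral_eq (hm₀ : m₀ ≠ 0) {n : ℕ} {ω : Ω} {κ : Measure E}
    (h : IsDrawLaw W q m₀ ρ n ω κ) {f : E → F} (hf : Measurable f) {C : ℝ}
    (hfC : ∀ y, ‖f y‖ ≤ C * W y ^ q) : ∫ y, f y ∂κ = urnAverage W m₀ ρ f n ω := by
  rw [h.eq, integral_smul_measure, urnAverage, limIntegral_eq W hf
    (integrable_signed_of_le (h.tame.integrable n) hf.aestronglyMeasurable hfC),
    integral_signed_of_nonneg (h.tame.nonneg n), ENNReal.toReal_inv,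
    ENNReal.toReal_ofReal (mass_pos hm₀ n).le]

theorem IsDrawLaw.lintegral_weight (hm₀ : m₀ ≠ 0) {n : ℕ} {ω : Ω} {κ : Measure E}
    (h : IsDrawLaw W q m₀ ρ n ω κ) {c : ℝ} (hc : 0 ≤ c) :
    ∫⁻ y, ENNReal.ofReal (c * W y ^ q) ∂κ =
      ENNReal.ofReal (c * urnAverage W m₀ ρ (fun y => W y ^ q) n ω) := by
  rw [← h.integral_eq hm₀ (measurable_rpow_weight W q) (norm_rpow_weight_le W q),
    ← integral_const_mul, ofReal_integral_eq_lintegral_ofReal (h.integrable.const_mul c)]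
  exact Eventually.of_forall fun y => mul_nonneg hc (rpow_weight_nonneg W q y)

theorem IsDrawLaw.one_le (hm₀ : m₀ ≠ 0) (hq : 0 ≤ q) {n : ℕ} {ω : Ω} {κ : Measure E}
    (h : IsDrawLaw W q m₀ ρ n ω κ) : 1 ≤ urnAverage W m₀ ρ (fun y => W y ^ q) n ω := by
  have := h.prob
  rw [← h.integral_eq hm₀ (measurable_rpow_weight W q) (norm_rpow_weight_le W q)]
  have h1 := integral_mono (μ := κ) (integrable_const (1 : ℝ)) h.integrable
    fun y => one_le_rpow_weight W hq y
  simpa using h1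

theorem IsDrawLaw.integrable_of_le {G : Type*} [NormedAddCommGroup G] {n : ℕ} {ω : Ω}
    {κ : Measure E} (h : IsDrawLaw W q m₀ ρ n ω κ) {f : E → G} (hf : AEStronglyMeasurable f κ)
    {C : ℝ} (hfC : ∀ y, ‖f y‖ ≤ C * W y ^ q) : Integrable f κ :=
  (h.integrable.const_mul C).mono' hf (Eventually.of_forall hfC)

theorem IsDrawLaw.norm_urnAverage_le (hm₀ : m₀ ≠ 0) {n : ℕ} {ω : Ω} {κ : Measure E}
    (h : IsDrawLaw W q m₀ ρ n ω κ) {f : E → F} (hf : Measurable f) {C : ℝ}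
    (hfC : ∀ y, ‖f y‖ ≤ C * W y ^ q) :
    ‖urnAverage W m₀ ρ f n ω‖ ≤ C * urnAverage W m₀ ρ (fun y => W y ^ q) n ω := by
  rw [← h.integral_eq hm₀ hf hfC,
    ← h.integral_eq hm₀ (measurable_rpow_weight W q) (norm_rpow_weight_le W q),
    ← integral_const_mul]
  exact norm_integral_le_of_norm_le (h.integrable.const_mul C) (Eventually.of_forall hfC)

theorem IsDrawLaw.sq_norm_urnAverage_le (hm₀ : m₀ ≠ 0) (hq : 2 ≤ q) {n : ℕ} {ω : Ω}
    {κ : Measure E} (h : IsDrawLaw W q m₀ ρ n ω κ) (f : BW W) :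
    ‖urnAverage W m₀ ρ f n ω‖ ^ 2 ≤
      ‖f‖ ^ 2 * urnAverage W m₀ ρ (fun y => W y ^ q) n ω := by
  have := h.prob
  have hb : ∀ y, ‖f y‖ ^ 2 ≤ ‖f‖ ^ 2 * W y ^ q := fun y => by
    have h1 : ‖f y‖ ^ 2 ≤ (‖f‖ * W y) ^ 2 := pow_le_pow_left₀ (norm_nonneg _) (f.le_norm y) 2
    have h2 : W y ^ 2 ≤ W y ^ q := by
      rw [← Real.rpow_natCast]
      exact Real.rpow_le_rpow_of_exponent_le (W.one_le' y) (by exact_mod_cast hq)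
    rw [mul_pow] at h1
    exact h1.trans (mul_le_mul_of_nonneg_left h2 (sq_nonneg _))
  have hint : Integrable (fun y => ‖f y‖ ^ 2) κ :=
    h.integrable_of_le (f.measurable.norm.pow_const 2).aestronglyMeasurable
      (fun y => by simpa using hb y)
  have hL : MemLp (f : E → ℂ) 2 κ :=
    (memLp_two_iff_integrable_sq_norm f.measurable.aestronglyMeasurable).2 hint
  rw [← h.integral_eq hm₀ f.measurable (f.norm_apply_le_rpow (by linarith)),
    ← h.integral_eq hm₀ (measurable_rpow_weight W q) (norm_rpow_weight_le W q),
    ← integral_const_mul]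
  calc ‖∫ y, f y ∂κ‖ ^ 2 ≤ (∫ y, ‖f y‖ ∂κ) ^ 2 :=
        pow_le_pow_left₀ (norm_nonneg _) (norm_integral_le_integral_norm _) 2
    _ ≤ ∫ y, ‖f y‖ ^ 2 ∂κ := sq_integral_norm_le hL
    _ ≤ _ := integral_mono hint (h.integrable.const_mul _) hb

theorem IsDrawLaw.urnAverage_add_mul (hm₀ : m₀ ≠ 0) (hq : 1 ≤ q) {n : ℕ} {ω : Ω}
    {κ : Measure E} (h : IsDrawLaw W q m₀ ρ n ω κ) (f g : BW W) (c : ℂ) :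
    urnAverage W m₀ ρ (f + c • g : BW W) n ω =
      urnAverage W m₀ ρ f n ω + c * urnAverage W m₀ ρ g n ω := by
  have hint := fun f : BW W => h.integrable_of_le f.measurable.aestronglyMeasurable
    (f.norm_apply_le_rpow hq)
  rw [← h.integral_eq hm₀ (BW.measurable _) (BW.norm_apply_le_rpow hq _),
    ← h.integral_eq hm₀ f.measurable (f.norm_apply_le_rpow hq),
    ← h.integral_eq hm₀ g.measurable (g.norm_apply_le_rpow hq), ← integral_const_mul,
    ← integral_add (hint f) ((hint g).const_mul c)]
  rfl

end DrawKernel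

section Moments

variable {E : Type u} [MeasurableSpace E] {Ω : Type v} [mΩ : MeasurableSpace Ω]
  {R : Kernel E (SignedMeasure E)} {m₀ : Measure E} [IsFiniteMeasure m₀] {P : Measure Ω}
  {Y : ℕ → Ω → E} {ρ : ℕ → Ω → SignedMeasure E} {W : Weight E} {q : ℝ}
  [IsProbabilityMeasure P]

/-- The conditional law of the next draw given the history, as a kernel. The total variation of the
composition is measurable only where the composition is positive, so the kernel is set to `0` on a
measurable null set outside of which the trajectories are tame. -/
theorem IsMVPP.exists_drawKernel (hm₀ : m₀ ≠ 0) (h : IsMVPP R m₀ P Y ρ)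
    (ht : ∀ᵐ ω ∂P, IsTame W q m₀ ρ ω) (n : ℕ) :
    ∃ κ : Kernel Ω E, (∀ᵐ ω ∂P, IsDrawLaw W q m₀ ρ n ω (κ ω)) ∧
      ∀ H, MeasurableSet[history Y ρ n] H → (P.restrict H).map (Y n) = (P.restrict H).bind κ := by
  classical
  obtain ⟨N, hN, hNm, hN0⟩ := exists_measurable_superset_of_null (ae_iff.1 ht)
  have hNt : ∀ ω, ω ∉ N → IsTame W q m₀ ρ ω := fun ω hω => by
    by_contra hc
    exact hω (hN hc)
  set s := m₀.real Set.univ + n with hs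
  set K : Ω → Measure E := fun ω =>
    if ω ∈ N then 0 else (ENNReal.ofReal s)⁻¹ • (composition m₀ ρ n ω).variation with hK
  have hKm : Measurable K := by
    refine Measure.measurable_of_measurable_coe _ fun A hA => ?_
    have h1 : (fun ω => K ω A) = fun ω => if ω ∈ N then 0 else
        (ENNReal.ofReal s)⁻¹ * ENNReal.ofReal (composition m₀ ρ n ω A) := by
      funext ω
      by_cases hω : ω ∈ N
      · simp [hK, hω]
      · simp [hK, hω, variation_apply_of_nonneg ((hNt ω hω).nonneg n) hA]
    rw [h1]
    refine Measurable.ite hNm measurable_const (Measurable.const_mul ?_ _)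
    exact ENNReal.measurable_ofReal.comp ((measurable_eval hA).comp
      ((measurable_composition_history m₀ Y ρ n).mono (h.history_le n) le_rfl))
  have hNae : ∀ᵐ ω ∂P, ω ∉ N := measure_eq_zero_iff_ae_notMem.1 hN0
  have hlaw : ∀ ω, ω ∉ N → IsDrawLaw W q m₀ ρ n ω (K ω) := fun ω hω => by
    simpa [hK, hω] using (hNt ω hω).isDrawLaw hm₀ n
  have hfin : IsFiniteKernel (⟨K, hKm⟩ : Kernel Ω E) := by
    refine ⟨1, ENNReal.one_lt_top, fun ω => ?_⟩
    by_cases hω : ω ∈ N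
    · simp [hK, hω]
    · have := (hlaw ω hω).prob
      exact (measure_univ (μ := K ω)).le
  refine ⟨⟨K, hKm⟩, hNae.mono hlaw, fun H hH => ?_⟩
  refine map_restrict_eq_bind_of_condExp (h.history_le n) (h.measurable_draw n) (fun A hA => ?_) hH
  refine (h.law_draw n A hA).trans (hNae.mono fun ω hω => ?_)
  have hsn := mass_pos hm₀ n
  have h2 := variation_apply_of_nonneg ((hNt ω hω).nonneg n) hA
  change normalized m₀ ρ n ω A = (K ω A).toReal
  simp only [hK, hω, if_false, Measure.smul_apply, h2, smul_eq_mul,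
    ENNReal.toReal_mul, ENNReal.toReal_inv, ENNReal.toReal_ofReal ((hNt ω hω).nonneg n A hA),
    ENNReal.toReal_ofReal hsn.le, normalized, (hNt ω hω).univ n, hs, smul_apply]

theorem IsMVPP.integrable_urnAverage (hm₀ : m₀ ≠ 0) (h : IsMVPP R m₀ P Y ρ)
    (ht : ∀ᵐ ω ∂P, IsTame W q m₀ ρ ω) (hq : 0 ≤ q) (n : ℕ)
    (hint : Integrable (urnAverage W m₀ ρ (fun y => W y ^ q) n) P)
    {F : Type*} [NormedAddCommGroup F] [NormedSpace ℝ F] [ProperSpace F] [MeasurableSpace F]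
    [BorelSpace F] {f : E → F} (hf : Measurable f) {C : ℝ} (hC : 0 ≤ C) (hfC : ∀ y, ‖f y‖ ≤ C * W y ^ q) :
    Integrable (urnAverage W m₀ ρ f n) P := by
  obtain ⟨κ, hκ, -⟩ := h.exists_drawKernel hm₀ ht n
  exact (hint.const_mul C).mono'
    (((stronglyMeasurable_urnAverage (Y := Y) hq hf hC hfC n).mono
      (h.history_le n)).aestronglyMeasurable)
    (hκ.mono fun ω hω => hω.norm_urnAverage_le hm₀ hf hfC)

variable [IsMarkovKernel R]

theorem IsMVPP.lintegral_replacement (h : IsMVPP R m₀ P Y ρ) (n : ℕ) {κ : Kernel Ω E}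
    {H : Set Ω} (hH : MeasurableSet[history Y ρ n] H)
    (hκ : (P.restrict H).map (Y n) = (P.restrict H).bind κ)
    {ψ : SignedMeasure E → ℝ≥0∞} (hψ : Measurable ψ) :
    ∫⁻ ω in H, ψ (ρ n ω) ∂P = ∫⁻ ω in H, ∫⁻ y, ∫⁻ m, ψ m ∂(R y) ∂(κ ω) ∂P := by
  rw [lintegral_comp_of_map_eq_bind (h.measurable_replacement n) (h.map_replacement n hH) hψ,
    ← lintegral_comp_of_map_eq_bind (h.measurable_draw n) hκ hψ.lintegral_kernel]
  rfl

theorem IsMVPP.lintegral_replacement_le (hm₀ : m₀ ≠ 0) (h : IsMVPP R m₀ P Y ρ)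
    (ht : ∀ᵐ ω ∂P, IsTame W q m₀ ρ ω) (hq : 0 ≤ q) (n : ℕ)
    (hint : Integrable (urnAverage W m₀ ρ (fun y => W y ^ q) n) P)
    {ψ : SignedMeasure E → ℝ≥0∞} (hψ : Measurable ψ) {c : ℝ} (hc : 0 ≤ c)
    (hb : ∀ x, ∫⁻ m, ψ m ∂(R x) ≤ ENNReal.ofReal (c * W x ^ q)) :
    ∫⁻ ω, ψ (ρ n ω) ∂P ≤
      ENNReal.ofReal (c * ∫ ω, urnAverage W m₀ ρ (fun y => W y ^ q) n ω ∂P) := by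
  obtain ⟨κ, hκ, hκY⟩ := h.exists_drawKernel hm₀ ht n
  have h1 := h.lintegral_replacement n MeasurableSet.univ (hκY _ MeasurableSet.univ) hψ
  rw [Measure.restrict_univ] at h1
  rw [h1, ← integral_const_mul, ofReal_integral_eq_lintegral_ofReal (hint.const_mul c)]
  · refine lintegral_mono_ae (hκ.mono fun ω hω => ?_)
    rw [← hω.lintegral_weight hm₀ hc]
    exact lintegral_mono hb
  · exact hκ.mono fun ω hω => mul_nonneg hc (zero_le_one.trans (hω.one_le hm₀ hq))

theorem IsMVPP.integrable_replacement (hm₀ : m₀ ≠ 0) (h : IsMVPP R m₀ P Y ρ)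
    (ht : ∀ᵐ ω ∂P, IsTame W q m₀ ρ ω) (hq : 0 ≤ q) (n : ℕ)
    (hint : Integrable (urnAverage W m₀ ρ (fun y => W y ^ q) n) P)
    {F : Type*} [NormedAddCommGroup F]
    {ψ : SignedMeasure E → F} (hψ : StronglyMeasurable ψ) {c : ℝ} (hc : 0 ≤ c)
    (hb : ∀ x, ∫⁻ m, ‖ψ m‖ₑ ∂(R x) ≤ ENNReal.ofReal (c * W x ^ q)) :
    Integrable (fun ω => ψ (ρ n ω)) P :=
  ⟨(hψ.comp_measurable (h.measurable_replacement n)).aestronglyMeasurable,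
    (h.lintegral_replacement_le hm₀ ht hq n hint hψ.enorm hc hb).trans_lt ENNReal.ofReal_lt_top⟩

variable {F : Type*} [NormedAddCommGroup F] [NormedSpace ℝ F] [ProperSpace F] [MeasurableSpace F]
  [BorelSpace F]

/-- Given the history, the mean of a functional `ψ` of the next replacement is the integral of
`x ↦ E[ψ(R_x)]` against the normalised composition. -/
theorem IsMVPP.setIntegral_replacement (hm₀ : m₀ ≠ 0) (h : IsMVPP R m₀ P Y ρ)
    (ht : ∀ᵐ ω ∂P, IsTame W q m₀ ρ ω) (hq : 0 ≤ q) (n : ℕ)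
    (hint : Integrable (urnAverage W m₀ ρ (fun y => W y ^ q) n) P)
    {ψ : SignedMeasure E → F} (hψ : StronglyMeasurable ψ) {c : ℝ} (hc : 0 ≤ c)
    (hb : ∀ x, ∫⁻ m, ‖ψ m‖ₑ ∂(R x) ≤ ENNReal.ofReal (c * W x ^ q))
    {H : Set Ω} (hH : MeasurableSet[history Y ρ n] H) :
    ∫ ω in H, ψ (ρ n ω) ∂P = ∫ ω in H, urnAverage W m₀ ρ (fun x => ∫ m, ψ m ∂(R x)) n ω ∂P := by
  obtain ⟨κ, hκ, hκY⟩ := h.exists_drawKernel hm₀ ht n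
  have hfin : ∫⁻ ω in H, ∫⁻ y, ∫⁻ m, ‖ψ m‖ₑ ∂(R y) ∂(κ ω) ∂P < ∞ := by
    rw [← h.lintegral_replacement n hH (hκY H hH) hψ.enorm]
    exact lt_of_le_of_lt (setLIntegral_le_lintegral _ _)
      (h.integrable_replacement hm₀ ht hq n hint hψ hc hb).2
  have hfin' : ∫⁻ ω in H, ∫⁻ m, ‖ψ m‖ₑ ∂(R (Y n ω)) ∂P < ∞ := by
    rwa [lintegral_comp_of_map_eq_bind (h.measurable_draw n) (hκY H hH)
      hψ.enorm.lintegral_kernel]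
  have hg : StronglyMeasurable fun x => ∫ m, ψ m ∂(R x) := hψ.integral_kernel
  rw [integral_comp_of_map_eq_bind (h.measurable_replacement n) (h.map_replacement n hH) hψ hfin']
  have h2 := integral_comp_of_map_eq_bind (h.measurable_draw n) (hκY H hH) hg
    (lt_of_le_of_lt (lintegral_mono fun ω => lintegral_mono fun y =>
      enorm_integral_le_lintegral_enorm _) hfin)
  refine Eq.trans (by rfl) (h2.trans ?_)
  refine integral_congr_ae ((ae_restrict_of_ae hκ).mono fun ω hω => ?_)
  refine hω.integral_eq hm₀ hg.measurable (C := c) fun x => ?_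
  rw [← toReal_enorm]
  refine ENNReal.toReal_le_of_le_ofReal (mul_nonneg hc (rpow_weight_nonneg W q x)) ?_
  exact (enorm_integral_le_lintegral_enorm _).trans (hb x)

end Moments

/-! ### Moments of the normalised compositions -/

theorem memLp_two_of_lintegral_le {Ω : Type*} {mΩ : MeasurableSpace Ω} {P : Measure Ω} {X : Ω → ℂ} (hX : AEStronglyMeasurable X P) {c : ℝ}
    (hc : 0 ≤ c) (h : ∫⁻ ω, ‖X ω‖ₑ ^ (2 : ℝ) ∂P ≤ ENNReal.ofReal c) :
    MemLp X 2 P ∧ ∫ ω, ‖X ω‖ ^ 2 ∂P ≤ c := by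
  refine ⟨⟨hX, ?_⟩, ?_⟩
  · rw [eLpNorm_lt_top_iff_lintegral_rpow_enorm_lt_top (by norm_num) (by norm_num)]
    simpa using h.trans_lt ENNReal.ofReal_lt_top
  · rw [integral_eq_lintegral_of_nonneg_ae (Eventually.of_forall fun ω => sq_nonneg _)
      (hX.norm.pow 2)]
    refine ENNReal.toReal_le_of_le_ofReal hc (le_trans (le_of_eq ?_) h)
    refine lintegral_congr fun ω => ?_
    rw [ENNReal.ofReal_pow (norm_nonneg _), ofReal_norm, ← ENNReal.rpow_natCast]
    norm_num

section Functionals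

variable {E : Type u} [MeasurableSpace E] {R : Kernel E (SignedMeasure E)} {W : Weight E}
  {q ϑ C₁ C₂ L : ℝ}

theorem HasReplacementBounds.stronglyMeasurable_limIntegral
    (hR : HasReplacementBounds R W q ϑ C₁ C₂ L) (f : BW W) :
    StronglyMeasurable (limIntegral W (f : E → ℂ)) := by
  have hq := hR.two_le
  exact MVPP.stronglyMeasurable_limIntegral (by linarith) f.measurable (norm_nonneg f)
    (f.norm_apply_le_rpow (by linarith))

theorem HasReplacementBounds.first_bound_nonneg
    (hR : HasReplacementBounds R W q ϑ C₁ C₂ L) (f : BW W) : 0 ≤ 1 + ‖f‖ ^ 2 * C₂ := by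
  have := hR.nonneg_second
  positivity

theorem HasReplacementBounds.stronglyMeasurable_urnAverage {Ω : Type v}
    {m₀ : Measure E} [IsFiniteMeasure m₀] {Y : ℕ → Ω → E} {ρ : ℕ → Ω → SignedMeasure E}
    (hR : HasReplacementBounds R W q ϑ C₁ C₂ L) (f : BW W) (n : ℕ) :
    StronglyMeasurable[history Y ρ n] (urnAverage W m₀ ρ (f : E → ℂ) n) := by
  have hq := hR.two_le
  exact MVPP.stronglyMeasurable_urnAverage (by linarith) f.measurable (norm_nonneg f)
    (f.norm_apply_le_rpow (by linarith)) n

end Functionals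

section Scheme

variable {E : Type u} [MeasurableSpace E] {Ω : Type v} [mΩ : MeasurableSpace Ω]
  {R : Kernel E (SignedMeasure E)} {m₀ : Measure E} [IsFiniteMeasure m₀] {P : Measure Ω}
  {Y : ℕ → Ω → E} {ρ : ℕ → Ω → SignedMeasure E} {W : Weight E} {q ϑ C₁ C₂ L : ℝ}
  [IsProbabilityMeasure P] [IsMarkovKernel R]

theorem one_le_average_weight (hm₀ : m₀ ≠ 0) (hq : 0 ≤ q)
    (hV : Integrable (fun y => W y ^ q) m₀) :
    1 ≤ (∫ y, W y ^ q ∂m₀) / m₀.real Set.univ := by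
  rw [le_div_iff₀ (real_univ_pos hm₀), one_mul]
  have h1 := integral_mono (μ := m₀) (integrable_const (1 : ℝ)) hV
    fun y => one_le_rpow_weight W hq y
  simpa using h1

/-- The drift condition bounds the mean of `W ^ q` under the normalised compositions, uniformly in
time. -/
theorem HasReplacementBounds.integral_weight_le (hR : HasReplacementBounds R W q ϑ C₁ C₂ L)
    (hm₀ : m₀ ≠ 0) (hV : Integrable (fun y => W y ^ q) m₀) (h : IsMVPP R m₀ P Y ρ) (n : ℕ) :
    Integrable (urnAverage W m₀ ρ (fun y => W y ^ q) n) P ∧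
      ∫ ω, urnAverage W m₀ ρ (fun y => W y ^ q) n ω ∂P ≤
        max 1 (C₁ / (1 - ϑ)) * ((∫ y, W y ^ q ∂m₀) / m₀.real Set.univ) := by
  have hq : 0 ≤ q := by linarith [hR.two_le]
  have ht := hR.ae_isTame hV h
  have hv := one_le_average_weight hm₀ hq hV
  set v := (∫ y, W y ^ q ∂m₀) / m₀.real Set.univ with hvdef
  set B := max 1 (C₁ / (1 - ϑ)) * v with hB
  have hB1 : C₁ ≤ (1 - ϑ) * B := by
    have h1 : C₁ / (1 - ϑ) ≤ B :=
      (le_max_right 1 _).trans (le_mul_of_one_le_right (zero_le_one.trans (le_max_left _ _)) hv)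
    rwa [div_le_iff₀' (by linarith [hR.theta_lt_one])] at h1
  have hmV := measurable_rpow_weight W q
  have hVn := norm_rpow_weight_le W q
  induction n with
  | zero =>
    have h0 : urnAverage W m₀ ρ (fun y => W y ^ q) 0 = fun _ => v := by
      funext ω
      have h1 : composition m₀ ρ 0 ω = m₀.toSignedMeasure := by simp [composition]
      have h2 : m₀.toSignedMeasure.Integrable fun y => W y ^ q := by
        rw [VectorMeasure.Integrable, Measure.variation_toSignedMeasure]
        exact hV
      rw [urnAverage, h1, limIntegral_eq W hmV h2, VectorMeasure.integral_toSignedMeasure, hvdef]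
      simp [div_eq_inv_mul]
    rw [h0]
    refine ⟨integrable_const _, ?_⟩
    simpa [hB] using le_mul_of_one_le_left (zero_le_one.trans hv) (le_max_left 1 (C₁ / (1 - ϑ)))
  | succ n ih =>
    obtain ⟨hint, hle⟩ := ih
    set s := m₀.real Set.univ + n with hs
    have hs0 : 0 < s := mass_pos hm₀ n
    have hψ := MVPP.stronglyMeasurable_limIntegral hq hmV zero_le_one hVn
    have hJ := h.integrable_replacement hm₀ ht hq n hint hψ hR.nonneg_first hR.first_moment
    have hsucc : urnAverage W m₀ ρ (fun y => W y ^ q) (n + 1) =ᵐ[P] fun ω =>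
        (s + 1)⁻¹ * (s * urnAverage W m₀ ρ (fun y => W y ^ q) n ω +
          limIntegral W (fun y => W y ^ q) (ρ n ω)) := by
      filter_upwards [ht] with ω hω
      have h1 := hω.urnAverage_succ hm₀ hmV hVn n
      simp only [smul_eq_mul] at h1
      rw [← h1, inv_mul_cancel_left₀ (by positivity)]
    have hint' : Integrable (fun ω => s * urnAverage W m₀ ρ (fun y => W y ^ q) n ω) P :=
      hint.const_mul s
    refine ⟨((hint'.add hJ).const_mul (s + 1)⁻¹).congr hsucc.symm, ?_⟩
    rw [integral_congr_ae hsucc, integral_const_mul, integral_add hint' hJ, integral_const_mul]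
    have hmean : ∫ ω, limIntegral W (fun y => W y ^ q) (ρ n ω) ∂P ≤ ϑ * B + C₁ := by
      have h1 := h.setIntegral_replacement hm₀ ht hq n hint hψ hR.nonneg_first hR.first_moment
        MeasurableSet.univ
      rw [Measure.restrict_univ] at h1
      rw [h1]
      obtain ⟨κ, hκ, -⟩ := h.exists_drawKernel hm₀ ht n
      have hgm : Measurable fun x => ∫ m, limIntegral W (fun y => W y ^ q) m ∂(R x) :=
        hψ.integral_kernel.measurable
      have hgb : ∀ x, ‖∫ m, limIntegral W (fun y => W y ^ q) m ∂(R x)‖ ≤ L * W x ^ q := fun x => by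
        rw [← toReal_enorm]
        refine ENNReal.toReal_le_of_le_ofReal
          (mul_nonneg hR.nonneg_first (rpow_weight_nonneg W q x)) ?_
        exact (enorm_integral_le_lintegral_enorm _).trans (hR.first_moment x)
      calc ∫ ω, urnAverage W m₀ ρ (fun x => ∫ m, limIntegral W (fun y => W y ^ q) m ∂(R x)) n ω ∂P
          ≤ ∫ ω, (ϑ * urnAverage W m₀ ρ (fun y => W y ^ q) n ω + C₁) ∂P := by
            refine integral_mono_ae
              (h.integrable_urnAverage hm₀ ht hq n hint hgm hR.nonneg_first hgb)
              ((hint.const_mul ϑ).add (integrable_const _)) (hκ.mono fun ω hω => ?_)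
            have := hω.prob
            have h2 := integral_mono (μ := κ ω)
              (hω.integrable_of_le hgm.aestronglyMeasurable hgb)
              ((hω.integrable.const_mul ϑ).add (integrable_const C₁)) hR.drift
            rw [hω.integral_eq hm₀ hgm hgb] at h2
            refine h2.trans (le_of_eq ?_)
            simp only [Pi.add_apply]
            rw [integral_add (hω.integrable.const_mul ϑ) (integrable_const C₁), integral_const_mul,
              hω.integral_eq hm₀ hmV hVn]
            simp
        _ = ϑ * ∫ ω, urnAverage W m₀ ρ (fun y => W y ^ q) n ω ∂P + C₁ := by
            rw [integral_add (hint.const_mul ϑ) (integrable_const _), integral_const_mul]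
            simp
        _ ≤ ϑ * B + C₁ := by
            have := mul_le_mul_of_nonneg_left hle hR.theta_pos.le
            linarith
    have h3 : s * ∫ ω, urnAverage W m₀ ρ (fun y => W y ^ q) n ω ∂P ≤ s * B :=
      mul_le_mul_of_nonneg_left hle hs0.le
    rw [inv_mul_le_iff₀ (by positivity)]
    nlinarith

theorem HasReplacementBounds.lintegral_limIntegral_le
    (hR : HasReplacementBounds R W q ϑ C₁ C₂ L) (f : BW W) (x : E) :
    ∫⁻ m, ‖limIntegral W f m‖ₑ ∂(R x) ≤ ENNReal.ofReal ((1 + ‖f‖ ^ 2 * C₂) * W x ^ q) := by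
  have hq := hR.two_le
  have h1 : ∀ t : ℝ≥0∞, t ≤ 1 + t ^ (2 : ℝ) := fun t => by
    rcases le_total t 1 with ht | ht
    · exact le_add_right ht
    · exact le_add_left (ENNReal.le_rpow_self_of_one_le ht (by norm_num))
  calc ∫⁻ m, ‖limIntegral W f m‖ₑ ∂(R x)
      ≤ ∫⁻ m, (1 + ‖limIntegral W f m‖ₑ ^ (2 : ℝ)) ∂(R x) := lintegral_mono fun m => h1 _
    _ = 1 + ∫⁻ m, ‖limIntegral W f m‖ₑ ^ (2 : ℝ) ∂(R x) := by
        rw [lintegral_add_left measurable_const]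
        simp
    _ ≤ ENNReal.ofReal (W x ^ q) + ENNReal.ofReal (‖f‖ ^ 2 * (C₂ * W x ^ q)) := by
        refine add_le_add ?_ (hR.second_moment x f)
        rw [← ENNReal.ofReal_one]
        exact ENNReal.ofReal_le_ofReal (one_le_rpow_weight W (by linarith) x)
    _ = ENNReal.ofReal ((1 + ‖f‖ ^ 2 * C₂) * W x ^ q) := by
        have hV := rpow_weight_nonneg W q x
        have hC := hR.nonneg_second
        rw [← ENNReal.ofReal_add hV (by positivity)]
        ring_nf

/-- The bound on the mean of `W ^ q` under the normalised compositions. -/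
noncomputable def weightBound (W : Weight E) (q ϑ C₁ : ℝ) (m₀ : Measure E) : ℝ :=
  max 1 (C₁ / (1 - ϑ)) * ((∫ y, W y ^ q ∂m₀) / m₀.real Set.univ)

theorem HasReplacementBounds.memLp_limIntegral (hR : HasReplacementBounds R W q ϑ C₁ C₂ L)
    (hm₀ : m₀ ≠ 0) (hV : Integrable (fun y => W y ^ q) m₀) (h : IsMVPP R m₀ P Y ρ) (n : ℕ)
    (f : BW W) :
    MemLp (fun ω => limIntegral W f (ρ n ω)) 2 P ∧
      ∫ ω, ‖limIntegral W f (ρ n ω)‖ ^ 2 ∂P ≤ C₂ * weightBound W q ϑ C₁ m₀ * ‖f‖ ^ 2 := by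
  have hq := hR.two_le
  have ht := hR.ae_isTame hV h
  have hC := hR.nonneg_second
  obtain ⟨hint, hle⟩ := hR.integral_weight_le hm₀ hV h n
  have hψ := hR.stronglyMeasurable_limIntegral f
  have hnn : 0 ≤ ∫ ω, urnAverage W m₀ ρ (fun y => W y ^ q) n ω ∂P := by
    obtain ⟨κ, hκ, -⟩ := h.exists_drawKernel hm₀ ht n
    exact integral_nonneg_of_ae (hκ.mono fun ω hω =>
      zero_le_one.trans (hω.one_le hm₀ (by linarith)))
  have h1 := h.lintegral_replacement_le hm₀ ht (by linarith) n hint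
    (ψ := fun m => ‖limIntegral W f m‖ₑ ^ (2 : ℝ)) (hψ.enorm.pow_const _)
    (c := ‖f‖ ^ 2 * C₂) (by positivity)
    (fun x => (hR.second_moment x f).trans (le_of_eq (by rw [mul_assoc])))
  obtain ⟨h2, h3⟩ := memLp_two_of_lintegral_le
    (hψ.comp_measurable (h.measurable_replacement n)).aestronglyMeasurable (by positivity) h1
  refine ⟨h2, h3.trans ?_⟩
  have h4 : ‖f‖ ^ 2 * C₂ * ∫ ω, urnAverage W m₀ ρ (fun y => W y ^ q) n ω ∂P ≤
      ‖f‖ ^ 2 * C₂ * weightBound W q ϑ C₁ m₀ := mul_le_mul_of_nonneg_left hle (by positivity)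
  exact h4.trans (le_of_eq (by ring))

theorem HasReplacementBounds.memLp_urnAverage (hR : HasReplacementBounds R W q ϑ C₁ C₂ L)
    (hm₀ : m₀ ≠ 0) (hV : Integrable (fun y => W y ^ q) m₀) (h : IsMVPP R m₀ P Y ρ) (n : ℕ)
    (f : BW W) :
    MemLp (urnAverage W m₀ ρ (f : E → ℂ) n) 2 P ∧
      ∫ ω, ‖urnAverage W m₀ ρ (f : E → ℂ) n ω‖ ^ 2 ∂P ≤ weightBound W q ϑ C₁ m₀ * ‖f‖ ^ 2 := by
  have hq := hR.two_le
  have ht := hR.ae_isTame hV h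
  obtain ⟨hint, hle⟩ := hR.integral_weight_le hm₀ hV h n
  obtain ⟨κ, hκ, -⟩ := h.exists_drawKernel hm₀ ht n
  have hmeas : AEStronglyMeasurable (urnAverage W m₀ ρ (f : E → ℂ) n) P :=
    ((hR.stronglyMeasurable_urnAverage (Y := Y) f n).mono (h.history_le n)).aestronglyMeasurable
  have hb : ∀ᵐ ω ∂P, ‖urnAverage W m₀ ρ (f : E → ℂ) n ω‖ ^ 2 ≤
      ‖f‖ ^ 2 * urnAverage W m₀ ρ (fun y => W y ^ q) n ω :=
    hκ.mono fun ω hω => hω.sq_norm_urnAverage_le hm₀ hq f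
  have hsq : Integrable (fun ω => ‖urnAverage W m₀ ρ (f : E → ℂ) n ω‖ ^ 2) P :=
    (hint.const_mul (‖f‖ ^ 2)).mono' (hmeas.norm.pow 2) (hb.mono fun ω hω => by simpa using hω)
  refine ⟨(memLp_two_iff_integrable_sq_norm hmeas).2 hsq, ?_⟩
  refine (integral_mono_ae hsq (hint.const_mul _) hb).trans ?_
  rw [integral_const_mul, mul_comm]
  exact mul_le_mul_of_nonneg_right hle (sq_nonneg _)

/-- The conditional mean of the next replacement is the mean replacement operator, integrated against
the normalised composition. -/
theorem HasReplacementBounds.condExp_limIntegral (hR : HasReplacementBounds R W q ϑ C₁ C₂ L)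
    (hm₀ : m₀ ≠ 0) (hV : Integrable (fun y => W y ^ q) m₀) (h : IsMVPP R m₀ P Y ρ) (n : ℕ)
    (f : BW W) :
    P[fun ω => limIntegral W f (ρ n ω) | history Y ρ n] =ᵐ[P]
      urnAverage W m₀ ρ (meanOperator R W f : E → ℂ) n := by
  have hq := hR.two_le
  have ht := hR.ae_isTame hV h
  obtain ⟨hint, -⟩ := hR.integral_weight_le hm₀ hV h n
  refine (ae_eq_condExp_of_forall_setIntegral_eq (h.history_le n)
    ((hR.memLp_limIntegral hm₀ hV h n f).1.integrable (by norm_num))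
    (fun H _ _ => ((hR.memLp_urnAverage hm₀ hV h n _).1.integrable (by norm_num)).integrableOn)
    (fun H hH _ => ?_)
    (hR.stronglyMeasurable_urnAverage (Y := Y) _ n).aestronglyMeasurable).symm
  rw [h.setIntegral_replacement hm₀ ht (by linarith) n hint
    (hR.stronglyMeasurable_limIntegral f) (hR.first_bound_nonneg f)
    (hR.lintegral_limIntegral_le f) hH]
  simp only [hR.mean _ f]

/-- The normalised compositions, applied to functions in a space `X` that `ι` maps into `B(W)`,
form a linear scheme driven by the mean replacement operator. -/
theorem HasReplacementBounds.isLinearScheme (hR : HasReplacementBounds R W q ϑ C₁ C₂ L)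
    (hm₀ : m₀ ≠ 0) (hV : Integrable (fun y => W y ^ q) m₀) (h : IsMVPP R m₀ P Y ρ)
    {X : Type*} [NormedAddCommGroup X] [NormedSpace ℂ X] (ι : X →L[ℂ] BW W)
    (hι : ∀ x, ‖ι x‖ ≤ ‖x‖) {T : X →L[ℂ] X} (hT : ∀ x, ι (T x) = meanOperator R W (ι x)) :
    IsLinearScheme P h.filtration T (m₀.real Set.univ)
      ((1 + 2 * C₂ + 2 * ‖meanOperator R W‖ ^ 2) * weightBound W q ϑ C₁ m₀)
      fun n x => urnAverage W m₀ ρ (ι x : E → ℂ) n := by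
  have hq := hR.two_le
  have hC := hR.nonneg_second
  have ht := hR.ae_isTame hV h
  set B := weightBound W q ϑ C₁ m₀ with hB
  have hB0 : 0 ≤ B := mul_nonneg (zero_le_one.trans (le_max_left _ _))
    (zero_le_one.trans (one_le_average_weight hm₀ (by linarith) hV))
  -- with `s = s₀ + n + 1`, the increment is `s⁻¹` times the next replacement minus its conditional mean
  have hsucc : ∀ n x, (fun ω => urnAverage W m₀ ρ (ι x : E → ℂ) (n + 1) ω -
      urnAverage W m₀ ρ (ι (x + (((m₀.real Set.univ + n + 1)⁻¹ : ℝ) : ℂ) • (T x - x)) : E → ℂ) n ω)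
      =ᵐ[P] fun ω => (((m₀.real Set.univ + n + 1)⁻¹ : ℝ) : ℂ) * (limIntegral W (ι x) (ρ n ω) -
        urnAverage W m₀ ρ (meanOperator R W (ι x) : E → ℂ) n ω) := by
    intro n x
    obtain ⟨κ, hκ, -⟩ := h.exists_drawKernel hm₀ ht n
    filter_upwards [hκ] with ω hω
    have h1 := hω.tame.urnAverage_succ hm₀ (ι x).measurable
      ((ι x).norm_apply_le_rpow (by linarith)) n
    have h2 := hω.urnAverage_add_mul hm₀ (by linarith) (meanOperator R W (ι x)) (ι x) (-1)
    have h3 := hω.urnAverage_add_mul hm₀ (by linarith) (ι x) (meanOperator R W (ι x) + (-1 : ℂ) • ι x)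
      (((m₀.real Set.univ + n + 1)⁻¹ : ℝ) : ℂ)
    have h4 : ι (x + (((m₀.real Set.univ + n + 1)⁻¹ : ℝ) : ℂ) • (T x - x)) =
        ι x + (((m₀.real Set.univ + n + 1)⁻¹ : ℝ) : ℂ) • (meanOperator R W (ι x) + (-1 : ℂ) • ι x) := by
      rw [map_add, map_smul, map_sub, hT, neg_one_smul, sub_eq_add_neg]
    rw [h4, h3, h2]
    have hs : m₀.real Set.univ + n + 1 ≠ 0 := by
      have := mass_pos hm₀ n
      positivity
    rw [← smul_right_inj hs, smul_sub, h1]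
    simp only [Complex.real_smul]
    push_cast
    have hs' : (m₀.real Set.univ : ℂ) + n + 1 ≠ 0 := by exact_mod_cast hs
    field_simp
    ring
  refine ⟨real_univ_pos hm₀, by positivity, fun n x => hR.stronglyMeasurable_urnAverage _ n,
    fun n x => (hR.memLp_urnAverage hm₀ hV h n _).1, fun n x => ?_, fun n x y c => ?_,
    fun n x => ?_, fun n x => ?_⟩
  · refine (hR.memLp_urnAverage hm₀ hV h n _).2.trans ?_
    rw [← hB]
    refine mul_le_mul ?_ (pow_le_pow_left₀ (norm_nonneg _) (hι x) 2) (by positivity) (by positivity)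
    exact le_mul_of_one_le_left hB0 (by nlinarith [sq_nonneg ‖meanOperator R W‖])
  · obtain ⟨κ, hκ, -⟩ := h.exists_drawKernel hm₀ ht n
    filter_upwards [hκ] with ω hω
    rw [map_add, map_smul]
    exact hω.urnAverage_add_mul hm₀ (by linarith) _ _ _
  · have hJ := (hR.memLp_limIntegral hm₀ hV h n (ι x)).1.integrable (by norm_num)
    have hX := (hR.memLp_urnAverage hm₀ hV h n (meanOperator R W (ι x))).1.integrable (by norm_num)
    refine (condExp_congr_ae (hsucc n x)).trans ?_
    refine (condExp_smul (((m₀.real Set.univ + n + 1)⁻¹ : ℝ) : ℂ) _ _).trans ?_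
    filter_upwards [condExp_sub hJ hX (history Y ρ n), hR.condExp_limIntegral hm₀ hV h n (ι x)]
      with ω h1 h2
    have h3 := condExp_of_stronglyMeasurable (h.history_le n)
      (hR.stronglyMeasurable_urnAverage (m₀ := m₀) (Y := Y) (ρ := ρ) (meanOperator R W (ι x)) n) hX
    have h4 : (P[(fun ω => limIntegral W (ι x) (ρ n ω)) -
        urnAverage W m₀ ρ (meanOperator R W (ι x) : E → ℂ) n | history Y ρ n]) ω = 0 := by
      rw [h1, Pi.sub_apply, h2, h3, sub_self]
    rw [Pi.smul_apply]
    exact (congrArg _ h4).trans (smul_zero _)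
  · obtain ⟨hJ, hJb⟩ := hR.memLp_limIntegral hm₀ hV h n (ι x)
    obtain ⟨hX, hXb⟩ := hR.memLp_urnAverage hm₀ hV h n (meanOperator R W (ι x))
    have hs := mass_pos hm₀ n
    have h1 : ∀ᵐ ω ∂P, ‖urnAverage W m₀ ρ (ι x : E → ℂ) (n + 1) ω - urnAverage W m₀ ρ
        (ι (x + (((m₀.real Set.univ + n + 1)⁻¹ : ℝ) : ℂ) • (T x - x)) : E → ℂ) n ω‖ ^ 2 ≤
        ((m₀.real Set.univ + n + 1)⁻¹) ^ 2 * (2 * ‖limIntegral W (ι x) (ρ n ω)‖ ^ 2 +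
          2 * ‖urnAverage W m₀ ρ (meanOperator R W (ι x) : E → ℂ) n ω‖ ^ 2) := by
      filter_upwards [hsucc n x] with ω hω
      rw [hω, norm_mul, mul_pow, Complex.norm_real, Real.norm_eq_abs, sq_abs]
      refine mul_le_mul_of_nonneg_left ?_ (sq_nonneg _)
      have h2 := norm_sub_le (limIntegral W (ι x) (ρ n ω))
        (urnAverage W m₀ ρ (meanOperator R W (ι x) : E → ℂ) n ω)
      have h3 := pow_le_pow_left₀ (norm_nonneg _) h2 2
      nlinarith [sq_nonneg (‖limIntegral W (ι x) (ρ n ω)‖ -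
        ‖urnAverage W m₀ ρ (meanOperator R W (ι x) : E → ℂ) n ω‖)]
    have hJ2 := (hJ.integrable_norm_pow (p := 2) (by norm_num)).const_mul 2
    have hX2 := (hX.integrable_norm_pow (p := 2) (by norm_num)).const_mul 2
    refine (integral_mono_of_nonneg (Eventually.of_forall fun ω => sq_nonneg _)
      ((hJ2.add hX2).const_mul _) h1).trans ?_
    simp only [Pi.add_apply]
    rw [integral_const_mul, integral_add hJ2 hX2, integral_const_mul, integral_const_mul,
      div_eq_inv_mul, inv_pow]
    refine mul_le_mul_of_nonneg_left ?_ (by positivity)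
    rw [← hB] at hJb hXb
    have h5 : ‖ι x‖ ^ 2 ≤ ‖x‖ ^ 2 := pow_le_pow_left₀ (norm_nonneg _) (hι x) 2
    have h6 : ‖meanOperator R W (ι x)‖ ^ 2 ≤ ‖meanOperator R W‖ ^ 2 * ‖x‖ ^ 2 := by
      rw [← mul_pow]
      exact pow_le_pow_left₀ (norm_nonneg _) (((meanOperator R W).le_opNorm _).trans
        (mul_le_mul_of_nonneg_left (hι x) (norm_nonneg _))) 2
    have h7 : C₂ * B * ‖ι x‖ ^ 2 ≤ C₂ * B * ‖x‖ ^ 2 :=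
      mul_le_mul_of_nonneg_left h5 (by positivity)
    have h8 : B * ‖meanOperator R W (ι x)‖ ^ 2 ≤ B * (‖meanOperator R W‖ ^ 2 * ‖x‖ ^ 2) :=
      mul_le_mul_of_nonneg_left h6 hB0
    have h9 : 0 ≤ B * ‖x‖ ^ 2 := by positivity
    linear_combination 2 * hJb + 2 * hXb + 2 * h7 + 2 * h8 + h9

end Scheme

/-! ### The invariant law -/

section InvariantLaw

variable {E : Type u} [MeasurableSpace E] {W : Weight E} {ν : Measure E}

theorem BW.integrable_of_weight (hν : Integrable (fun y => W y) ν) (f : BW W) :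
    Integrable (f : E → ℂ) ν :=
  (hν.const_mul ‖f‖).mono' f.measurable.aestronglyMeasurable (Eventually.of_forall f.le_norm)

/-- The functional `f ↦ ∫ f dν` on `B(W)`. -/
noncomputable def BW.integralCLM (hν : Integrable (fun y => W y) ν) : BW W →L[ℂ] ℂ :=
  LinearMap.mkContinuous
    { toFun := fun f => ∫ y, f y ∂ν
      map_add' := fun f g => integral_add (f.integrable_of_weight hν) (g.integrable_of_weight hν)
      map_smul' := fun c f => integral_const_mul c _ } (∫ y, W y ∂ν) fun f => by
    rw [mul_comm, ← integral_const_mul]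
    exact norm_integral_le_of_norm_le (hν.const_mul _) (Eventually.of_forall f.le_norm)

theorem BW.integralCLM_apply (hν : Integrable (fun y => W y) ν) (f : BW W) :
    BW.integralCLM hν f = ∫ y, f y ∂ν := rfl

theorem IsInvariantLaw.integrable_weight {R : Kernel E (SignedMeasure E)} {q : ℝ} (hq : 1 ≤ q)
    (h : IsInvariantLaw R W q ν) : Integrable (fun y => W y) ν :=
  h.integrable.mono' W.measurable'.aestronglyMeasurable (Eventually.of_forall fun y => by
    rw [Real.norm_of_nonneg (W.pos y).le]
    exact Real.self_le_rpow_of_one_le (W.one_le' y) hq)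

variable {R : Kernel E (SignedMeasure E)} [IsMarkovKernel R] {q : ℝ}

theorem integrable_integral_meanKernel (hq : 1 ≤ q) (hm : MomentBound R W q)
    (hν : Integrable (fun y => W y) ν) {g : E → ℂ} (hg : Measurable g) {C : ℝ}
    (hC : ∀ y, ‖g y‖ ≤ C * W y) :
    Integrable (fun x => ∫ᵛ y, g y ∂<•(meanKernel R x)) ν := by
  have h1 : (fun x => ∫ᵛ y, g y ∂<•(meanKernel R x)) =
      fun x => meanOperator R W (BW.mk g hg C hC) x := by
    funext x
    rw [meanOperator_apply hq hm]
    rfl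
  rw [h1]
  exact BW.integrable_of_weight hν _

theorem SimpleFunc.exists_norm_le_mul_weight (W : Weight E) (g : SimpleFunc E ℂ) :
    ∃ C : ℝ, ∀ y, ‖g y‖ ≤ C * W y := by
  obtain ⟨C, hC⟩ := g.exists_forall_norm_le
  exact ⟨|C|, le_mul_weight_of_bounded (abs_nonneg C) fun y => (hC y).trans (le_abs_self C)⟩

theorem IsInvariantLaw.integral_simpleFunc [IsProbabilityMeasure ν] (hq : 1 ≤ q)
    (hm : MomentBound R W q) (h : IsInvariantLaw R W q ν) (g : SimpleFunc E ℂ) :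
    ∫ x, ∫ᵛ y, g y ∂<•(meanKernel R x) ∂ν = ∫ y, g y ∂ν := by
  have hν := h.integrable_weight hq
  induction g using SimpleFunc.induction with
  | const c hs =>
    rename_i s
    have h1 : (fun y => (SimpleFunc.piecewise s hs (SimpleFunc.const E c)
        (SimpleFunc.const E 0)) y) = s.indicator fun _ => c := by
      ext y
      simp [Set.indicator, Set.piecewise]
    have h2 : ∀ x, ∫ᵛ y, (SimpleFunc.piecewise s hs (SimpleFunc.const E c)
        (SimpleFunc.const E 0)) y ∂<•(meanKernel R x) = meanKernel R x s • c := fun x => by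
      rw [h1, VectorMeasure.integral_indicator hs, VectorMeasure.setIntegral_const]
      simp
    simp only [h2]
    rw [integral_smul_const, h.invariant s hs, h1, integral_indicator_const c hs]
  | add hdisj hf hg =>
    rename_i f g
    obtain ⟨C, hC⟩ := SimpleFunc.exists_norm_le_mul_weight W f
    obtain ⟨C', hC'⟩ := SimpleFunc.exists_norm_le_mul_weight W g
    have h1 : ∀ x, ∫ᵛ y, (f + g) y ∂<•(meanKernel R x)
        = ∫ᵛ y, f y ∂<•(meanKernel R x) + ∫ᵛ y, g y ∂<•(meanKernel R x) := fun x =>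
      VectorMeasure.integral_fun_add (μ := meanKernel R x) (f := fun y => f y) (g := fun y => g y)
        (f.integrable_of_isFiniteMeasure (μ := (meanKernel R x).variation))
        (g.integrable_of_isFiniteMeasure (μ := (meanKernel R x).variation))
    simp only [h1]
    rw [integral_add (integrable_integral_meanKernel hq hm hν f.measurable hC)
      (integrable_integral_meanKernel hq hm hν g.measurable hC'), hf, hg,
      ← integral_add f.integrable_of_isFiniteMeasure g.integrable_of_isFiniteMeasure]
    rfl

/-- Invariance of `ν`, given on sets, extends to `B(W)` by dominated convergence. -/
theorem IsInvariantLaw.integralCLM_meanOperator [IsProbabilityMeasure ν] (hq : 1 ≤ q)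
    (hm : MomentBound R W q) (h : IsInvariantLaw R W q ν) (f : BW W) :
    BW.integralCLM (h.integrable_weight hq) (meanOperator R W f) =
      BW.integralCLM (h.integrable_weight hq) f := by
  have hν := h.integrable_weight hq
  rw [BW.integralCLM_apply, BW.integralCLM_apply]
  set g : ℕ → SimpleFunc E ℂ := fun n =>
    SimpleFunc.approxOn f f.measurable Set.univ 0 (Set.mem_univ _) n with hg
  have hgb : ∀ n y, ‖g n y‖ ≤ 2 * ‖f‖ * W y := fun n y => by
    have h1 := SimpleFunc.norm_approxOn_zero_le f.measurable (Set.mem_univ 0) y n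
    have h2 := f.le_norm y
    refine h1.trans ?_
    nlinarith
  have hgt : ∀ y, Tendsto (fun n => g n y) atTop (𝓝 (f y)) := fun y =>
    SimpleFunc.tendsto_approxOn _ _ (by simp)
  obtain ⟨K, hK0, hK⟩ := lintegral_meanKernel_le hq hm
  have hWM : ∀ x, Integrable (fun y => W y) (meanKernel R x).variation := fun x => by
    refine ⟨W.measurable'.aestronglyMeasurable, ?_⟩
    have := (hK x).trans_lt ENNReal.ofReal_lt_top
    simpa [HasFiniteIntegral, Real.enorm_eq_ofReal (W.pos _).le] using this
  have h1 : Tendsto (fun n => ∫ y, g n y ∂ν) atTop (𝓝 (∫ y, f y ∂ν)) :=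
    tendsto_integral_of_dominated_convergence (fun y => 2 * ‖f‖ * W y)
      (fun n => (g n).aestronglyMeasurable) (hν.const_mul _)
      (fun n => Eventually.of_forall (hgb n)) (Eventually.of_forall hgt)
  have h2 : Tendsto (fun n => ∫ x, ∫ᵛ y, g n y ∂<•(meanKernel R x) ∂ν) atTop
      (𝓝 (∫ x, meanOperator R W f x ∂ν)) := by
    refine tendsto_integral_of_dominated_convergence
      (fun x => ‖meanOperator R W‖ * (2 * ‖f‖) * W x)
      (fun n => (integrable_integral_meanKernel hq hm hν (g n).measurable (hgb n)).1)
      (hν.const_mul _) (fun n => Eventually.of_forall fun x => ?_)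
      (Eventually.of_forall fun x => ?_)
    · have h3 := meanOperator_apply hq hm (BW.mk (g n) (g n).measurable _ (hgb n)) x
      simp only [BW.mk_apply] at h3
      rw [← h3]
      refine (BW.le_norm _ x).trans (mul_le_mul_of_nonneg_right ?_ (W.pos x).le)
      refine ((meanOperator R W).le_opNorm _).trans
        (mul_le_mul_of_nonneg_left ?_ (norm_nonneg _))
      exact BW.norm_le_of _ (by positivity) (hgb n)
    · rw [meanOperator_apply hq hm]
      exact VectorMeasure.tendsto_integral_of_dominated_convergence
        (fun y => 2 * ‖f‖ * W y) (fun n => (g n).aestronglyMeasurable)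
        ((hWM x).const_mul _) (fun n => Eventually.of_forall (hgb n)) (Eventually.of_forall hgt)
  simp only [h.integral_simpleFunc hq hm] at h2
  exact tendsto_nhds_unique h2 h1

theorem meanOperator_one (hq : 1 ≤ q) (hm : MomentBound R W q) (hB : IsBalanced R) :
    meanOperator R W (1 : BW W) = 1 := by
  ext x
  rw [meanOperator_apply hq hm]
  simp only [BW.one_apply]
  have h1 : meanKernel R x Set.univ = 1 := by
    rw [meanKernel_apply hq hm x MeasurableSet.univ, integral_congr_ae (hB x)]
    simp
  rw [VectorMeasure.integral_const]
  simp [h1]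

end InvariantLaw

/-! ### Rates of convergence on `B(W)` -/

section Rates

variable {E : Type u} [MeasurableSpace E] {R : Kernel E (SignedMeasure E)} [IsMarkovKernel R]
  {W : Weight E} {q ϑ C₁ C₂ L : ℝ} {ν : Measure E}
  {X : Type u} [NormedAddCommGroup X] [NormedSpace ℂ X]

theorem weightBound_eq (m₀ : Measure E) : weightBound W q ϑ C₁ m₀ =
    max 1 (C₁ / (1 - ϑ)) * ((∫ y, W y ^ q ∂m₀) / m₀.real Set.univ) := rfl

/-- Centring `x` by a multiple of a vector representing the constant function `1` subtracts the
limit from the normalised compositions. -/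
theorem ae_urnAverage_centred (hR : HasReplacementBounds R W q ϑ C₁ C₂ L)
    (hν : Integrable (fun y => W y) ν) (ι : X →L[ℂ] BW W) {e : X} (he : ι e = 1)
    {m₀ : Measure E} [IsFiniteMeasure m₀] (hm₀ : m₀ ≠ 0)
    (hV : Integrable (fun y => W y ^ q) m₀) {Ω : Type v} [MeasurableSpace Ω] {P : Measure Ω}
    [IsProbabilityMeasure P] {Y : ℕ → Ω → E} {ρ : ℕ → Ω → SignedMeasure E}
    (h : IsMVPP R m₀ P Y ρ) (x : X) :
    ∀ᵐ ω ∂P, ∀ n, urnAverage W m₀ ρ (ι (x - (BW.integralCLM hν (ι x)) • e) : E → ℂ) n ω =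
      urnAverage W m₀ ρ (ι x : E → ℂ) n ω - ∫ y, ι x y ∂ν := by
  have hq := hR.two_le
  refine ae_all_iff.2 fun n => ?_
  obtain ⟨κ, hκ, -⟩ := h.exists_drawKernel hm₀ (hR.ae_isTame hV h) n
  filter_upwards [hκ] with ω hω
  have h1 : urnAverage W m₀ ρ ((1 : BW W) : E → ℂ) n ω = 1 := by
    have := hω.prob
    rw [← hω.integral_eq hm₀ (BW.measurable _)
      (BW.norm_apply_le_rpow (q := q) (by linarith) (1 : BW W))]
    simp
  have h2 : ι (x - (BW.integralCLM hν (ι x)) • e) = ι x + (-(BW.integralCLM hν (ι x))) • 1 := by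
    rw [map_sub, map_smul, he, neg_smul, sub_eq_add_neg]
  rw [h2, hω.urnAverage_add_mul hm₀ (by linarith), h1, BW.integralCLM_apply]
  ring

variable [IsProbabilityMeasure ν] [CompleteSpace X]

/-- The `L²` rate of convergence, with constants that do not depend on the initial composition. The
space `X` is an invariant subspace of `B(W)` or `B(W)` itself, embedded by `ι`. -/
theorem exists_sq_rate (hR : HasReplacementBounds R W q ϑ C₁ C₂ L) (hm : MomentBound R W q)
    (hν : IsInvariantLaw R W q ν) (ι : X →L[ℂ] BW W) (hι : ∀ x, ‖ι x‖ ≤ ‖x‖) {T : X →L[ℂ] X}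
    (hT : ∀ x, ι (T x) = meanOperator R W (ι x)) {e : X} (he : ι e = 1) (hTe : T e = e)
    (hS : IsSLQC T) {δ δ' : ℝ} (hδ : 0 < δ) (hδδ' : δ < δ')
    (hspec : ∀ z ∈ spectrum ℂ T, z ≠ 1 → z.re ≤ 1 - δ') :
    ∃ C : ℝ, 0 ≤ C ∧ ∀ (m₀ : Measure E) [IsFiniteMeasure m₀], m₀ ≠ 0 →
      Integrable (fun y => W y ^ q) m₀ →
      ∀ (Ω : Type v) [MeasurableSpace Ω] (P : Measure Ω) [IsProbabilityMeasure P]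
        (Y : ℕ → Ω → E) (ρ : ℕ → Ω → SignedMeasure E), IsMVPP R m₀ P Y ρ →
      ∀ x (n : ℕ), 1 ≤ n →
        ∫ ω, ‖urnAverage W m₀ ρ (ι x : E → ℂ) n ω - ∫ y, ι x y ∂ν‖ ^ 2 ∂P
          ≤ C * ((∫ y, W y ^ q ∂m₀) / m₀.real Set.univ)
            * ((m₀.real Set.univ + 1) / (m₀.real Set.univ + n)) ^ (min (2 * δ) 1) * ‖x‖ ^ 2 := by
  have hq := hR.two_le
  have hq1 : 1 ≤ q := by linarith
  have hW := hν.integrable_weight hq1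
  set ℓ : X →L[ℂ] ℂ := (BW.integralCLM hW).comp ι with hℓ
  have hℓT : ∀ x, ℓ (T x) = ℓ x := fun x => by
    change BW.integralCLM hW (ι (T x)) = BW.integralCLM hW (ι x)
    rw [hT, hν.integralCLM_meanOperator hq1 hm]
  have hℓe : ℓ e = 1 := by
    change BW.integralCLM hW (ι e) = 1
    rw [he, BW.integralCLM_apply]
    simp
  -- a contraction rate strictly above `δ`, since `min (2 * δ) 1` has to be less than twice the rate
  obtain ⟨N, C, S, hN, hNC, hstep⟩ := exists_contracting_norm hTe hℓT hℓe hS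
    (δ := (δ + δ') / 2) (by linarith) (by linarith) hspec
  obtain ⟨A, hA, hrate⟩ := exists_second_moment_le.{v} hℓT hN hNC hstep (by linarith)
    (κ := min (2 * δ) 1) (le_min (by linarith) zero_le_one) (min_le_right _ _)
    ((min_le_left _ _).trans_lt (by linarith))
  have hC := hR.nonneg_second
  set K := 1 + 2 * C₂ + 2 * ‖meanOperator R W‖ ^ 2 with hK
  set M := max 1 (C₁ / (1 - ϑ)) with hM
  have hM0 : 0 ≤ M := zero_le_one.trans (le_max_left _ _)
  refine ⟨A * K * M * (1 + ‖ℓ‖ * ‖e‖) ^ 2, by positivity, ?_⟩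
  intro m₀ _ hm₀ hV Ω _ P _ Y ρ h x n hn
  have hsch := hR.isLinearScheme hm₀ hV h ι hι hT
  set x' := x - ℓ x • e with hx'
  have hx'0 : ℓ x' = 0 := by rw [hx', map_sub, map_smul, hℓe]; simp
  have hx'n : ‖x'‖ ≤ (1 + ‖ℓ‖ * ‖e‖) * ‖x‖ := by
    have h1 := norm_sub_le x (ℓ x • e)
    rw [norm_smul] at h1
    have h2 := mul_le_mul_of_nonneg_right (ℓ.le_opNorm x) (norm_nonneg e)
    linarith
  have h1 := hrate hsch n hn x' hx'0
  have h2 : ∫ ω, ‖urnAverage W m₀ ρ (ι x : E → ℂ) n ω - ∫ y, ι x y ∂ν‖ ^ 2 ∂P =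
      ∫ ω, ‖urnAverage W m₀ ρ (ι x' : E → ℂ) n ω‖ ^ 2 ∂P := by
    refine integral_congr_ae ?_
    filter_upwards [ae_urnAverage_centred hR hW ι he hm₀ hV h x] with ω hω
    rw [← hω n]
    rfl
  rw [h2]
  refine h1.trans ?_
  have hv := one_le_average_weight hm₀ (by linarith) hV
  have hη : 0 ≤ (m₀.real Set.univ + 1) / (m₀.real Set.univ + n) := by
    have := real_univ_pos hm₀
    positivity
  rw [weightBound_eq]
  set v := (∫ y, W y ^ q ∂m₀) / m₀.real Set.univ
  set r := ((m₀.real Set.univ + 1) / (m₀.real Set.univ + n)) ^ (min (2 * δ) 1)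
  have hr : 0 ≤ r := Real.rpow_nonneg hη _
  calc A * (K * (M * v)) * r * ‖x'‖ ^ 2
      ≤ A * (K * (M * v)) * r * ((1 + ‖ℓ‖ * ‖e‖) * ‖x‖) ^ 2 := by gcongr
    _ = A * K * M * (1 + ‖ℓ‖ * ‖e‖) ^ 2 * v * r * ‖x‖ ^ 2 := by ring

theorem integral_norm_le_sqrt {Ω : Type*} {mΩ : MeasurableSpace Ω} {P : Measure Ω}
    [IsProbabilityMeasure P] {Z : Ω → ℂ} (hZ : MemLp Z 2 P) {c : ℝ}
    (h : ∫ ω, ‖Z ω‖ ^ 2 ∂P ≤ c) : ∫ ω, ‖Z ω‖ ∂P ≤ √c :=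
  Real.le_sqrt_of_sq_le ((sq_integral_norm_le hZ).trans h)

/-- The almost sure rate of convergence. -/
theorem ae_tendsto_rate (hR : HasReplacementBounds R W q ϑ C₁ C₂ L) (hm : MomentBound R W q)
    (hν : IsInvariantLaw R W q ν) (ι : X →L[ℂ] BW W) (hι : ∀ x, ‖ι x‖ ≤ ‖x‖) {T : X →L[ℂ] X}
    (hT : ∀ x, ι (T x) = meanOperator R W (ι x)) {e : X} (he : ι e = 1) (hTe : T e = e)
    (hS : IsSLQC T) {δ δ' : ℝ} (hδ : 0 < δ) (hδδ' : δ < δ') (hδ2 : δ < 1 / 2)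
    (hspec : ∀ z ∈ spectrum ℂ T, z ≠ 1 → z.re ≤ 1 - δ') {m₀ : Measure E} [IsFiniteMeasure m₀]
    (hm₀ : m₀ ≠ 0) (hV : Integrable (fun y => W y ^ q) m₀) {Ω : Type v} [MeasurableSpace Ω]
    {P : Measure Ω} [IsProbabilityMeasure P] {Y : ℕ → Ω → E} {ρ : ℕ → Ω → SignedMeasure E}
    (h : IsMVPP R m₀ P Y ρ) (x : X) :
    ∀ᵐ ω ∂P, Tendsto (fun n : ℕ => (n : ℝ) ^ δ *
      ‖urnAverage W m₀ ρ (ι x : E → ℂ) n ω - ∫ y, ι x y ∂ν‖) atTop (𝓝 0) := by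
  have hq := hR.two_le
  have hW := hν.integrable_weight (by linarith)
  -- the rate in mean has to be better than `δ` for the drift to be summable
  obtain ⟨δ'', hδ1, hδ3⟩ := exists_between (lt_min hδδ' hδ2)
  have hδ4 := hδ3.trans_le (min_le_left _ _)
  have hδ5 := hδ3.trans_le (min_le_right _ _)
  obtain ⟨C, hC0, hC⟩ := exists_sq_rate.{u, v} hR hm hν ι hι hT he hTe hS (hδ.trans hδ1) hδ4 hspec
  have hsch := hR.isLinearScheme hm₀ hV h ι hι hT
  set x' := x - BW.integralCLM hW (ι x) • e with hx'
  have hx0 : ∀ z : X, BW.integralCLM hW (ι (T z - z)) = 0 := fun z => by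
    rw [map_sub, hT, map_sub, hν.integralCLM_meanOperator (by linarith) hm, sub_self]
  have hx'0 : BW.integralCLM hW (ι x') = 0 := by
    rw [hx', map_sub, map_smul, he, map_sub, map_smul, BW.integralCLM_apply,
      BW.integralCLM_apply]
    simp
  have hs₀ := real_univ_pos hm₀
  set s₀ := m₀.real Set.univ with hs
  have hv := one_le_average_weight hm₀ (by linarith) hV
  set v := (∫ y, W y ^ q ∂m₀) / s₀ with hvdef
  have hL1 : ∀ z : X, BW.integralCLM hW (ι z) = 0 → ∀ n : ℕ, 1 ≤ n →
      ∫ ω, ‖urnAverage W m₀ ρ (ι z : E → ℂ) n ω‖ ∂P ≤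
        √(C * v * ‖z‖ ^ 2) * (s₀ + 1) ^ δ'' * (n : ℝ) ^ (-δ'') := by
    intro z hz n hn
    have hn0 : (0 : ℝ) < n := by exact_mod_cast hn
    have h1 := hC m₀ hm₀ hV Ω P Y ρ h z n hn
    rw [BW.integralCLM_apply] at hz
    simp only [hz, sub_zero] at h1
    refine (integral_norm_le_sqrt (hsch.memLp n z) h1).trans ?_
    have h2 : min (2 * δ'') 1 = δ'' * 2 := by rw [min_eq_left (by linarith), mul_comm]
    have h3 : 0 ≤ (s₀ + 1) / (s₀ + n) := by positivity
    change √(C * v * ((s₀ + 1) / (s₀ + n)) ^ (min (2 * δ'') 1) * ‖z‖ ^ 2) ≤ _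
    rw [h2, Real.rpow_mul h3, mul_right_comm (C * v), Real.sqrt_mul (by positivity),
      mul_assoc (√(C * v * ‖z‖ ^ 2))]
    refine mul_le_mul_of_nonneg_left ?_ (Real.sqrt_nonneg _)
    rw [Real.rpow_two, Real.sqrt_sq (Real.rpow_nonneg h3 _), Real.rpow_neg hn0.le,
      ← div_eq_mul_inv, ← Real.div_rpow (by positivity) hn0.le]
    refine Real.rpow_le_rpow h3 ?_ (by linarith)
    exact div_le_div_of_nonneg_left (by positivity) hn0 (by linarith)
  set A := √(C * v * ‖x'‖ ^ 2) * (s₀ + 1) ^ δ'' + √(C * v * ‖T x' - x'‖ ^ 2) * (s₀ + 1) ^ δ''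
    with hA
  have hlim := hsch.ae_tendsto_rpow_mul hδ hδ2 hδ1 (x := x') (A := A)
    (fun n hn => (hL1 x' hx'0 n hn).trans (mul_le_mul_of_nonneg_right
      (le_add_of_nonneg_right (by positivity)) (by positivity)))
    (fun n hn => (hL1 _ (hx0 x') n hn).trans (mul_le_mul_of_nonneg_right
      (le_add_of_nonneg_left (by positivity)) (by positivity)))
  filter_upwards [hlim, ae_urnAverage_centred hR hW ι he hm₀ hV h x] with ω h1 h2
  simp only [← h2]
  exact h1

end Rates

/-! ### Rates of convergence on `B(W ^ 2)` and the theorem -/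

section Truncation

variable {E : Type u} [MeasurableSpace E] {W : Weight E} {q : ℝ}

theorem BW.norm_apply_le_rpow_of_sq (hq : 2 ≤ q) (f : BW (W.pow 2)) (y : E) :
    ‖f y‖ ≤ ‖f‖ * W y ^ q := by
  refine (f.le_norm y).trans (mul_le_mul_of_nonneg_left ?_ (norm_nonneg f))
  change W y ^ 2 ≤ W y ^ q
  rw [← Real.rpow_natCast]
  exact Real.rpow_le_rpow_of_exponent_le (W.one_le' y) (by exact_mod_cast hq)

theorem norm_truncation_sq_le {c : ℝ} (hc : 0 ≤ c) (f : BW (W.pow 2)) (y : E) :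
    ‖truncation W c f y‖ ≤ c * ‖f‖ * W y := by
  have hW := W.pos y
  by_cases h : W y ≤ c
  · rw [truncation, Set.indicator_of_mem (by exact h)]
    refine (f.le_norm y).trans ?_
    change ‖f‖ * W y ^ 2 ≤ c * ‖f‖ * W y
    have h1 := mul_le_mul_of_nonneg_left h (mul_nonneg (norm_nonneg f) hW.le)
    linear_combination h1
  · rw [truncation, Set.indicator_of_notMem (by exact h), norm_zero]
    have := norm_nonneg f
    positivity

/-- A function of order `W ^ 2` truncated to `{W ≤ c}`, as an element of `B(W)`. -/
noncomputable def BW.truncate (c : ℝ) (hc : 0 ≤ c) (f : BW (W.pow 2)) : BW W :=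
  BW.mk (truncation W c f) (measurable_truncation W c f.measurable) (c * ‖f‖)
    fun y => norm_truncation_sq_le hc f y

theorem BW.norm_truncate_le {c : ℝ} (hc : 0 ≤ c) (f : BW (W.pow 2)) :
    ‖BW.truncate c hc f‖ ≤ c * ‖f‖ :=
  BW.norm_le_of _ (mul_nonneg hc (norm_nonneg f)) fun y => norm_truncation_sq_le hc f y

theorem norm_sub_truncation_le (hq : 2 ≤ q) {c : ℝ} (hc : 0 < c) (f : BW (W.pow 2)) (y : E) :
    ‖f y - truncation W c f y‖ ≤ ‖f‖ * c ^ (2 - q) * W y ^ q := by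
  have hW := W.pos y
  have hV := rpow_weight_nonneg W q y
  by_cases h : W y ≤ c
  · rw [truncation, Set.indicator_of_mem (by exact h), sub_self, norm_zero]
    have := norm_nonneg f
    positivity
  · rw [truncation, Set.indicator_of_notMem (by exact h), sub_zero, mul_assoc]
    refine (f.le_norm y).trans (mul_le_mul_of_nonneg_left ?_ (norm_nonneg f))
    change W y ^ 2 ≤ c ^ (2 - q) * W y ^ q
    have h1 : W y ^ (2 - q) ≤ c ^ (2 - q) :=
      Real.rpow_le_rpow_of_nonpos hc (not_le.1 h).le (by linarith)
    calc W y ^ 2 = W y ^ (2 - q) * W y ^ q := by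
          rw [← Real.rpow_add hW, sub_add_cancel, Real.rpow_two]
      _ ≤ c ^ (2 - q) * W y ^ q := mul_le_mul_of_nonneg_right h1 hV

theorem norm_integral_sub_truncate_le (hq : 2 ≤ q) {c : ℝ} (hc : 0 < c) (f : BW (W.pow 2))
    {κ : Measure E} (hκ : Integrable (fun y => W y ^ q) κ) :
    ‖∫ y, f y ∂κ - ∫ y, BW.truncate c hc.le f y ∂κ‖ ≤ ‖f‖ * c ^ (2 - q) * ∫ y, W y ^ q ∂κ := by
  have h1 : Integrable (f : E → ℂ) κ := (hκ.const_mul ‖f‖).mono' f.measurable.aestronglyMeasurable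
    (Eventually.of_forall (f.norm_apply_le_rpow_of_sq hq))
  have h2 : Integrable (BW.truncate c hc.le f : E → ℂ) κ :=
    h1.mono (BW.measurable _).aestronglyMeasurable
      (Eventually.of_forall fun y => norm_truncation_le W c f y)
  rw [← integral_sub h1 h2, ← integral_const_mul]
  exact norm_integral_le_of_norm_le (hκ.const_mul _)
    (Eventually.of_forall (norm_sub_truncation_le hq hc f))

variable {R : Kernel E (SignedMeasure E)} [IsMarkovKernel R] {ϑ C₁ C₂ L : ℝ}

/-- A mean square rate on `B(W)` gives a mean rate on `B(W ^ 2)`: truncate at the level of `W`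
where the two contributions are of the same order. -/
theorem HasReplacementBounds.integral_norm_le_of_sq_rate (hR : HasReplacementBounds R W q ϑ C₁ C₂ L)
    {ν : Measure E} (hν : Integrable (fun y => W y ^ q) ν)
    {m₀ : Measure E} [IsFiniteMeasure m₀] (hm₀ : m₀ ≠ 0)
    (hV : Integrable (fun y => W y ^ q) m₀) {Ω : Type v} [MeasurableSpace Ω] {P : Measure Ω}
    [IsProbabilityMeasure P] {Y : ℕ → Ω → E} {ρ : ℕ → Ω → SignedMeasure E}
    (h : IsMVPP R m₀ P Y ρ) {n : ℕ} {C κ η : ℝ} (hη : 0 < η)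
    (hC : ∀ f : BW W, ∫ ω, ‖urnAverage W m₀ ρ (f : E → ℂ) n ω - ∫ y, f y ∂ν‖ ^ 2 ∂P
      ≤ C * ((∫ y, W y ^ q ∂m₀) / m₀.real Set.univ) * η ^ κ * ‖f‖ ^ 2) (hC0 : 0 ≤ C)
    (f : BW (W.pow 2)) :
    ∫ ω, ‖urnAverage W m₀ ρ (f : E → ℂ) n ω - ∫ y, f y ∂ν‖ ∂P ≤
      (√C + max 1 (C₁ / (1 - ϑ)) + ∫ y, W y ^ q ∂ν) *
        ((∫ y, W y ^ q ∂m₀) / m₀.real Set.univ) * η ^ (κ * ((q / 2 - 1) / (q - 1))) * ‖f‖ := by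
  have hq := hR.two_le
  have hq0 : 0 ≤ q := by linarith
  have ht := hR.ae_isTame hV h
  have hv := one_le_average_weight hm₀ hq0 hV
  obtain ⟨hint, hle⟩ := hR.integral_weight_le hm₀ hV h n
  obtain ⟨K, hK, -⟩ := h.exists_drawKernel hm₀ ht n
  set v := (∫ y, W y ^ q ∂m₀) / m₀.real Set.univ
  set M := max 1 (C₁ / (1 - ϑ))
  -- the level at which the two error terms balance
  set c := η ^ (-(κ / (2 * (q - 1)))) with hc
  have hc0 : 0 < c := Real.rpow_pos_of_pos hη _
  set p := κ * ((q / 2 - 1) / (q - 1)) with hp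
  have hq1 : q - 1 ≠ 0 := by linarith
  have hcp : c ^ (2 - q) = η ^ p := by
    rw [hc, ← Real.rpow_mul hη.le]
    congr 1
    rw [hp]
    field_simp
    ring
  have hcp' : √(η ^ κ) * c = η ^ p := by
    rw [Real.sqrt_eq_rpow, ← Real.rpow_mul hη.le, hc, ← Real.rpow_add hη]
    congr 1
    rw [hp]
    field_simp
    ring
  set g := BW.truncate c hc0.le f with hg
  have hgn : ‖g‖ ≤ c * ‖f‖ := BW.norm_truncate_le hc0.le f
  have hmem := (hR.memLp_urnAverage hm₀ hV h n g).1.sub (memLp_const (∫ y, g y ∂ν))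
  have h1 : ∫ ω, ‖urnAverage W m₀ ρ (g : E → ℂ) n ω - ∫ y, g y ∂ν‖ ∂P ≤ √C * v * η ^ p * ‖f‖ := by
    refine (integral_norm_le_sqrt hmem (hC g)).trans ?_
    have h2 : √(C * v * η ^ κ * ‖g‖ ^ 2) = √C * √v * √(η ^ κ) * ‖g‖ := by
      rw [Real.sqrt_mul (by positivity), Real.sqrt_sq (norm_nonneg _),
        Real.sqrt_mul (by positivity), Real.sqrt_mul hC0]
    have h3 : √v ≤ v := by
      rw [Real.sqrt_le_left (by linarith)]
      nlinarith
    rw [h2, ← hcp']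
    calc √C * √v * √(η ^ κ) * ‖g‖ ≤ √C * v * √(η ^ κ) * (c * ‖f‖) := by gcongr
      _ = _ := by ring
  have h4 : ∀ᵐ ω ∂P, ‖urnAverage W m₀ ρ (f : E → ℂ) n ω - ∫ y, f y ∂ν‖ ≤
      ‖urnAverage W m₀ ρ (g : E → ℂ) n ω - ∫ y, g y ∂ν‖ +
        (‖f‖ * η ^ p * urnAverage W m₀ ρ (fun y => W y ^ q) n ω +
          ‖f‖ * η ^ p * ∫ y, W y ^ q ∂ν) := by
    filter_upwards [hK] with ω hω
    have h5 := norm_integral_sub_truncate_le hq hc0 f hω.integrable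
    rw [hω.integral_eq hm₀ f.measurable (f.norm_apply_le_rpow_of_sq hq),
      hω.integral_eq hm₀ (BW.measurable _) (BW.norm_apply_le_rpow (by linarith) _),
      hω.integral_eq hm₀ (measurable_rpow_weight W q) (norm_rpow_weight_le W q), hcp] at h5
    have h6 := norm_integral_sub_truncate_le hq hc0 f hν
    rw [hcp] at h6
    have h7 : urnAverage W m₀ ρ (f : E → ℂ) n ω - ∫ y, f y ∂ν =
        (urnAverage W m₀ ρ (g : E → ℂ) n ω - ∫ y, g y ∂ν) +
          ((urnAverage W m₀ ρ (f : E → ℂ) n ω - urnAverage W m₀ ρ (g : E → ℂ) n ω) -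
            (∫ y, f y ∂ν - ∫ y, g y ∂ν)) := by ring
    rw [h7]
    exact (norm_add_le _ _).trans (add_le_add le_rfl
      ((norm_sub_le _ _).trans (add_le_add h5 h6)))
  have hi1 := (hmem.integrable (by norm_num)).norm
  have hi2 : Integrable (fun ω => ‖f‖ * η ^ p * urnAverage W m₀ ρ (fun y => W y ^ q) n ω) P :=
    hint.const_mul _
  have h8 : ∫ ω, ‖urnAverage W m₀ ρ (f : E → ℂ) n ω - ∫ y, f y ∂ν‖ ∂P ≤
      ∫ ω, ‖urnAverage W m₀ ρ (g : E → ℂ) n ω - ∫ y, g y ∂ν‖ ∂P +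
        (‖f‖ * η ^ p * ∫ ω, urnAverage W m₀ ρ (fun y => W y ^ q) n ω ∂P +
          ‖f‖ * η ^ p * ∫ y, W y ^ q ∂ν) := by
    refine (integral_mono_of_nonneg (Eventually.of_forall fun ω => norm_nonneg _)
      (hi1.add (hi2.add (integrable_const _))) h4).trans (le_of_eq ?_)
    refine (integral_add hi1 (hi2.add (integrable_const _))).trans ?_
    congr 1
    refine (integral_add hi2 (integrable_const _)).trans ?_
    rw [integral_const_mul]
    simp
  have hηp : 0 ≤ η ^ p := Real.rpow_nonneg hη.le _
  have hνV : 0 ≤ ∫ y, W y ^ q ∂ν := integral_nonneg fun y => rpow_weight_nonneg W q y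
  have h9 : ‖f‖ * η ^ p * ∫ ω, urnAverage W m₀ ρ (fun y => W y ^ q) n ω ∂P ≤
      ‖f‖ * η ^ p * (M * v) := mul_le_mul_of_nonneg_left hle (by positivity)
  have h10 : ‖f‖ * η ^ p * ∫ y, W y ^ q ∂ν ≤ ‖f‖ * η ^ p * ((∫ y, W y ^ q ∂ν) * v) :=
    mul_le_mul_of_nonneg_left (le_mul_of_one_le_right hνV hv) (by positivity)
  linear_combination h8 + h1 + h9 + h10

end Truncation

end MVPP

theorem theorem2p4 {E : Type u} [MeasurableSpace E]
    (R : Kernel E (SignedMeasure E)) [IsMarkovKernel R]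
    (W : Weight E) (q : ℝ) (hq : 2 < q)
    (hpos : PositiveOffDiagonal R) (hB : IsBalanced R)
    (hHi : LyapunovDrift R W q) (hHii : MomentBound R W q)
    (ν : Measure E) [IsProbabilityMeasure ν] (hN : IsInvariantLaw R W q ν)
    (D : Submodule ℂ (BW W)) (hDc : IsClosed (D : Set (BW W)))
    (hDinv : ∀ f ∈ D, meanOperator R W f ∈ D) (hD1 : (1 : BW W) ∈ D)
    (hD : IsSLQC ((meanOperator R W).restrict hDinv)) :
    (specBound ((meanOperator R W).restrict hDinv) < 1 ∧
      ∀ δ : ℝ, 0 < δ → (δ : EReal) < 1 - specBound ((meanOperator R W).restrict hDinv) →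
        (∃ C : ℝ, ∀ (m₀ : Measure E) [IsFiniteMeasure m₀], m₀ ≠ 0 →
          Integrable (fun x => W x ^ q) m₀ →
          ∀ (Ω : Type v) [MeasurableSpace Ω] (P : Measure Ω) [IsProbabilityMeasure P]
            (Y : ℕ → Ω → E) (ρ : ℕ → Ω → SignedMeasure E), IsMVPP R m₀ P Y ρ →
          ∀ f ∈ D, ∀ n : ℕ, 1 ≤ n →
            (∀ᵐ ω ∂P, (normalized m₀ ρ n ω).Integrable f) ∧
            MemLp (fun ω => ∫ᵛ x, f x ∂<•(normalized m₀ ρ n ω)) 2 P ∧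
            ∫ ω, ‖∫ᵛ x, f x ∂<•(normalized m₀ ρ n ω) - ∫ x, f x ∂ν‖ ^ 2 ∂P
              ≤ C * ((∫ x, W x ^ q ∂m₀) / m₀.real Set.univ)
                * ((m₀.real Set.univ + 1) / (m₀.real Set.univ + n)) ^ (min (2 * δ) 1)
                * ‖f‖ ^ 2) ∧
        (δ < 1 / 2 → ∀ (m₀ : Measure E) [IsFiniteMeasure m₀], m₀ ≠ 0 →
          Integrable (fun x => W x ^ q) m₀ →
          ∀ (Ω : Type v) [MeasurableSpace Ω] (P : Measure Ω) [IsProbabilityMeasure P]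
            (Y : ℕ → Ω → E) (ρ : ℕ → Ω → SignedMeasure E), IsMVPP R m₀ P Y ρ →
          ∀ f ∈ D, ∀ᵐ ω ∂P,
            Tendsto (fun n : ℕ => (n : ℝ) ^ δ *
              ‖∫ᵛ x, f x ∂<•(normalized m₀ ρ n ω) - ∫ x, f x ∂ν‖) atTop (𝓝 0))) ∧
    (IsSLQC (meanOperator R W) →
      specBound (meanOperator R W) < 1 ∧
      ∀ δ : ℝ, 0 < δ → (δ : EReal) < 1 - specBound (meanOperator R W) →
        ∃ C : ℝ, ∀ (m₀ : Measure E) [IsFiniteMeasure m₀], m₀ ≠ 0 →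
          Integrable (fun x => W x ^ q) m₀ →
          ∀ (Ω : Type v) [MeasurableSpace Ω] (P : Measure Ω) [IsProbabilityMeasure P]
            (Y : ℕ → Ω → E) (ρ : ℕ → Ω → SignedMeasure E), IsMVPP R m₀ P Y ρ →
          ∀ (f : BW (W.pow 2)) (n : ℕ), 1 ≤ n →
            (∀ᵐ ω ∂P, (normalized m₀ ρ n ω).Integrable f) ∧
            Integrable (fun ω => ∫ᵛ x, f x ∂<•(normalized m₀ ρ n ω)) P ∧
            ∫ ω, ‖∫ᵛ x, f x ∂<•(normalized m₀ ρ n ω) - ∫ x, f x ∂ν‖ ∂P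
              ≤ C * ((∫ x, W x ^ q ∂m₀) / m₀.real Set.univ)
                * ((m₀.real Set.univ + 1) / (m₀.real Set.univ + n))
                  ^ (min (2 * δ) 1 * ((q / 2 - 1) / (q - 1)))
                * ‖f‖) := by
  have hq2 : 2 ≤ q := hq.le
  have hq0 : 0 ≤ q := by linarith
  have hq1 : 1 ≤ q := by linarith
  obtain ⟨ϑ, C₁, C₂, L, hR⟩ := exists_hasReplacementBounds hq hpos hB hHi hHii
  have hone := meanOperator_one (W := W) hq1 hHii hB
  have : CompleteSpace D := hDc.completeSpace_coe
  refine ⟨⟨specBound_lt_one hD, fun δ hδ hδD => ?_⟩, fun hS => ⟨specBound_lt_one hS,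
    fun δ hδ hδS => ?_⟩⟩
  · obtain ⟨δ', hδδ', hspec⟩ := exists_gap_of_lt_specBound hδD
    have hTe : (meanOperator R W).restrict hDinv ⟨1, hD1⟩ = ⟨1, hD1⟩ := Subtype.ext hone
    refine ⟨?_, fun hδ2 m₀ _ hm₀ hV Ω _ P _ Y ρ h f hf => ?_⟩
    · obtain ⟨C, -, hC⟩ := exists_sq_rate.{u, v} hR hHii hN D.subtypeL (fun _ => le_rfl)
        (fun _ => rfl) (e := ⟨1, hD1⟩) rfl hTe hD hδ hδδ' hspec
      refine ⟨C, fun m₀ _ hm₀ hV Ω _ P _ Y ρ h f hf n hn => ?_⟩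
      have ht := hR.ae_isTame hV h
      have heq : (fun ω => ∫ᵛ x, f x ∂<•(normalized m₀ ρ n ω)) =ᵐ[P]
          urnAverage W m₀ ρ (f : E → ℂ) n := ht.mono fun ω hω =>
        (hω.urnAverage_eq f.measurable (f.norm_apply_le_rpow hq1) n).symm
      refine ⟨ht.mono fun ω hω => hω.integrable_normalized f.measurable
        (f.norm_apply_le_rpow hq1) n,
        (memLp_congr_ae heq).2 (hR.memLp_urnAverage hm₀ hV h n f).1, ?_⟩
      exact (integral_congr_ae (heq.fun_comp fun z => ‖z - ∫ y, f y ∂ν‖ ^ 2)).trans_le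
        (hC m₀ hm₀ hV Ω P Y ρ h ⟨f, hf⟩ n hn)
    · have ht := hR.ae_isTame hV h
      filter_upwards [ht, ae_tendsto_rate hR hHii hN D.subtypeL (fun _ => le_rfl)
        (fun _ => rfl) (e := ⟨1, hD1⟩) rfl hTe hD hδ hδδ' hδ2 hspec hm₀ hV h ⟨f, hf⟩] with ω hω h1
      refine h1.congr fun n => ?_
      rw [← hω.urnAverage_eq f.measurable (f.norm_apply_le_rpow hq1) n]
      rfl
  · obtain ⟨δ', hδδ', hspec⟩ := exists_gap_of_lt_specBound hδS
    obtain ⟨C, hC0, hC⟩ := exists_sq_rate.{u, v} hR hHii hN (ContinuousLinearMap.id ℂ (BW W))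
      (fun _ => le_rfl) (fun _ => rfl) (e := 1) rfl hone hS hδ hδδ' hspec
    refine ⟨√C + max 1 (C₁ / (1 - ϑ)) + ∫ y, W y ^ q ∂ν,
      fun m₀ _ hm₀ hV Ω _ P _ Y ρ h f n hn => ?_⟩
    have ht := hR.ae_isTame hV h
    have heq : (fun ω => ∫ᵛ x, f x ∂<•(normalized m₀ ρ n ω)) =ᵐ[P]
        urnAverage W m₀ ρ (f : E → ℂ) n := ht.mono fun ω hω =>
      (hω.urnAverage_eq f.measurable (f.norm_apply_le_rpow_of_sq hq2) n).symm
    refine ⟨ht.mono fun ω hω => hω.integrable_normalized f.measurable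
      (f.norm_apply_le_rpow_of_sq hq2) n, ?_, ?_⟩
    · exact (integrable_congr heq).2 (h.integrable_urnAverage hm₀ ht hq0 n
        (hR.integral_weight_le hm₀ hV h n).1 f.measurable (norm_nonneg f)
        (f.norm_apply_le_rpow_of_sq hq2))
    · have := real_univ_pos hm₀
      refine (integral_congr_ae (heq.fun_comp fun z => ‖z - ∫ y, f y ∂ν‖)).trans_le ?_
      exact hR.integral_norm_le_of_sq_rate hN.integrable hm₀ hV h (by positivity)
        (fun g => hC m₀ hm₀ hV Ω P Y ρ h g n hn) hC0 f
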